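/- A tree decomposition of a graph $G=(V,E)$ is a rooted tree $T$ with node set $I$ together with bags $X_i\subseteq V$ ($i\in I$) that cover $V$, such that each edge lies in some bag and, for each $v\in V$, the nodes $i$ with $v\in X_i$ induce a connected subgraph of $T$. Its width is $\max_i |X_i|-1$. A bisection of $G$ is a bipartition $(A,B)$ of $V$ with $-1\le |A|-|B|\le 1$; its size is the total weight $w(A,B)$ of the edges between $A$ and $B$. The problem Max Bisection (Min Bisection) asks for a bisection of maximum (minimum) size. Running times are uniform-cost step counts of a random access machine which adds, subtracts and compares natural numbers and real numbers, has natural-number and real memory with indirect addressing, and has no real constant other than $0$. **Theorem.** (1) There are a program and a constant $C$ with the following property. Given any graph $G$ on $n$ vertices with arbitrary real edge weights $w$ (as weighted adjacency matrix) and any tree decomposition of $G$ of width $t\ge 0$ with $N$ nodes (as the array of parents and the list of the bags), the program halts with a maximum size bisection of $G$ after at most $$C\cdot\bigl(2^t(\bar t n)^2+\bar t N\bigr),\qquad \bar t=\max(t,1),$$ steps. The term $\bar t N$ accounts for reading the decomposition. In particular, Max Bisection is solved in time $O(2^t(tn)^2)$ when $t\ge 1$ and the given tree decomposition has $O(n)$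 nodes. (2) The same holds for Min Bisection. (3) Call a tree decomposition nice if every non-leaf node $i$ either has exactly one child $j$ and $X_i=X_j\cup\{v\}$ for some $v\notin X_j$, or has exactly one child $j$ and $X_j=X_i\cup\{v\}$ for some $v\notin X_i$, or has exactly two children $j,k$ and $X_i=X_j=X_k$ (a join node). For a node $i$ let $n_i$ be the sum of $|X_j|$ over $i$ and all its descendants $j$. Then for each $K$ there is a constant $C_K$ such that, for every nice tree decomposition of width $t\ge 0$ with at most $Kn$ nodes of an $n$-vertex graph, $$\sum_{i\text{ join node with children }j,k} n_j n_k\le C_K\,(\bar t n)^2 .$$ -/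

import Mathlib

namespace Bisection

/-! ## Edge-weighted graphs and bisections -/

section Graphs

variable {n : ℕ} {G : SimpleGraph (Fin n)}

open Classical in
/-- The weight of the pair `u, v`: the weight of the edge `uv`, or `0` if `u, v` are not adjacent. -/
noncomputable def pairWeight (w : G.edgeSet → ℝ) (u v : Fin n) : ℝ :=
  if h : G.Adj u v then w ⟨s(u, v), h⟩ else 0

/-- `w(A, B)`, the total weight of the edges between the disjoint sets `A` and `B`. -/
noncomputable def cutWeight (w : G.edgeSet → ℝ) (A B : Finset (Fin n)) : ℝ :=
  ∑ u ∈ A, ∑ v ∈ B, pairWeight w u v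

/-- `(A, B)` is a bipartition of the vertex set with `-1 ≤ |A| - |B| ≤ 1`. -/
def IsBisection (A B : Finset (Fin n)) : Prop :=
  Disjoint A B ∧ A ∪ B = Finset.univ ∧
    (-1 : ℤ) ≤ (A.card : ℤ) - (B.card : ℤ) ∧ (A.card : ℤ) - (B.card : ℤ) ≤ 1

/-- `(A, B)` is a bisection of maximum size. -/
def IsMaxBisection (w : G.edgeSet → ℝ) (A B : Finset (Fin n)) : Prop :=
  IsBisection A B ∧ ∀ A' B', IsBisection A' B' → cutWeight w A' B' ≤ cutWeight w A B

/-- `(A, B)` is a bisection of minimum size. -/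
def IsMinBisection (w : G.edgeSet → ℝ) (A B : Finset (Fin n)) : Prop :=
  IsBisection A B ∧ ∀ A' B', IsBisection A' B' → cutWeight w A B ≤ cutWeight w A' B'

end Graphs

/-! ## Rooted trees and tree decompositions -/

/-- A rooted tree with node set `Fin N`, given by its parent map (the root is its own parent, and
the root is reached from every node by going to the parent repeatedly). -/
structure RootedTree (N : ℕ) where
  root : Fin N
  parent : Fin N → Fin N
  parent_root : parent root = root
  reaches_root : ∀ i, ∃ k : ℕ, parent^[k] i = root

namespace RootedTree

variable {N : ℕ} (T : RootedTree N)

/-- The underlying undirected tree. -/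
def graph : SimpleGraph (Fin N) :=
  SimpleGraph.fromRel fun i j => T.parent i = j

/-- The set of children of a node. -/
def children (i : Fin N) : Finset (Fin N) :=
  Finset.univ.filter fun j => j ≠ T.root ∧ T.parent j = i

open Classical in
/-- The node `i` together with all its descendants. -/
noncomputable def subtree (i : Fin N) : Finset (Fin N) :=
  Finset.univ.filter fun j => ∃ k : ℕ, T.parent^[k] j = i

end RootedTree

/-- A tree decomposition of `G` with `N` nodes. -/
structure TreeDecomposition {n : ℕ} (G : SimpleGraph (Fin n)) (N : ℕ) where
  tree : RootedTree N
  bag : Fin N → Finset (Fin n)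
  cover : ∀ v, ∃ i, v ∈ bag i
  edge_cover : ∀ u v, G.Adj u v → ∃ i, u ∈ bag i ∧ v ∈ bag i
  connected : ∀ v, (tree.graph.induce {i | v ∈ bag i}).Connected

namespace TreeDecomposition

variable {n N : ℕ} {G : SimpleGraph (Fin n)} (D : TreeDecomposition G N)

/-- The width, that is, the maximum size of a bag minus one. -/
def width : ℤ :=
  ((Finset.univ.sup fun i => (D.bag i).card : ℕ) : ℤ) - 1

/-- `i` has exactly one child `j`, and `X_i = X_j ∪ {v}` for some `v ∉ X_j`. -/
def IsIntroduce (i : Fin N) : Prop :=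
  ∃ j v, D.tree.children i = {j} ∧ v ∉ D.bag j ∧ D.bag i = insert v (D.bag j)

/-- `i` has exactly one child `j`, and `X_j = X_i ∪ {v}` for some `v ∉ X_i`. -/
def IsForget (i : Fin N) : Prop :=
  ∃ j v, D.tree.children i = {j} ∧ v ∉ D.bag i ∧ D.bag j = insert v (D.bag i)

/-- `i` has exactly two children `j, k`, and `X_i = X_j = X_k`. -/
def IsJoin (i : Fin N) : Prop :=
  ∃ j k, j ≠ k ∧ D.tree.children i = {j, k} ∧ D.bag i = D.bag j ∧ D.bag i = D.bag k

/-- Every node that is not a leaf is an introduce, a forget or a join node. -/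
def IsNice : Prop :=
  ∀ i, D.tree.children i ≠ ∅ → D.IsIntroduce i ∨ D.IsForget i ∨ D.IsJoin i

/-- `n_i`, the sum of the bag sizes over `i` and all its descendants. -/
noncomputable def subtreeSize (i : Fin N) : ℕ :=
  ∑ j ∈ D.tree.subtree i, (D.bag j).card

open Classical in
/-- The sum over all join nodes `i`, with children `j` and `k`, of `n_j * n_k`. -/
noncomputable def joinSum : ℕ :=
  ∑ i ∈ Finset.univ.filter fun i => D.IsJoin i, ∏ j ∈ D.tree.children i, D.subtreeSize j

end TreeDecomposition

/-! ## A random access machine with natural-number and real memory, at uniform cost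

The machine has variables and arrays of natural numbers, and variables and arrays of real numbers.
All are named by natural numbers, so that a program mentions only finitely many of them; arrays are
unbounded and indexed by natural numbers. The arithmetic is addition and subtraction, the tests are
comparisons, and only natural numbers may occur as constants in a program, except for the real
number zero. Each operation and each evaluation of a test takes one step. -/

namespace RealRAM

/-- The content of the memory. -/
structure State where
  natVar : ℕ → ℕ
  natArr : ℕ → ℕ → ℕ
  realVar : ℕ → ℝ
  realArr : ℕ → ℕ → ℝ

/-- The elementary operations. -/
inductive Op where
  /-- `x := c` -/
  | const (x c : ℕ)
  /-- `x := y` -/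
  | move (x y : ℕ)
  /-- `x := y + z` -/
  | add (x y z : ℕ)
  /-- `x := max (y - z) 0` -/
  | sub (x y z : ℕ)
  /-- `x := a[i]`, where the index is the content of the variable `i` -/
  | load (x a i : ℕ)
  /-- `a[i] := x` -/
  | store (a i x : ℕ)
  /-- `x := 0` for a real variable -/
  | realZero (x : ℕ)
  /-- `x := y` for real variables -/
  | realMove (x y : ℕ)
  /-- `x := y + z` for real variables -/
  | realAdd (x y z : ℕ)
  /-- `x := y - z` for real variables -/
  | realSub (x y z : ℕ)
  /-- `x := a[i]` for a real variable `x`, a real array `a` and a natural-number variable `i` -/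
  | realLoad (x a i : ℕ)
  /-- `a[i] := x` for a real variable `x`, a real array `a` and a natural-number variable `i` -/
  | realStore (a i x : ℕ)

/-- The effect of an elementary operation on the memory. -/
noncomputable def Op.apply (s : State) : Op → State
  | .const x c => { s with natVar := Function.update s.natVar x c }
  | .move x y => { s with natVar := Function.update s.natVar x (s.natVar y) }
  | .add x y z => { s with natVar := Function.update s.natVar x (s.natVar y + s.natVar z) }
  | .sub x y z => { s with natVar := Function.update s.natVar x (s.natVar y - s.natVar z) }
  | .load x a i => { s with natVar := Function.update s.natVar x (s.natArr a (s.natVar i)) }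
  | .store a i x =>
      let b := Function.update (s.natArr a) (s.natVar i) (s.natVar x)
      { s with natArr := Function.update s.natArr a b }
  | .realZero x => { s with realVar := Function.update s.realVar x 0 }
  | .realMove x y => { s with realVar := Function.update s.realVar x (s.realVar y) }
  | .realAdd x y z =>
      { s with realVar := Function.update s.realVar x (s.realVar y + s.realVar z) }
  | .realSub x y z =>
      { s with realVar := Function.update s.realVar x (s.realVar y - s.realVar z) }
  | .realLoad x a i =>
      { s with realVar := Function.update s.realVar x (s.realArr a (s.natVar i)) }
  | .realStore a i x =>
      let b := Function.update (s.realArr a) (s.natVar i) (s.realVar x)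
      { s with realArr := Function.update s.realArr a b }

/-- The tests: `x = y` and `x < y` for natural-number variables, `x < y` for real variables. -/
inductive Test where
  | eq (x y : ℕ)
  | lt (x y : ℕ)
  | realLt (x y : ℕ)

/-- The truth value of a test. -/
def Test.Holds (s : State) : Test → Prop
  | .eq x y => s.natVar x = s.natVar y
  | .lt x y => s.natVar x < s.natVar y
  | .realLt x y => s.realVar x < s.realVar y

/-- Programs: elementary operations, sequencing, conditionals and while loops. -/
inductive Prog where
  | op (o : Op)
  | seq (p q : Prog)
  | cond (b : Test) (p q : Prog)
  | loop (b : Test) (p : Prog)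

/-- `Run p s k s'`: the program `p`, started in the memory state `s`, halts after exactly `k` steps
in the memory state `s'`. -/
inductive Run : Prog → State → ℕ → State → Prop where
  | op (o : Op) (s : State) : Run (.op o) s 1 (o.apply s)
  | seq {p q : Prog} {s s' s'' : State} {k l : ℕ} :
      Run p s k s' → Run q s' l s'' → Run (.seq p q) s (k + l) s''
  | cond_true {b : Test} {p q : Prog} {s s' : State} {k : ℕ} :
      b.Holds s → Run p s k s' → Run (.cond b p q) s (k + 1) s'
  | cond_false {b : Test} {p q : Prog} {s s' : State} {k : ℕ} :
      ¬ b.Holds s → Run q s k s' → Run (.cond b p q) s (k + 1) s'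
  | loop_true {b : Test} {p : Prog} {s s' s'' : State} {k l : ℕ} :
      b.Holds s → Run p s k s' → Run (.loop b p) s' l s'' → Run (.loop b p) s (k + l + 1) s''
  | loop_false {b : Test} {p : Prog} {s : State} :
      ¬ b.Holds s → Run (.loop b p) s 1 s

end RealRAM

/-! ## Input and output -/

section InputOutput

variable {n N : ℕ} {G : SimpleGraph (Fin n)}

/-- The parent of each node of the tree. -/
def parentArray (D : TreeDecomposition G N) (k : ℕ) : ℕ :=
  if h : k < N then (D.tree.parent ⟨k, h⟩ : ℕ) else 0

/-- The concatenation of the bags of the nodes `0, 1, …, N - 1`, each listed in increasing order. -/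
def bagArray (D : TreeDecomposition G N) (k : ℕ) : ℕ :=
  ((List.finRange N).flatMap fun i => ((D.bag i).sort (· ≤ ·)).map Fin.val).getD k 0

/-- For `k < N`, the position where the bag of the node `k` starts in `bagArray`; for `k = N`, the
total length of the bags. -/
def offsetArray (D : TreeDecomposition G N) (k : ℕ) : ℕ :=
  if k ≤ N then ∑ j ∈ Finset.univ.filter (fun j : Fin N => (j : ℕ) < k), (D.bag j).card else 0

/-- The weighted adjacency matrix, row by row. -/
noncomputable def weightArray (w : G.edgeSet → ℝ) (k : ℕ) : ℝ :=
  if h : k < n * n then pairWeight w (⟨k, h⟩ : Fin (n * n)).divNat (⟨k, h⟩ : Fin (n * n)).modNat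
  else 0

/-- The initial memory: the variables `0` and `1` hold the numbers of vertices and of nodes, the
arrays hold the tree, the bags and the edge weights, and everything else is zero. -/
noncomputable def inputState (w : G.edgeSet → ℝ) (D : TreeDecomposition G N) : RealRAM.State where
  natVar
    | 0 => n
    | 1 => N
    | _ => 0
  natArr
    | 0 => parentArray D
    | 1 => offsetArray D
    | 2 => bagArray D
    | _ => fun _ => 0
  realVar := fun _ => 0
  realArr
    | 0 => weightArray w
    | _ => fun _ => 0

/-- The output: the set of vertices `v` for which entry `v` of the array `3` is `1`. -/
def outputSet (n : ℕ) (s : RealRAM.State) : Finset (Fin n) :=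
  Finset.univ.filter fun v => s.natArr 3 v = 1

end InputOutput

end Bisection

/-! Parts (1) and (2) rest on an elimination order rather than on a nice decomposition. Order the
nodes with parents before children and number the vertices 1, …, n by first occurrence in the bags.
The bag where v is first met belongs to the topmost node containing v; let P(v) be the set of
earlier vertices in that bag, so |P(v)| ≤ t. Two subtrees that meet share the top of the lower one
(`mem_bag_top`). Hence the earlier neighbours of v all lie in P(v), and if par(v) is the last
element of P(v), the rest of P(v) lies in P(par(v)): a perfect elimination order of a chordal
supergraph (`IsDiscovery.elimination`). Greedy colouring of that supergraph gives each vertex a slot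
below some T ≤ t + 1, distinct from the slots of P(v), so a mask below 2^T can record the sides of v
and of all of P(v).

The map par, completed by a virtual root 0, is a tree on the positions. Each cut edge is charged to
its later end (`localWeight`). The positions are merged into their parents, the last one first. The
table of j holds, for each mask m and each number k, the best weight of the group merged into j when
k members other than j lie on side 1. Merging v computes new(m, k) = max over b + k₁ + k₂ = k of
table_par(m, k₁) + table_v(m with slot v set to b, k₂). `sum_localWeight_le` shows that the root
table bounds every colouring, and `IsTrace` retraces the recorded choices to attain the bound. With
k = ⌈n/2⌉ this is Max Bisection; negated weights give Min Bisection.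

For the time, merging groups of sizes x and y takes about 2^T·xy steps and raises the sum of the
squared group sizes by 2xy, so all merges take O(2^T·n²) (`sum_stageCount_mul_le`). Local weights
cost O(2^T·n²), the bit table O(T·2^T), and the passes over the decomposition O((t + 1)(n + N)).

The programs are verified in a Hoare logic with step bounds (`Tri`): expressions are compiled to
scratch registers, and what a program leaves unchanged is read off its syntax (`Frame`).

For part (3), n_j·n_k is the weight of the pairs in subtree(j) × subtree(k), a pair weighing the
product of its bag sizes. Such a pair determines the join node i as its lowest common ancestor, so
the sum is at most (Σ|X_i|)² (`joinSum_le`). -/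

namespace Bisection

namespace RealRAM

/-! ### Memory updates and agreement up to scratch registers -/

namespace State

/-- Assign to a variable. -/
def setN (s : State) (x v : ℕ) : State := { s with natVar := Function.update s.natVar x v }

/-- Assign to an entry of an array. -/
def setA (s : State) (a i v : ℕ) : State :=
  { s with natArr := Function.update s.natArr a (Function.update (s.natArr a) i v) }

/-- Assign to a real variable. -/
noncomputable def setR (s : State) (x : ℕ) (v : ℝ) : State :=
  { s with realVar := Function.update s.realVar x v }

/-- Assign to an entry of a real array. -/
noncomputable def setB (s : State) (a i : ℕ) (v : ℝ) : State :=
  { s with realArr := Function.update s.realArr a (Function.update (s.realArr a) i v) }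

section

variable (s : State) (x y a b i j v : ℕ) (r : ℝ)

@[simp] theorem setN_natVar : (s.setN x v).natVar y = if y = x then v else s.natVar y := by
  simp [setN, Function.update_apply]

@[simp] theorem setN_natArr : (s.setN x v).natArr = s.natArr := rfl

@[simp] theorem setN_realVar : (s.setN x v).realVar = s.realVar := rfl

@[simp] theorem setN_realArr : (s.setN x v).realArr = s.realArr := rfl

@[simp] theorem setA_natVar : (s.setA a i v).natVar = s.natVar := rfl

@[simp] theorem setA_natArr : (s.setA a i v).natArr b =
    if b = a then Function.update (s.natArr a) i v else s.natArr b := by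
  simp [setA, Function.update_apply]

@[simp] theorem setA_realVar : (s.setA a i v).realVar = s.realVar := rfl

@[simp] theorem setA_realArr : (s.setA a i v).realArr = s.realArr := rfl

@[simp] theorem setR_natVar : (s.setR x r).natVar = s.natVar := rfl

@[simp] theorem setR_natArr : (s.setR x r).natArr = s.natArr := rfl

@[simp] theorem setR_realVar : (s.setR x r).realVar y = if y = x then r else s.realVar y := by
  simp [setR, Function.update_apply]

@[simp] theorem setR_realArr : (s.setR x r).realArr = s.realArr := rfl

@[simp] theorem setB_natVar : (s.setB a i r).natVar = s.natVar := rfl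

@[simp] theorem setB_natArr : (s.setB a i r).natArr = s.natArr := rfl

@[simp] theorem setB_realVar : (s.setB a i r).realVar = s.realVar := rfl

@[simp] theorem setB_realArr : (s.setB a i r).realArr b =
    if b = a then Function.update (s.realArr a) i r else s.realArr b := by
  simp [setB, Function.update_apply]

end

/-- Two states agree up to the scratch registers, which are the variables from `100` on. -/
structure Sim (t s : State) : Prop where
  natVar : ∀ x < 100, t.natVar x = s.natVar x
  natArr : t.natArr = s.natArr
  realVar : ∀ x < 100, t.realVar x = s.realVar x
  realArr : t.realArr = s.realArr

theorem Sim.refl (s : State) : s.Sim s := ⟨fun _ _ => rfl, rfl, fun _ _ => rfl, rfl⟩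

theorem Sim.setN {t s : State} (h : t.Sim s) {x v w : ℕ} (hv : v = w) :
    (t.setN x v).Sim (s.setN x w) := by
  refine ⟨fun y hy => ?_, h.natArr, h.realVar, h.realArr⟩
  simp [hv, h.natVar y hy]

theorem Sim.setR {t s : State} (h : t.Sim s) {x : ℕ} {v w : ℝ} (hv : v = w) :
    (t.setR x v).Sim (s.setR x w) := by
  refine ⟨h.natVar, h.natArr, fun y hy => ?_, h.realArr⟩
  simp [hv, h.realVar y hy]

theorem Sim.setA {t s : State} (h : t.Sim s) {a i j v w : ℕ} (hi : i = j) (hv : v = w) :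
    (t.setA a i v).Sim (s.setA a j w) := by
  refine ⟨h.natVar, ?_, h.realVar, h.realArr⟩
  subst hi hv
  simp [State.setA, h.natArr]

theorem Sim.setB {t s : State} (h : t.Sim s) {a i j : ℕ} {v w : ℝ} (hi : i = j) (hv : v = w) :
    (t.setB a i v).Sim (s.setB a j w) := by
  refine ⟨h.natVar, h.natArr, h.realVar, ?_⟩
  subst hi hv
  simp [State.setB, h.realArr]

end State

/-! ### Expressions and their compilation -/

/-- Expressions for natural numbers. -/
inductive NatExpr where
  | lit (c : ℕ)
  | var (x : ℕ)
  | add (e f : NatExpr)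
  | sub (e f : NatExpr)
  | get (a : ℕ) (e : NatExpr)

namespace NatExpr

/-- The value of an expression. -/
@[simp] def eval (s : State) : NatExpr → ℕ
  | lit c => c
  | var x => s.natVar x
  | add e f => e.eval s + f.eval s
  | sub e f => e.eval s - f.eval s
  | get a e => s.natArr a (e.eval s)

/-- No scratch register occurs in the expression. -/
def ok : NatExpr → Bool
  | lit _ => true
  | var x => x < 100
  | add e f => e.ok && f.ok
  | sub e f => e.ok && f.ok
  | get _ e => e.ok

/-- The number of steps of the evaluation. -/
def cost : NatExpr → ℕ
  | lit _ => 1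
  | var _ => 1
  | add e f => e.cost + (f.cost + 1)
  | sub e f => e.cost + (f.cost + 1)
  | get _ e => e.cost + 1

/-- Evaluate an expression into the register `r`, using the registers from `r` on. -/
def code : NatExpr → ℕ → Prog
  | lit c, r => .op (.const r c)
  | var x, r => .op (.move r x)
  | add e f, r => .seq (e.code r) (.seq (f.code (r + 1)) (.op (.add r r (r + 1))))
  | sub e f, r => .seq (e.code r) (.seq (f.code (r + 1)) (.op (.sub r r (r + 1))))
  | get a e, r => .seq (e.code r) (.op (.load r a r))

theorem eval_congr {t s : State} (hv : ∀ x < 100, t.natVar x = s.natVar x)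
    (ha : t.natArr = s.natArr) :
    ∀ e : NatExpr, e.ok = true → e.eval t = e.eval s
  | lit _, _ => rfl
  | var x, h => hv x (by simpa [ok] using h)
  | add e f, h => by
    simp only [ok, Bool.and_eq_true] at h
    simp [eval_congr hv ha e h.1, eval_congr hv ha f h.2]
  | sub e f, h => by
    simp only [ok, Bool.and_eq_true] at h
    simp [eval_congr hv ha e h.1, eval_congr hv ha f h.2]
  | get a e, h => by simp [eval_congr hv ha e h, ha]

/-- The registers from `r` on serve as an evaluation stack. Preservation of all registers below `r`
keeps the left operand intact while the right one is evaluated into `r + 1`. -/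
theorem run_code : ∀ (e : NatExpr) (r : ℕ) (t : State), e.ok = true → 100 ≤ r →
    ∃ t', Run (e.code r) t e.cost t' ∧ t'.natVar r = e.eval t ∧
      (∀ x < r, t'.natVar x = t.natVar x) ∧ t'.natArr = t.natArr ∧ t'.realVar = t.realVar ∧
      t'.realArr = t.realArr
  | lit c, r, t, _, _ => ⟨_, .op _ _, by simp [Op.apply], fun x hx => by
      simp [Op.apply, hx.ne], rfl, rfl, rfl⟩
  | var y, r, t, _, _ => ⟨_, .op _ _, by simp [Op.apply], fun x hx => by
      simp [Op.apply, hx.ne], rfl, rfl, rfl⟩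
  | add e f, r, t, h, hr => by
    simp only [ok, Bool.and_eq_true] at h
    obtain ⟨t₁, h₁, v₁, x₁, a₁, b₁, c₁⟩ := run_code e r t h.1 hr
    obtain ⟨t₂, h₂, v₂, x₂, a₂, b₂, c₂⟩ := run_code f (r + 1) t₁ h.2 (by omega)
    rw [eval_congr (fun x hx => x₁ x (by omega)) a₁ f h.2] at v₂
    refine ⟨_, .seq h₁ (.seq h₂ (.op _ _)), ?_, fun x hx => ?_, a₂.trans a₁, b₂.trans b₁,
      c₂.trans c₁⟩
    · simp [Op.apply, v₂, x₂ r (by omega), v₁]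
    · simp [Op.apply, hx.ne, x₂ x (by omega), x₁ x hx]
  | sub e f, r, t, h, hr => by
    simp only [ok, Bool.and_eq_true] at h
    obtain ⟨t₁, h₁, v₁, x₁, a₁, b₁, c₁⟩ := run_code e r t h.1 hr
    obtain ⟨t₂, h₂, v₂, x₂, a₂, b₂, c₂⟩ := run_code f (r + 1) t₁ h.2 (by omega)
    rw [eval_congr (fun x hx => x₁ x (by omega)) a₁ f h.2] at v₂
    refine ⟨_, .seq h₁ (.seq h₂ (.op _ _)), ?_, fun x hx => ?_, a₂.trans a₁, b₂.trans b₁,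
      c₂.trans c₁⟩
    · simp [Op.apply, v₂, x₂ r (by omega), v₁]
    · simp [Op.apply, hx.ne, x₂ x (by omega), x₁ x hx]
  | get a e, r, t, h, hr => by
    obtain ⟨t₁, h₁, v₁, x₁, a₁, b₁, c₁⟩ := run_code e r t h hr
    refine ⟨_, .seq h₁ (.op _ _), ?_, fun x hx => ?_, a₁, b₁, c₁⟩
    · simp [Op.apply, v₁, a₁]
    · simp [Op.apply, hx.ne, x₁ x hx]

theorem exists_run {e : NatExpr} {t s : State} (h : t.Sim s) (he : e.ok = true) {r : ℕ}
    (hr : 100 ≤ r) : ∃ t', Run (e.code r) t e.cost t' ∧ t'.natVar r = e.eval s ∧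
      (∀ x < r, t'.natVar x = t.natVar x) ∧ t'.realVar = t.realVar ∧ t'.Sim s := by
  obtain ⟨t₁, h₁, v₁, x₁, a₁, b₁, c₁⟩ := run_code e r t he hr
  refine ⟨t₁, h₁, v₁.trans (eval_congr h.natVar h.natArr e he), x₁, b₁,
    fun x hx => (x₁ x (by omega)).trans (h.natVar x hx), a₁.trans h.natArr, ?_,
    c₁.trans h.realArr⟩
  rw [b₁]
  exact h.realVar

end NatExpr

/-- Expressions for real numbers. -/
inductive RealExpr where
  | zero
  | var (x : ℕ)
  | add (e f : RealExpr)
  | sub (e f : RealExpr)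
  | get (a : ℕ) (e : NatExpr)

namespace RealExpr

/-- The value of an expression. -/
@[simp] noncomputable def eval (s : State) : RealExpr → ℝ
  | zero => 0
  | var x => s.realVar x
  | add e f => e.eval s + f.eval s
  | sub e f => e.eval s - f.eval s
  | get a e => s.realArr a (e.eval s)

/-- No scratch register occurs in the expression. -/
def ok : RealExpr → Bool
  | zero => true
  | var x => x < 100
  | add e f => e.ok && f.ok
  | sub e f => e.ok && f.ok
  | get _ e => e.ok

/-- The number of steps of the evaluation. -/
def cost : RealExpr → ℕ
  | zero => 1
  | var _ => 1
  | add e f => e.cost + (f.cost + 1)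
  | sub e f => e.cost + (f.cost + 1)
  | get _ e => e.cost + 1

/-- Evaluate an expression into the register `r`, using the registers from `r` on. -/
def code : RealExpr → ℕ → Prog
  | zero, r => .op (.realZero r)
  | var x, r => .op (.realMove r x)
  | add e f, r => .seq (e.code r) (.seq (f.code (r + 1)) (.op (.realAdd r r (r + 1))))
  | sub e f, r => .seq (e.code r) (.seq (f.code (r + 1)) (.op (.realSub r r (r + 1))))
  -- Natural and real registers are separate banks, so the index may use register `100` for every
  -- `r` without disturbing real intermediate results.
  | get a e, r => .seq (e.code 100) (.op (.realLoad r a 100))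

theorem exists_run {s : State} : ∀ {e : RealExpr} {t : State}, t.Sim s → e.ok = true → ∀ {r : ℕ},
    100 ≤ r → ∃ t', Run (e.code r) t e.cost t' ∧ t'.realVar r = e.eval s ∧
      (∀ x < r, t'.realVar x = t.realVar x) ∧ t'.Sim s
  | zero, t, h, _, r, hr => ⟨_, .op _ _, by simp [Op.apply], fun x hx => by
      simp [Op.apply, hx.ne], h.natVar, h.natArr, fun x hx => by
      simp [Op.apply, (show x ≠ r by omega), h.realVar x hx], h.realArr⟩
  | var y, t, h, hy, r, hr => ⟨_, .op _ _, by
      simp [Op.apply, h.realVar y (by simpa [ok] using hy)], fun x hx => by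
      simp [Op.apply, hx.ne], h.natVar, h.natArr, fun x hx => by
      simp [Op.apply, (show x ≠ r by omega), h.realVar x hx], h.realArr⟩
  | add e f, t, h, he, r, hr => by
    simp only [ok, Bool.and_eq_true] at he
    obtain ⟨t₁, h₁, v₁, x₁, s₁⟩ := exists_run h he.1 hr
    obtain ⟨t₂, h₂, v₂, x₂, s₂⟩ := exists_run s₁ he.2 (r := r + 1) (by omega)
    refine ⟨_, .seq h₁ (.seq h₂ (.op _ _)), ?_, fun x hx => ?_, s₂.natVar, s₂.natArr,
      fun x hx => ?_, s₂.realArr⟩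
    · simp [Op.apply, v₂, x₂ r (by omega), v₁]
    · simp [Op.apply, hx.ne, x₂ x (by omega), x₁ x hx]
    · simp [Op.apply, (show x ≠ r by omega), s₂.realVar x hx]
  | sub e f, t, h, he, r, hr => by
    simp only [ok, Bool.and_eq_true] at he
    obtain ⟨t₁, h₁, v₁, x₁, s₁⟩ := exists_run h he.1 hr
    obtain ⟨t₂, h₂, v₂, x₂, s₂⟩ := exists_run s₁ he.2 (r := r + 1) (by omega)
    refine ⟨_, .seq h₁ (.seq h₂ (.op _ _)), ?_, fun x hx => ?_, s₂.natVar, s₂.natArr,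
      fun x hx => ?_, s₂.realArr⟩
    · simp [Op.apply, v₂, x₂ r (by omega), v₁]
    · simp [Op.apply, hx.ne, x₂ x (by omega), x₁ x hx]
    · simp [Op.apply, (show x ≠ r by omega), s₂.realVar x hx]
  | get a e, t, h, he, r, hr => by
    obtain ⟨t₁, h₁, v₁, x₁, b₁, s₁⟩ := NatExpr.exists_run h (e := e) he le_rfl
    refine ⟨_, .seq h₁ (.op _ _), ?_, fun x hx => ?_, s₁.natVar, s₁.natArr, fun x hx => ?_,
      s₁.realArr⟩
    · simp [Op.apply, v₁, s₁.realArr]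
    · simp [Op.apply, hx.ne, b₁]
    · simp [Op.apply, (show x ≠ r by omega), s₁.realVar x hx]

end RealExpr

/-- Comparisons of expressions. -/
inductive BoolExpr where
  | eq (e f : NatExpr)
  | lt (e f : NatExpr)
  | realLt (e f : RealExpr)

namespace BoolExpr

/-- The truth value of a comparison. -/
@[simp] def Holds (s : State) : BoolExpr → Prop
  | eq e f => e.eval s = f.eval s
  | lt e f => e.eval s < f.eval s
  | realLt e f => e.eval s < f.eval s

/-- No scratch register occurs in the comparison. -/
def ok : BoolExpr → Bool
  | eq e f => e.ok && f.ok
  | lt e f => e.ok && f.ok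
  | realLt e f => e.ok && f.ok

/-- The number of steps of the evaluation of both sides. -/
def cost : BoolExpr → ℕ
  | eq e f => e.cost + f.cost
  | lt e f => e.cost + f.cost
  | realLt e f => e.cost + f.cost

/-- Evaluate both sides into scratch registers. -/
def code : BoolExpr → Prog
  | eq e f => .seq (e.code 100) (f.code 101)
  | lt e f => .seq (e.code 100) (f.code 101)
  | realLt e f => .seq (e.code 100) (f.code 101)

/-- The test to be made after `code`. -/
def test : BoolExpr → Test
  | eq _ _ => .eq 100 101
  | lt _ _ => .lt 100 101
  | realLt _ _ => .realLt 100 101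

theorem exists_run {b : BoolExpr} {t s : State} (h : t.Sim s) (hb : b.ok = true) :
    ∃ t', Run b.code t b.cost t' ∧ (b.test.Holds t' ↔ b.Holds s) ∧ t'.Sim s := by
  cases b with
  | eq e f =>
    simp only [ok, Bool.and_eq_true] at hb
    obtain ⟨t₁, h₁, v₁, x₁, -, s₁⟩ := NatExpr.exists_run h hb.1 (r := 100) le_rfl
    obtain ⟨t₂, h₂, v₂, x₂, -, s₂⟩ := NatExpr.exists_run s₁ hb.2 (r := 101) (by omega)
    exact ⟨t₂, .seq h₁ h₂, by simp [test, Test.Holds, v₂, x₂ 100 (by omega), v₁], s₂⟩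
  | lt e f =>
    simp only [ok, Bool.and_eq_true] at hb
    obtain ⟨t₁, h₁, v₁, x₁, -, s₁⟩ := NatExpr.exists_run h hb.1 (r := 100) le_rfl
    obtain ⟨t₂, h₂, v₂, x₂, -, s₂⟩ := NatExpr.exists_run s₁ hb.2 (r := 101) (by omega)
    exact ⟨t₂, .seq h₁ h₂, by simp [test, Test.Holds, v₂, x₂ 100 (by omega), v₁], s₂⟩
  | realLt e f =>
    simp only [ok, Bool.and_eq_true] at hb
    obtain ⟨t₁, h₁, v₁, x₁, s₁⟩ := RealExpr.exists_run h hb.1 (r := 100) le_rfl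
    obtain ⟨t₂, h₂, v₂, x₂, s₂⟩ := RealExpr.exists_run s₁ hb.2 (r := 101) (by omega)
    exact ⟨t₂, .seq h₁ h₂, by simp [test, Test.Holds, v₂, x₂ 100 (by omega), v₁], s₂⟩

end BoolExpr

/-! ### Frames: the parts of the memory that a program leaves alone -/

/-- `o` writes the variable `x`. -/
def Op.writesN (x : ℕ) : Op → Bool
  | .const y _ | .move y _ | .add y _ _ | .sub y _ _ | .load y _ _ => y == x
  | _ => false

/-- `o` writes the array `a`. -/
def Op.writesA (a : ℕ) : Op → Bool
  | .store b _ _ => b == a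
  | _ => false

/-- `o` writes the real variable `x`. -/
def Op.writesR (x : ℕ) : Op → Bool
  | .realZero y | .realMove y _ | .realAdd y _ _ | .realSub y _ _ | .realLoad y _ _ => y == x
  | _ => false

/-- `o` writes the real array `a`. -/
def Op.writesB (a : ℕ) : Op → Bool
  | .realStore b _ _ => b == a
  | _ => false

/-- Some operation of the program has the property `f`. -/
def Prog.any (f : Op → Bool) : Prog → Bool
  | .op o => f o
  | .seq p q => p.any f || q.any f
  | .cond _ p q => p.any f || q.any f
  | .loop _ p => p.any f

/-- If no operation of a program changes a quantity, then the program does not change it. -/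
theorem Run.invariant {α : Type*} (F : State → α) (f : Op → Bool)
    (hF : ∀ (o : Op) (s : State), f o = false → F (o.apply s) = F s) {p : Prog} {s s' : State}
    {k : ℕ} (h : Run p s k s') (hp : p.any f = false) : F s' = F s := by
  induction h with
  | op o s => exact hF o s hp
  | seq _ _ ih₁ ih₂ =>
    simp only [Prog.any, Bool.or_eq_false_iff] at hp
    rw [ih₂ hp.2, ih₁ hp.1]
  | cond_true _ _ ih =>
    simp only [Prog.any, Bool.or_eq_false_iff] at hp
    exact ih hp.1
  | cond_false _ _ ih =>
    simp only [Prog.any, Bool.or_eq_false_iff] at hp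
    exact ih hp.2
  | loop_true _ _ _ ih₁ ih₂ => rw [ih₂ hp, ih₁ hp]
  | loop_false _ => rfl

/-- The states agree on everything that the program `p` does not write. -/
structure Frame (p : Prog) (s s' : State) : Prop where
  natVar : ∀ x < 100, p.any (Op.writesN x) = false → s'.natVar x = s.natVar x
  natArr : ∀ a, p.any (Op.writesA a) = false → s'.natArr a = s.natArr a
  realVar : ∀ x < 100, p.any (Op.writesR x) = false → s'.realVar x = s.realVar x
  realArr : ∀ a, p.any (Op.writesB a) = false → s'.realArr a = s.realArr a

theorem Frame.trans {p q r : Prog} {s s' s'' : State} (h : Frame p s s') (h' : Frame q s' s'')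
    (hr : ∀ f, r.any f = false → p.any f = false ∧ q.any f = false) : Frame r s s'' :=
  ⟨fun x hx hf => (h'.natVar x hx (hr _ hf).2).trans (h.natVar x hx (hr _ hf).1),
    fun a hf => (h'.natArr a (hr _ hf).2).trans (h.natArr a (hr _ hf).1),
    fun x hx hf => (h'.realVar x hx (hr _ hf).2).trans (h.realVar x hx (hr _ hf).1),
    fun a hf => (h'.realArr a (hr _ hf).2).trans (h.realArr a (hr _ hf).1)⟩

theorem Frame.refl (p : Prog) (s : State) : Frame p s s :=
  ⟨fun _ _ _ => rfl, fun _ _ => rfl, fun _ _ _ => rfl, fun _ _ => rfl⟩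

/-- `Run.invariant` is applied to each memory component. The conditions for leaving a component
alone are Boolean computations on the program text, so they are later discharged by `rfl` or
`decide`. -/
theorem Run.frame {p : Prog} {t t' s s' : State} {k : ℕ} (h : Run p t k t') (ht : t.Sim s)
    (ht' : t'.Sim s') : Frame p s s' where
  natVar x hx hp := by
    rw [← ht.natVar x hx, ← ht'.natVar x hx]
    refine h.invariant (fun s => s.natVar x) (Op.writesN x) (fun o s ho => ?_) hp
    cases o <;> first
      | rfl
      | (simp only [Op.writesN, beq_eq_false_iff_ne] at ho
         exact Function.update_of_ne ho.symm _ _)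
  natArr a hp := by
    rw [← ht.natArr, ← ht'.natArr]
    refine h.invariant (fun s => s.natArr a) (Op.writesA a) (fun o s ho => ?_) hp
    cases o <;> first
      | rfl
      | (simp only [Op.writesA, beq_eq_false_iff_ne] at ho
         exact Function.update_of_ne ho.symm _ _)
  realVar x hx hp := by
    rw [← ht.realVar x hx, ← ht'.realVar x hx]
    refine h.invariant (fun s => s.realVar x) (Op.writesR x) (fun o s ho => ?_) hp
    cases o <;> first
      | rfl
      | (simp only [Op.writesR, beq_eq_false_iff_ne] at ho
         exact Function.update_of_ne ho.symm _ _)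
  realArr a hp := by
    rw [← ht.realArr, ← ht'.realArr]
    refine h.invariant (fun s => s.realArr a) (Op.writesB a) (fun o s ho => ?_) hp
    cases o <;> first
      | rfl
      | (simp only [Op.writesB, beq_eq_false_iff_ne] at ho
         exact Function.update_of_ne ho.symm _ _)

/-! ### Total correctness with a bound on the number of steps -/

/-- Started in any state that agrees with `s` up to scratch registers, `p` halts after at most `B`
steps in a state that agrees up to scratch registers with one that satisfies `Q`. -/
def Tri (p : Prog) (s : State) (B : ℕ) (Q : State → Prop) : Prop :=
  ∀ t, t.Sim s → ∃ k t' s', Run p t k t' ∧ k ≤ B ∧ t'.Sim s' ∧ Q s'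

/-- `x := e` -/
def asg (x : ℕ) (e : NatExpr) : Prog := .seq (e.code 100) (.op (.move x 100))

/-- `a[i] := e` -/
def put (a : ℕ) (i e : NatExpr) : Prog :=
  .seq (i.code 100) (.seq (e.code 101) (.op (.store a 100 101)))

/-- `x := e` for a real variable `x` -/
def rasg (x : ℕ) (e : RealExpr) : Prog := .seq (e.code 100) (.op (.realMove x 100))

/-- `a[i] := e` for a real array `a` -/
def rput (a : ℕ) (i : NatExpr) (e : RealExpr) : Prog :=
  .seq (e.code 100) (.seq (i.code 100) (.op (.realStore a 100 100)))

/-- The program that does nothing. -/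
def skip : Prog := .op (.move 100 100)

/-- `if b then p else q` -/
def branch (b : BoolExpr) (p q : Prog) : Prog := .seq b.code (.cond b.test p q)

/-- `while b do p` -/
def repeatWhile (b : BoolExpr) (p : Prog) : Prog := .seq b.code (.loop b.test (.seq p b.code))

/-- `for x from 0 to y - 1 do p`, where `y` is a variable. -/
def forUp (x y : ℕ) (p : Prog) : Prog :=
  .seq (asg x (.lit 0)) (repeatWhile (.lt (.var x) (.var y))
    (.seq p (asg x (.add (.var x) (.lit 1)))))

namespace Tri

variable {p q : Prog} {s : State} {B B' : ℕ} {Q R : State → Prop}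

/-- The frame is available when the postcondition is weakened, so specifications need to mention
only what a program changes. -/
theorem mono (h : Tri p s B Q) (hB : B ≤ B') (hQ : ∀ s', Q s' → Frame p s s' → R s') :
    Tri p s B' R := by
  intro t ht
  obtain ⟨k, t', s', h₁, h₂, h₃, h₄⟩ := h t ht
  exact ⟨k, t', s', h₁, h₂.trans hB, h₃, hQ _ h₄ (h₁.frame ht h₃)⟩

theorem seq {B₁ B₂ : ℕ} (h : Tri p s B₁ R)
    (h' : ∀ s', R s' → Frame p s s' → Tri q s' B₂ Q) (hB : B₁ + B₂ ≤ B) :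
    Tri (.seq p q) s B Q := by
  intro t ht
  obtain ⟨k, t', s', h₁, h₂, h₃, h₄⟩ := h t ht
  obtain ⟨l, t'', s'', h₅, h₆, h₇, h₈⟩ := h' s' h₄ (h₁.frame ht h₃) t' h₃
  exact ⟨_, t'', s'', .seq h₁ h₅, by omega, h₇, h₈⟩

theorem skip (hB : 1 ≤ B) (h : Q s) : Tri skip s B Q := fun _ ht =>
  ⟨1, _, s, .op _ _, hB, ⟨fun x hx => by simp [Op.apply, ht.natVar x hx],
    ht.natArr, ht.realVar, ht.realArr⟩, h⟩

theorem asg {x : ℕ} {e : NatExpr} (h : Q (s.setN x (e.eval s))) (hB : e.cost + 1 ≤ B)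
    (he : e.ok = true := by rfl) : Tri (asg x e) s B Q := by
  intro t ht
  obtain ⟨t₁, h₁, v₁, -, -, s₁⟩ := NatExpr.exists_run ht he (r := 100) le_rfl
  exact ⟨_, _, _, .seq h₁ (.op _ _), hB, s₁.setN v₁, h⟩

theorem rasg {x : ℕ} {e : RealExpr} (h : Q (s.setR x (e.eval s))) (hB : e.cost + 1 ≤ B)
    (he : e.ok = true := by rfl) : Tri (rasg x e) s B Q := by
  intro t ht
  obtain ⟨t₁, h₁, v₁, -, s₁⟩ := RealExpr.exists_run ht he (r := 100) le_rfl
  exact ⟨_, _, _, .seq h₁ (.op _ _), hB, s₁.setR v₁, h⟩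

theorem put {a : ℕ} {i e : NatExpr} (h : Q (s.setA a (i.eval s) (e.eval s)))
    (hB : i.cost + e.cost + 1 ≤ B) (hi : i.ok = true := by rfl) (he : e.ok = true := by rfl) :
    Tri (put a i e) s B Q := by
  intro t ht
  obtain ⟨t₁, h₁, v₁, -, -, s₁⟩ := NatExpr.exists_run ht hi (r := 100) le_rfl
  obtain ⟨t₂, h₂, v₂, x₂, -, s₂⟩ := NatExpr.exists_run s₁ he (r := 101) (by omega)
  exact ⟨_, _, _, .seq h₁ (.seq h₂ (.op _ _)), by omega,
    s₂.setA ((x₂ 100 (by omega)).trans v₁) v₂, h⟩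

theorem rput {a : ℕ} {i : NatExpr} {e : RealExpr} (h : Q (s.setB a (i.eval s) (e.eval s)))
    (hB : i.cost + e.cost + 1 ≤ B) (hi : i.ok = true := by rfl) (he : e.ok = true := by rfl) :
    Tri (rput a i e) s B Q := by
  intro t ht
  -- The value is computed before the index, because its evaluation may overwrite the natural
  -- register `100` that must hold the index at the store.
  obtain ⟨t₁, h₁, v₁, -, s₁⟩ := RealExpr.exists_run ht he (r := 100) le_rfl
  obtain ⟨t₂, h₂, v₂, -, b₂, s₂⟩ := NatExpr.exists_run s₁ hi (r := 100) le_rfl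
  refine ⟨_, _, _, .seq h₁ (.seq h₂ (.op _ _)), by omega, s₂.setB v₂ ?_, h⟩
  rw [b₂, v₁]

/-- The state after the assignment is an explicit term. Chains of such rules amount to symbolic
execution, and `simp` evaluates the resulting state. -/
theorem seq_asg {x : ℕ} {e : NatExpr} (h : Tri q (s.setN x (e.eval s)) B' Q)
    (hB : e.cost + 1 + B' ≤ B) (he : e.ok = true := by rfl) :
    Tri (.seq (RealRAM.asg x e) q) s B Q :=
  seq (R := fun s' => s' = s.setN x (e.eval s)) (asg rfl le_rfl he)
    (fun s' hs' _ => by subst hs'; exact h) hB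

theorem seq_rasg {x : ℕ} {e : RealExpr} (h : Tri q (s.setR x (e.eval s)) B' Q)
    (hB : e.cost + 1 + B' ≤ B) (he : e.ok = true := by rfl) :
    Tri (.seq (RealRAM.rasg x e) q) s B Q :=
  seq (R := fun s' => s' = s.setR x (e.eval s)) (rasg rfl le_rfl he)
    (fun s' hs' _ => by subst hs'; exact h) hB

theorem seq_put {a : ℕ} {i e : NatExpr} (h : Tri q (s.setA a (i.eval s) (e.eval s)) B' Q)
    (hB : i.cost + e.cost + 1 + B' ≤ B) (hi : i.ok = true := by rfl)
    (he : e.ok = true := by rfl) : Tri (.seq (RealRAM.put a i e) q) s B Q :=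
  seq (R := fun s' => s' = s.setA a (i.eval s) (e.eval s)) (put rfl le_rfl hi he)
    (fun s' hs' _ => by subst hs'; exact h) hB

theorem seq_rput {a : ℕ} {i : NatExpr} {e : RealExpr}
    (h : Tri q (s.setB a (i.eval s) (e.eval s)) B' Q)
    (hB : i.cost + e.cost + 1 + B' ≤ B) (hi : i.ok = true := by rfl)
    (he : e.ok = true := by rfl) : Tri (.seq (RealRAM.rput a i e) q) s B Q :=
  seq (R := fun s' => s' = s.setB a (i.eval s) (e.eval s)) (rput rfl le_rfl hi he)
    (fun s' hs' _ => by subst hs'; exact h) hB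

theorem branch {b : BoolExpr} (h₁ : b.Holds s → Tri p s B' Q) (h₂ : ¬ b.Holds s → Tri q s B' Q)
    (hB : b.cost + 1 + B' ≤ B) (hb : b.ok = true := by rfl) : Tri (branch b p q) s B Q := by
  intro t ht
  obtain ⟨t₁, r₁, b₁, s₁⟩ := BoolExpr.exists_run ht hb
  by_cases h : b.Holds s
  · obtain ⟨k, t', s', r, hk, ht', hQ⟩ := h₁ h t₁ s₁
    exact ⟨_, t', s', .seq r₁ (.cond_true (b₁.2 h) r), by omega, ht', hQ⟩
  · obtain ⟨k, t', s', r, hk, ht', hQ⟩ := h₂ h t₁ s₁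
    exact ⟨_, t', s', .seq r₁ (.cond_false (fun hc => h (b₁.1 hc)) r), by omega, ht', hQ⟩

/-- A while loop that makes exactly `n` iterations. -/
theorem repeatWhile {b : BoolExpr} (n : ℕ) (I : ℕ → State → Prop) (B : ℕ → ℕ) (h₀ : I 0 s)
    (step : ∀ j < n, ∀ s', I j s' → Frame (repeatWhile b p) s s' →
      b.Holds s' ∧ Tri p s' (B j) (I (j + 1)))
    (final : ∀ s', I n s' → Frame (repeatWhile b p) s s' → ¬ b.Holds s')
    (hb : b.ok = true := by rfl) :
    Tri (repeatWhile b p) s (∑ j ∈ Finset.range n, (B j + b.cost + 1) + b.cost + 1) (I n) := by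
  -- Induction on the number `m` of remaining iterations, at a moment when both sides of the test
  -- already sit in the scratch registers. The frame always refers to the state before the whole
  -- loop.
  have key : ∀ m ≤ n, ∀ s' t, I (n - m) s' → Frame (RealRAM.repeatWhile b p) s s' →
      t.Sim s' → (b.test.Holds t ↔ b.Holds s') → ∃ k t' s'',
      Run (.loop b.test (.seq p b.code)) t k t' ∧
      k ≤ ∑ j ∈ Finset.Ico (n - m) n, (B j + b.cost + 1) + 1 ∧ t'.Sim s'' ∧ I n s'' := by
    intro m
    induction m with
    | zero =>
      intro _ s' t hI hF ht hbt
      exact ⟨1, t, s', .loop_false (fun h => final s' hI hF (hbt.1 h)), by simp, ht, hI⟩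
    | succ m ih =>
      intro hm s' t hI hF ht hbt
      obtain ⟨hbs, htri⟩ := step (n - (m + 1)) (by omega) s' hI hF
      obtain ⟨k, t₁, s₁, r₁, hk, ht₁, hI₁⟩ := htri t ht
      rw [show n - (m + 1) + 1 = n - m by omega] at hI₁
      obtain ⟨t₂, r₂, b₂, ht₂⟩ := BoolExpr.exists_run ht₁ hb
      have hF₁ : Frame (RealRAM.repeatWhile b p) s s₁ :=
        hF.trans (r₁.frame ht ht₁) (fun f hf => ⟨hf, by
          simp only [RealRAM.repeatWhile, Prog.any, Bool.or_eq_false_iff] at hf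
          exact hf.2.1⟩)
      obtain ⟨l, t₃, s₃, r₃, hl, ht₃, hI₃⟩ := ih (by omega) s₁ t₂ hI₁ hF₁ ht₂ b₂
      refine ⟨_, t₃, s₃, .loop_true (hbt.2 hbs) (.seq r₁ r₂) r₃, ?_, ht₃, hI₃⟩
      rw [Finset.sum_eq_sum_Ico_succ_bot (by omega), show n - (m + 1) + 1 = n - m by omega]
      omega
  intro t ht
  obtain ⟨t₁, r₁, b₁, ht₁⟩ := BoolExpr.exists_run ht hb
  obtain ⟨k, t', s', r, hk, ht', hI⟩ :=
    key n le_rfl s t₁ (by simpa using h₀) (.refl _ _) ht₁ b₁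
  refine ⟨_, t', s', .seq r₁ r, ?_, ht', hI⟩
  simp only [Nat.sub_self, Nat.Ico_zero_eq_range] at hk
  omega

/-- A for loop whose body writes neither the loop variable nor its bound. -/
theorem forUp {x y : ℕ} (n : ℕ) (I : ℕ → State → Prop) (B : ℕ → ℕ) (hn : s.natVar y = n)
    (h₀ : I 0 (s.setN x 0))
    (step : ∀ j < n, ∀ s', s'.natVar x = j → I j s' → Frame (forUp x y p) s s' →
      Tri p s' (B j) (fun s'' => I (j + 1) (s''.setN x (j + 1))))
    (hB : ∑ j ∈ Finset.range n, (B j + 7) + 5 ≤ B')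
    (hxy : (x < 100 ∧ y < 100) ∧ x ≠ y := by decide)
    (hp : p.any (Op.writesN x) = false ∧ p.any (Op.writesN y) = false := by decide) :
    Tri (forUp x y p) s B' (fun s' => I n s') := by
  obtain ⟨⟨hx, hy⟩, hne⟩ := hxy
  have hne' : y ≠ x := hne.symm
  have okx : (NatExpr.var x).ok = true := by simpa [NatExpr.ok] using hx
  have oky : (NatExpr.var y).ok = true := by simpa [NatExpr.ok] using hy
  -- Each round pays 4 steps for the increment and 3 for the test; initialising the counter takes 2
  -- steps and the last test 3.
  refine seq_asg (B' := ∑ j ∈ Finset.range n, (B j + 7) + 3) (mono (repeatWhile n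
    (fun j s' => I j s' ∧ s'.natVar x = j ∧ s'.natVar y = n) (fun j => B j + 4)
    ⟨h₀, by simp, by simp [hne', hn]⟩ ?_ ?_ ?_) ?_ (fun s' h _ => h.1)) ?_
  · rintro j hj s' ⟨hI, hxj, hyn⟩ hF
    refine ⟨by simpa [hxj, hyn] using hj, seq (B₁ := B j) (B₂ := 4) (step j hj s' hxj hI ?_)
      (fun s'' hI' hF' => asg ?_ ?_ ?_) le_rfl⟩
    · have hF₀ : Frame (RealRAM.asg x (.lit 0)) s (s.setN x 0) := by
        refine ⟨fun z _ h => ?_, fun _ _ => rfl, fun _ _ _ => rfl, fun _ _ => rfl⟩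
        simp only [RealRAM.asg, Prog.any, Op.writesN, Bool.or_eq_false_iff, beq_eq_false_iff_ne] at h
        simp [Ne.symm h.2]
      exact hF₀.trans hF (fun f hf => by
        simpa only [RealRAM.forUp, Prog.any, Bool.or_eq_false_iff] using hf)
    · have h₁ := hF'.natVar x hx hp.1
      have h₂ := hF'.natVar y hy hp.2
      simp only [NatExpr.eval, h₁, hxj]
      exact ⟨hI', by simp, by simp [hne', h₂, hyn]⟩
    · simp [NatExpr.cost]
    · simp [NatExpr.ok, hx]
  · rintro s' ⟨-, hxn, hyn⟩ -
    simp [hxn, hyn]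
  · simp [BoolExpr.ok, okx, oky]
  · simp [BoolExpr.cost, NatExpr.cost, Finset.sum_add_distrib]
    omega
  · simp [NatExpr.cost]
    omega

/-- A for loop with a uniform bound for the iterations. -/
theorem forUp_const {x y : ℕ} (n : ℕ) (I : ℕ → State → Prop) (B : ℕ) (hn : s.natVar y = n)
    (h₀ : I 0 (s.setN x 0))
    (step : ∀ j < n, ∀ s', s'.natVar x = j → I j s' → Frame (RealRAM.forUp x y p) s s' →
      Tri p s' B (fun s'' => I (j + 1) (s''.setN x (j + 1))))
    (hB : n * (B + 7) + 5 ≤ B')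
    (hxy : (x < 100 ∧ y < 100) ∧ x ≠ y := by decide)
    (hp : p.any (Op.writesN x) = false ∧ p.any (Op.writesN y) = false := by decide) :
    Tri (RealRAM.forUp x y p) s B' (fun s' => I n s') :=
  forUp n I (fun _ => B) hn h₀ step (by simpa using hB) hxy hp

theorem exists_run (h : Tri p s B Q) : ∃ k t s', Run p s k t ∧ k ≤ B ∧ t.Sim s' ∧ Q s' :=
  h s (.refl s)

end Tri

end RealRAM

/-! ### Rooted trees -/

namespace RootedTree

variable {N : ℕ} (T : RootedTree N)

theorem iterate_root (k : ℕ) : T.parent^[k] T.root = T.root := by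
  induction k with
  | zero => rfl
  | succ k ih => rw [Function.iterate_succ_apply, T.parent_root, ih]

theorem eq_root_of_parent_eq {i : Fin N} (h : T.parent i = i) : i = T.root := by
  obtain ⟨k, hk⟩ := T.reaches_root i
  rwa [Function.iterate_fixed h k] at hk

theorem mem_subtree {i j : Fin N} : j ∈ T.subtree i ↔ ∃ k, T.parent^[k] j = i := by
  simp [subtree]

theorem mem_children {i j : Fin N} : j ∈ T.children i ↔ j ≠ T.root ∧ T.parent j = i := by
  simp [children]

/-- Running through the cycle often enough exceeds the number of steps from `i` to the root, and the
iteration never leaves the root again. -/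
theorem eq_root_of_iterate_eq {i : Fin N} {k : ℕ} (hk : k ≠ 0) (h : T.parent^[k] i = i) :
    i = T.root := by
  obtain ⟨l, hl⟩ := T.reaches_root i
  have h₁ : T.parent^[k * l] i = i := by
    rw [Function.iterate_mul]
    exact Function.iterate_fixed h l
  obtain ⟨m, hm⟩ := Nat.exists_eq_add_of_le (Nat.le_mul_of_pos_left l (Nat.pos_of_ne_zero hk))
  rw [hm, Nat.add_comm, Function.iterate_add_apply, hl, iterate_root] at h₁
  exact h₁.symm

theorem subtree_antisymm {i j : Fin N} (h : i ∈ T.subtree j) (h' : j ∈ T.subtree i) : i = j := by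
  obtain ⟨k, hk⟩ := T.mem_subtree.1 h
  obtain ⟨l, hl⟩ := T.mem_subtree.1 h'
  rcases Nat.eq_zero_or_pos k with rfl | hk0
  · exact hk
  have hi : i = T.root := T.eq_root_of_iterate_eq (k := l + k) (by omega) (by
    rw [Function.iterate_add_apply, hk, hl])
  rw [← hk, hi, iterate_root]

theorem subtree_total {x i j : Fin N} (h : x ∈ T.subtree i) (h' : x ∈ T.subtree j) :
    i ∈ T.subtree j ∨ j ∈ T.subtree i := by
  obtain ⟨k, rfl⟩ := T.mem_subtree.1 h
  obtain ⟨l, rfl⟩ := T.mem_subtree.1 h'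
  simp only [mem_subtree, ← Function.iterate_add_apply]
  rcases le_total k l with hkl | hkl
  · exact .inl ⟨l - k, by rw [Nat.sub_add_cancel hkl]⟩
  · exact .inr ⟨k - l, by rw [Nat.sub_add_cancel hkl]⟩

theorem subtree_trans {x i j : Fin N} (h : x ∈ T.subtree i) (h' : i ∈ T.subtree j) :
    x ∈ T.subtree j := by
  obtain ⟨k, rfl⟩ := T.mem_subtree.1 h
  obtain ⟨l, hl⟩ := T.mem_subtree.1 h'
  exact T.mem_subtree.2 ⟨l + k, by rw [Function.iterate_add_apply, hl]⟩

theorem self_mem_subtree (i : Fin N) : i ∈ T.subtree i := T.mem_subtree.2 ⟨0, rfl⟩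

/-- A proper descendant of `i` is a descendant of a child of `i`. -/
theorem exists_child {x i : Fin N} (h : x ∈ T.subtree i) (hne : x ≠ i) :
    ∃ j ∈ T.children i, x ∈ T.subtree j := by
  obtain ⟨k, hk⟩ := T.mem_subtree.1 h
  induction k generalizing x with
  | zero => exact absurd hk hne
  | succ k ih =>
    rw [Function.iterate_succ_apply] at hk
    by_cases hp : T.parent x = i
    · refine ⟨x, T.mem_children.2 ⟨fun hr => hne ?_, hp⟩, T.self_mem_subtree x⟩
      rw [← hp, hr, T.parent_root]
    · obtain ⟨j, hj, hx⟩ := ih (T.mem_subtree.2 ⟨k, hk⟩) hp hk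
      exact ⟨j, hj, T.subtree_trans (T.mem_subtree.2 ⟨1, rfl⟩) hx⟩

/-- The subtrees of different children are disjoint. -/
theorem eq_of_mem_subtree_children {x i j k : Fin N} (hj : j ∈ T.children i)
    (hk : k ∈ T.children i) (h : x ∈ T.subtree j) (h' : x ∈ T.subtree k) : j = k := by
  -- A proper descendant `j` of `k` reaches `k` through its parent `i`; then `i` and `k` lie below
  -- each other, so `k` is its own parent and hence the root, which is no child.
  have key : ∀ {j k : Fin N}, j ∈ T.children i → k ∈ T.children i → j ∈ T.subtree k → j = k := by
    intro j k hj hk h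
    by_contra hne
    obtain ⟨l, hl, hjl⟩ := T.exists_child h hne
    rw [mem_children] at hj hk hl
    have hik : i ∈ T.subtree k := by
      obtain ⟨m, hm⟩ := T.mem_subtree.1 h
      cases m with
      | zero => exact absurd hm hne
      | succ m => exact T.mem_subtree.2 ⟨m, by rw [← hm, Function.iterate_succ_apply, hj.2]⟩
    have hki : k ∈ T.subtree i := T.mem_subtree.2 ⟨1, hk.2⟩
    have := T.subtree_antisymm hik hki
    exact hk.1 (T.eq_root_of_parent_eq (hk.2.trans this))
  rcases T.subtree_total h h' with h | h
  · exact key hj hk h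
  · exact (key hk hj h).symm

end RootedTree

/-! ### The sum over the join nodes -/

namespace TreeDecomposition

variable {n N : ℕ} {G : SimpleGraph (Fin n)} (D : TreeDecomposition G N)

theorem card_bag_le {t : ℕ} (h : D.width = t) (i : Fin N) : (D.bag i).card ≤ t + 1 := by
  have h₁ : (D.bag i).card ≤ Finset.univ.sup fun i => (D.bag i).card :=
    Finset.le_sup (f := fun i => (D.bag i).card) (Finset.mem_univ i)
  rw [width] at h
  omega

/-- Without vertices all bags are empty and the width is −1. -/
theorem pos_of_width {t : ℕ} (h : D.width = t) : 0 < n := by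
  rcases Nat.eq_zero_or_pos n with rfl | hn
  · have h₀ : (Finset.univ.sup fun i => (D.bag i).card) = 0 := by
      refine Nat.le_zero.1 (Finset.sup_le fun i _ => ?_)
      simp [Finset.eq_empty_of_isEmpty (D.bag i)]
    rw [width, h₀] at h
    omega
  · exact hn

/-- The product for a join node expands into a sum over pairs of nodes lying below its two different
children. A pair of nodes arises from at most one join node, its lowest common ancestor, so the
expanded sums are over disjoint sets of pairs. -/
theorem joinSum_le : D.joinSum ≤ (∑ i, (D.bag i).card) ^ 2 := by
  classical
  -- Fix an order of the two children of every join node; elsewhere the pair is a dummy.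
  have hex : ∀ i, ∃ p : Fin N × Fin N, D.IsJoin i → p.1 ≠ p.2 ∧ D.tree.children i = {p.1, p.2} := by
    intro i
    by_cases h : D.IsJoin i
    · obtain ⟨j, k, hne, hc, -⟩ := h
      exact ⟨(j, k), fun _ => ⟨hne, hc⟩⟩
    · exact ⟨(i, i), fun h' => absurd h' h⟩
  choose p hp using hex
  let S : Fin N → Finset (Fin N × Fin N) := fun i =>
    D.tree.subtree (p i).1 ×ˢ D.tree.subtree (p i).2
  have hprod : ∀ i, D.IsJoin i → ∏ j ∈ D.tree.children i, D.subtreeSize j =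
      ∑ x ∈ S i, (D.bag x.1).card * (D.bag x.2).card := by
    intro i hi
    rw [(hp i hi).2, Finset.prod_pair (hp i hi).1, subtreeSize, subtreeSize,
      Finset.sum_mul_sum, ← Finset.sum_product']
  have hanc : ∀ i, D.IsJoin i → ∀ x ∈ S i, x.1 ∈ D.tree.subtree i ∧ x.2 ∈ D.tree.subtree i := by
    intro i hi x hx
    have hc : ∀ j ∈ D.tree.children i, j ∈ D.tree.subtree i := fun j hj =>
      D.tree.mem_subtree.2 ⟨1, (D.tree.mem_children.1 hj).2⟩
    rw [(hp i hi).2] at hc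
    rw [Finset.mem_product] at hx
    exact ⟨D.tree.subtree_trans hx.1 (hc _ (by simp)),
      D.tree.subtree_trans hx.2 (hc _ (by simp))⟩
  -- If `i` were a proper descendant of `i'`, both components of `x` would lie below the same child
  -- of `i'`, whereas membership in `S i'` puts them below different children.
  have hsame : ∀ i i', D.IsJoin i → D.IsJoin i' → ∀ x, x ∈ S i → x ∈ S i' →
      i ∈ D.tree.subtree i' → i = i' := by
    intro i i' hi hi' x hx hx' hii
    by_contra hne
    obtain ⟨c, hc, hic⟩ := D.tree.exists_child hii hne
    have h₁ := hanc i hi x hx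
    have h' := Finset.mem_product.1 hx'
    have hch := (hp i' hi').2
    have e₁ := D.tree.eq_of_mem_subtree_children hc (k := (p i').1) (by rw [hch]; simp)
      (D.tree.subtree_trans h₁.1 hic) h'.1
    have e₂ := D.tree.eq_of_mem_subtree_children hc (k := (p i').2) (by rw [hch]; simp)
      (D.tree.subtree_trans h₁.2 hic) h'.2
    exact (hp i' hi').1 (e₁.symm.trans e₂)
  have hdisj : Set.PairwiseDisjoint
      (↑(Finset.univ.filter fun i => D.IsJoin i) : Set (Fin N)) S := by
    intro i hi i' hi' hne
    rw [Finset.mem_coe, Finset.mem_filter] at hi hi'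
    refine Finset.disjoint_left.2 fun x hx hx' => hne ?_
    rcases D.tree.subtree_total (hanc i hi.2 x hx).1 (hanc i' hi'.2 x hx').1 with h | h
    · exact hsame i i' hi.2 hi'.2 x hx hx' h
    · exact (hsame i' i hi'.2 hi.2 x hx' hx h).symm
  calc D.joinSum = ∑ i ∈ Finset.univ.filter (fun i => D.IsJoin i),
        ∑ x ∈ S i, (D.bag x.1).card * (D.bag x.2).card := by
        rw [joinSum]
        refine Finset.sum_congr (by congr) fun i hi => hprod i (Finset.mem_filter.1 hi).2
    _ = ∑ x ∈ (Finset.univ.filter (fun i => D.IsJoin i)).biUnion S,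
        (D.bag x.1).card * (D.bag x.2).card := (Finset.sum_biUnion hdisj).symm
    _ ≤ ∑ x : Fin N × Fin N, (D.bag x.1).card * (D.bag x.2).card :=
        Finset.sum_le_sum_of_subset (Finset.subset_univ _)
    _ = (∑ i, (D.bag i).card) ^ 2 := by
        rw [sq, Finset.sum_mul_sum, ← Finset.univ_product_univ, ← Finset.sum_product']

theorem sum_card_bag_le {t : ℕ} (h : D.width = t) : ∑ i, (D.bag i).card ≤ 2 * (max t 1 * N) := by
  calc ∑ i, (D.bag i).card ≤ ∑ _i : Fin N, 2 * max t 1 :=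
        Finset.sum_le_sum fun i _ => (D.card_bag_le h i).trans (by omega)
    _ = 2 * (max t 1 * N) := by simp; ring

/-- Since t + 1 ≤ 2·max(t, 1), the bags have total size at most 2·max(t, 1)·K·n, whose square gives
the factor 4K². -/
theorem joinSum_le_of_nodes_le {t K : ℕ} (h : D.width = t) (hN : N ≤ K * n) :
    D.joinSum ≤ 4 * K ^ 2 * (max t 1 * n) ^ 2 := by
  calc D.joinSum ≤ (2 * (max t 1 * (K * n))) ^ 2 :=
        D.joinSum_le.trans (Nat.pow_le_pow_left ((D.sum_card_bag_le h).trans (by gcongr)) 2)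
    _ = 4 * K ^ 2 * (max t 1 * n) ^ 2 := by ring

/-! ### Topological orders of the nodes -/

/-- If a vertex lies in the bag of `i`, and in the bag of a node that is not a descendant of `i`,
then it lies in the bag of the parent of `i`. -/
theorem mem_bag_parent {i j : Fin N} {v : Fin n} (hi : v ∈ D.bag i) (hj : v ∈ D.bag j)
    (hij : j ∉ D.tree.subtree i) : v ∈ D.bag (D.tree.parent i) := by
  obtain ⟨w⟩ := (D.connected v).preconnected ⟨i, hi⟩ ⟨j, hj⟩
  -- The walk stays among the nodes whose bags contain `v`, and the only tree edge leaving the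
  -- subtree of `i` joins `i` to its parent.
  have key : ∀ (a b : {i | v ∈ D.bag i}) (_ : (D.tree.graph.induce {i | v ∈ D.bag i}).Walk a b),
      (a : Fin N) ∈ D.tree.subtree i → (b : Fin N) ∉ D.tree.subtree i →
      v ∈ D.bag (D.tree.parent i) := by
    intro a b w
    induction w with
    | nil => exact fun h h' => absurd h h'
    | @cons a c b hac _ ih =>
      intro ha hb
      by_cases hc : (c : Fin N) ∈ D.tree.subtree i
      · exact ih hc hb
      · simp only [RootedTree.graph, SimpleGraph.comap_adj, Function.Embedding.subtype_apply,
          SimpleGraph.fromRel_adj] at hac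
        rcases hac.2 with h | h
        · obtain ⟨k, hk⟩ := D.tree.mem_subtree.1 ha
          cases k with
          | zero =>
            have hai : (a : Fin N) = i := hk
            have := c.2
            rw [Set.mem_ofPred_eq, ← h, hai] at this
            exact this
          | succ k =>
            exact absurd (D.tree.mem_subtree.2 ⟨k, by
              rw [← hk, Function.iterate_succ_apply, h]⟩) hc
        · exact absurd (D.tree.subtree_trans (D.tree.mem_subtree.2 ⟨1, h⟩) ha) hc
  exact key _ _ w (D.tree.self_mem_subtree i) hij

/-! ### Topmost nodes of vertices under a ranking of the nodes -/

section Rank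

variable {D} {rank : Fin N → ℕ} (hrank : ∀ i, i ≠ D.tree.root → rank (D.tree.parent i) < rank i)

include hrank

theorem rank_le_of_mem_subtree {i j : Fin N} (h : j ∈ D.tree.subtree i) : rank i ≤ rank j := by
  obtain ⟨k, rfl⟩ := D.tree.mem_subtree.1 h
  clear h
  induction k with
  | zero => rfl
  | succ k ih =>
    rw [Function.iterate_succ_apply']
    by_cases hr : D.tree.parent^[k] j = D.tree.root
    · rwa [hr, D.tree.parent_root, ← hr]
    · exact (hrank _ hr).le.trans ih

variable {top : Fin n → Fin N} (hmem : ∀ u, u ∈ D.bag (top u))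
  (htop : ∀ u i, u ∈ D.bag i → rank (top u) ≤ rank i) (hinj : Function.Injective rank)

include hmem htop hinj

/-- The descendants of `i` have rank at least that of `i`, while `top u` has the least rank among
the nodes containing `u`. So `top u` lies outside the subtree of `i`, and connectedness passes `u`
up to the parent. -/
theorem mem_bag_parent_of_ne_top {u : Fin n} {i : Fin N} (hu : u ∈ D.bag i) (hi : i ≠ top u) :
    u ∈ D.bag (D.tree.parent i) := by
  refine D.mem_bag_parent hu (hmem u) fun h => hi (hinj (le_antisymm ?_ (htop u i hu)))
  exact rank_le_of_mem_subtree hrank h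

/-- A common bag can be moved upwards: as long as its node is not `top v`, its rank exceeds those of
both topmost nodes, so both vertices also lie in the parent's bag. This is the source of the perfect
elimination property. -/
theorem mem_bag_top {u v : Fin n} (huv : rank (top u) ≤ rank (top v)) {i : Fin N}
    (hu : u ∈ D.bag i) (hv : v ∈ D.bag i) : u ∈ D.bag (top v) := by
  induction hk : rank i using Nat.strong_induction_on generalizing i with
  | _ k ih =>
    subst hk
    by_cases hi : i = top v
    · rwa [← hi]
    have hlt : rank (top v) < rank i :=
      lt_of_le_of_ne (htop v i hv) fun h => hi (hinj h).symm
    have hu' := mem_bag_parent_of_ne_top hrank hmem htop hinj hu (by rintro rfl; omega)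
    have hv' := mem_bag_parent_of_ne_top hrank hmem htop hinj hv hi
    have hr : i ≠ D.tree.root := by
      rintro rfl
      have := rank_le_of_mem_subtree hrank (i := D.tree.root) (j := top v)
        (D.tree.mem_subtree.2 (D.tree.reaches_root _))
      omega
    exact ih _ (hrank i hr) hu' hv' rfl

end Rank

/-! ### The input arrays -/

theorem parentArray_apply (i : Fin N) : parentArray D i = D.tree.parent i := by
  simp [parentArray]

theorem offsetArray_succ (i : Fin N) :
    offsetArray D (i + 1) = offsetArray D i + (D.bag i).card := by
  rw [offsetArray, offsetArray, if_pos (by omega), if_pos (by omega)]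
  have : Finset.univ.filter (fun j : Fin N => (j : ℕ) < i + 1) =
      insert i (Finset.univ.filter fun j : Fin N => (j : ℕ) < i) := by
    ext j
    simp only [Finset.mem_filter, Finset.mem_univ, true_and, Finset.mem_insert, Fin.ext_iff]
    omega
  rw [this, Finset.sum_insert (by simp), Nat.add_comm]

/-- The vertices of a bag in increasing order. -/
def bagList (i : Fin N) : List (Fin n) := (D.bag i).sort (· ≤ ·)

theorem length_bagList (i : Fin N) : (D.bagList i).length = (D.bag i).card := by
  simp [bagList]

theorem mem_bagList {i : Fin N} {v : Fin n} : v ∈ D.bagList i ↔ v ∈ D.bag i := by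
  simp [bagList]

theorem offsetArray_eq (k : ℕ) (hk : k ≤ N) : offsetArray D k =
    (((List.finRange N).take k).flatMap fun i => (D.bagList i).map Fin.val).length := by
  induction k with
  | zero => simp [offsetArray]
  | succ k ih =>
    have := D.offsetArray_succ ⟨k, hk⟩
    simp only at this
    rw [this, ih (by omega), List.take_add_one, List.flatMap_append, List.length_append]
    have hk' : k < (List.finRange N).length := by simpa using hk
    simp [List.getElem?_eq_getElem hk', length_bagList]

theorem bagArray_apply (i : Fin N) {r : ℕ} (hr : r < (D.bag i).card) :
    bagArray D (offsetArray D i + r) = (D.bagList i)[r]'(by rwa [length_bagList]) := by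
  have hi : (i : ℕ) < (List.finRange N).length := by simp
  have hsplit : List.finRange N = (List.finRange N).take i ++ i :: (List.finRange N).drop (i + 1) := by
    conv_lhs => rw [← List.take_append_drop i (List.finRange N), List.drop_eq_getElem_cons hi]
    simp
  have hdef : bagArray D (offsetArray D i + r) = ((List.finRange N).flatMap fun i =>
      (D.bagList i).map Fin.val).getD (offsetArray D i + r) 0 := rfl
  have hr' : r < ((D.bagList i).map Fin.val).length := by simpa [length_bagList] using hr
  rw [hdef, D.offsetArray_eq i i.2.le]
  conv_lhs => rw [hsplit, List.flatMap_append, List.flatMap_cons, ← hsplit]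
  rw [List.getD_append_right _ _ _ _ (Nat.le_add_right _ _), Nat.add_sub_cancel_left,
    List.getD_append _ _ _ _ hr', List.getD_eq_getElem _ _ hr', List.getElem_map]

end TreeDecomposition

/-! ### Bits -/

/-- The binary digit of `m` in position `s`. -/
def bit (m s : ℕ) : ℕ := m / 2 ^ s % 2

/-- Change the binary digit of `m` in position `s` to `b`. -/
def setBit (m s b : ℕ) : ℕ :=
  if bit m s = b then m else if b = 0 then m - 2 ^ s else m + 2 ^ s

theorem bit_lt (m s : ℕ) : bit m s < 2 := Nat.mod_lt _ two_pos

theorem bit_of_lt {m s : ℕ} (h : m < 2 ^ s) : bit m s = 0 := by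
  simp [bit, Nat.div_eq_of_lt h]

theorem bit_of_lt_succ {m s : ℕ} (h : 2 ^ s ≤ m) (h' : m < 2 ^ (s + 1)) : bit m s = 1 := by
  rw [bit, Nat.div_eq_of_lt_le (k := 1) (by omega) (by rw [pow_succ] at h'; omega)]

/-- Digit `s` is periodic in `m` with period 2^(s + 1). This is the recurrence by which `bitStep`
tabulates digits without division. -/
theorem bit_sub {m s : ℕ} (h : 2 ^ (s + 1) ≤ m) : bit (m - 2 ^ (s + 1)) s = bit m s := by
  obtain ⟨l, rfl⟩ := Nat.exists_eq_add_of_le h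
  rw [Nat.add_sub_cancel_left, bit, bit, pow_succ, Nat.mul_comm, Nat.add_comm,
    Nat.add_mul_div_right _ _ (by positivity)]
  omega

/-- Adding to a zero digit produces no carry. -/
theorem bit_add_two_pow {m s : ℕ} (h : bit m s = 0) (s' : ℕ) :
    bit (m + 2 ^ s) s' = if s' = s then 1 else bit m s' := by
  have hs : (m + 2 ^ s) / 2 ^ s = m / 2 ^ s + 1 := Nat.add_div_right _ (by positivity)
  rcases lt_trichotomy s' s with hlt | rfl | hlt
  · obtain ⟨d, rfl⟩ := Nat.exists_eq_add_of_lt hlt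
    rw [if_neg (by omega), bit, bit, show 2 ^ (s' + d + 1) = 2 * 2 ^ d * 2 ^ s' by ring,
      Nat.add_mul_div_right _ _ (by positivity), Nat.add_mul_mod_self_left]
  · rw [bit] at h
    rw [if_pos rfl, bit, hs]
    omega
  · obtain ⟨d, rfl⟩ := Nat.exists_eq_add_of_lt hlt
    rw [bit] at h
    rw [if_neg (by omega), bit, bit, show 2 ^ (s + d + 1) = 2 ^ s * (2 * 2 ^ d) by ring,
      ← Nat.div_div_eq_div_mul, ← Nat.div_div_eq_div_mul, hs, ← Nat.div_div_eq_div_mul,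
      ← Nat.div_div_eq_div_mul, show (m / 2 ^ s + 1) / 2 = m / 2 ^ s / 2 by omega]

theorem two_pow_le_of_bit {m s : ℕ} (h : bit m s ≠ 0) : 2 ^ s ≤ m := by
  by_contra hlt
  exact h (bit_of_lt (by omega))

theorem bit_sub_two_pow {m s : ℕ} (h : bit m s = 1) (s' : ℕ) :
    bit (m - 2 ^ s) s' = if s' = s then 0 else bit m s' := by
  obtain ⟨l, rfl⟩ := Nat.exists_eq_add_of_le' (two_pow_le_of_bit (m := m) (s := s) (by omega))
  rw [Nat.add_sub_cancel]
  have hl : bit l s = 0 := by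
    rw [bit, Nat.add_div_right _ (by positivity)] at h
    rw [bit]
    omega
  rw [bit_add_two_pow hl]
  split_ifs with h'
  · rw [h', hl]
  · rfl

theorem bit_setBit (m s s' : ℕ) {b : ℕ} (hb : b < 2) :
    bit (setBit m s b) s' = if s' = s then b else bit m s' := by
  have := bit_lt m s
  rw [setBit]
  by_cases h₁ : bit m s = b
  · rw [if_pos h₁]
    split_ifs with h₂
    · rw [h₂, h₁]
    · rfl
  · rw [if_neg h₁]
    by_cases h₂ : b = 0
    · rw [if_pos h₂, bit_sub_two_pow (by omega), h₂]
    · rw [if_neg h₂, bit_add_two_pow (by omega), show b = 1 by omega]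

theorem setBit_lt {m s b T : ℕ} (hm : m < 2 ^ T) (hs : s < T) (hb : b < 2) : setBit m s b < 2 ^ T := by
  have h₂ := bit_lt m s
  rw [setBit]
  split_ifs with h₁ h₃
  · exact hm
  · exact (Nat.sub_le _ _).trans_lt hm
  · have h₀ : m / 2 ^ s % 2 = 0 := by
      rw [bit] at h₁ h₂
      omega
    obtain ⟨d, rfl⟩ := Nat.exists_eq_add_of_lt hs
    have hp : 2 ^ (s + d + 1) = 2 ^ s * (2 * 2 ^ d) := by ring
    have h₄ : m / 2 ^ s < 2 * 2 ^ d := Nat.div_lt_of_lt_mul (by rwa [← hp])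
    have h₅ : (m + 2 ^ s) / 2 ^ s < 2 * 2 ^ d := by
      rw [Nat.add_div_right _ (by positivity)]
      omega
    rw [hp, Nat.mul_comm]
    exact (Nat.div_lt_iff_lt_mul (by positivity)).1 h₅

/-! ### Elimination orders -/

/-- An elimination order of the positions `1, …, n` with earlier neighbourhoods `P`: the position
`par v` is the last one in `P v`, and the numbers `slot v < T` colour the filled graph. The position
`0` is a virtual root. -/
structure Elimination (n T : ℕ) (P : ℕ → Finset ℕ) (par slot : ℕ → ℕ) : Prop where
  par_lt : ∀ v, 1 ≤ v → v ≤ n → par v < v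
  mem : ∀ v, 1 ≤ v → v ≤ n → ∀ u ∈ P v, 1 ≤ u ∧ u < v
  filled : ∀ v, 1 ≤ v → v ≤ n → ∀ u ∈ P v, u = par v ∨ 1 ≤ par v ∧ u ∈ P (par v)
  slot_ne : ∀ v, 1 ≤ v → v ≤ n → ∀ u ∈ P v, slot u ≠ slot v
  slot_lt : ∀ v, 1 ≤ v → v ≤ n → slot v < T

/-- The weight of the pairs `u, j` with `u < j` that are coloured differently. -/
noncomputable def localWeight (ω : ℕ → ℕ → ℝ) (c : ℕ → ℕ) (j : ℕ) : ℝ :=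
  ∑ u ∈ Finset.Ico 1 j, if c u = c j then 0 else ω u j

/-- The table that belongs to the position `j` after `a` merges; the merge of the position `v` with
its parent makes the table `n + v`. -/
def stageTable (n : ℕ) (par : ℕ → ℕ) : ℕ → ℕ → ℕ
  | 0, j => j
  | a + 1, j => if j = par (n - a) then n + (n - a) else stageTable n par a j

/-- The number of positions that have been merged into `j` after `a` merges. -/
def stageCount (n : ℕ) (par : ℕ → ℕ) : ℕ → ℕ → ℕ
  | 0, _ => 0
  | a + 1, j => stageCount n par a j +
      if j = par (n - a) then stageCount n par a (n - a) + 1 else 0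

/-- The row `h` is, as far as the triples in `Z` are concerned, the maximum of `f k₁ + g b k₂` over
all `b + k₁ + k₂ = k`, with `B` and `M` recording where the maximum is attained. -/
structure MergedRow (f : ℕ → ℝ) (g : ℕ → ℕ → ℝ) (p q : ℕ) (h : ℕ → ℝ) (B M : ℕ → ℕ)
    (Z : ℕ → ℕ → ℕ → Prop) : Prop where
  upper : ∀ b k₁ k₂, Z b k₁ k₂ → f k₁ + g b k₂ ≤ h (b + k₁ + k₂) ∧ B (b + k₁ + k₂) ≠ 0
  attained : ∀ k ≤ p + q + 1, B k ≠ 0 → ∃ b k₁ k₂, b < 2 ∧ k₁ ≤ p ∧ k₂ ≤ q ∧ k = b + k₁ + k₂ ∧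
    B k = b + 1 ∧ M k = k₂ ∧ h k = f k₁ + g b k₂

/-- The table `n + v` is the result of merging the position `v` with its parent. -/
def IsMerged (n T : ℕ) (par slot : ℕ → ℕ) (V : ℕ → ℕ → ℕ → ℝ) (B M : ℕ → ℕ → ℕ → ℕ) (v : ℕ) :
    Prop :=
  ∀ m < 2 ^ T, MergedRow (V (stageTable n par (n - v) (par v)) m)
    (fun b => V (stageTable n par (n - v) v) (setBit m (slot v) b))
    (stageCount n par (n - v) (par v)) (stageCount n par (n - v) v)
    (V (n + v) m) (B (n + v) m) (M (n + v) m)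
    (fun b k₁ k₂ => b < 2 ∧ k₁ ≤ stageCount n par (n - v) (par v) ∧
      k₂ ≤ stageCount n par (n - v) v)

/-- Only the entries up to `p`, `q` and `p + q + 1` matter, so the property survives writes to the
memory elsewhere. -/
theorem MergedRow.congr {f f' : ℕ → ℝ} {g g' : ℕ → ℕ → ℝ} {p q : ℕ} {h h' : ℕ → ℝ}
    {B B' M M' : ℕ → ℕ} {Z Z' : ℕ → ℕ → ℕ → Prop} (H : MergedRow f g p q h B M Z)
    (hZ : ∀ b k₁ k₂, Z' b k₁ k₂ → Z b k₁ k₂ ∧ b < 2 ∧ k₁ ≤ p ∧ k₂ ≤ q)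
    (hf : ∀ k ≤ p, f' k = f k) (hg : ∀ b < 2, ∀ k ≤ q, g' b k = g b k)
    (hh : ∀ k ≤ p + q + 1, h' k = h k ∧ B' k = B k ∧ M' k = M k) :
    MergedRow f' g' p q h' B' M' Z' where
  upper b k₁ k₂ hz := by
    obtain ⟨hz, hb, h₁, h₂⟩ := hZ b k₁ k₂ hz
    obtain ⟨e₁, e₂, -⟩ := hh (b + k₁ + k₂) (by omega)
    rw [hf k₁ h₁, hg b hb k₂ h₂, e₁, e₂]
    exact H.upper b k₁ k₂ hz
  attained k hk hB := by
    obtain ⟨e₁, e₂, e₃⟩ := hh k hk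
    rw [e₂] at hB
    obtain ⟨b, k₁, k₂, hb, h₁, h₂, h₃, h₄, h₅, h₆⟩ := H.attained k hk hB
    exact ⟨b, k₁, k₂, hb, h₁, h₂, h₃, e₂.trans h₄, e₃.trans h₅, by
      rw [e₁, h₆, hf k₁ h₁, hg b hb k₂ h₂]⟩

/-! ### Correctness and total size of the merges along an elimination order -/

section Stages

variable {n T : ℕ} {P : ℕ → Finset ℕ} {par slot : ℕ → ℕ}

theorem stageTable_succ {a v : ℕ} (h : a + v = n) (j : ℕ) :
    stageTable n par (a + 1) j = if j = par v then n + v else stageTable n par a j := by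
  rw [stageTable, show n - a = v by omega]

theorem stageCount_succ {a v : ℕ} (h : a + v = n) (j : ℕ) :
    stageCount n par (a + 1) j = stageCount n par a j +
      if j = par v then stageCount n par a v + 1 else 0 := by
  rw [stageCount, show n - a = v by omega]

/-- The next merge writes the table `n + (n - a)`. By this dichotomy that table is fresh: a
remaining position uses its initial table or one with a larger number. -/
theorem stageTable_or (a j : ℕ) (ha : a ≤ n) :
    stageTable n par a j = j ∨
      n + (n - a) < stageTable n par a j ∧ stageTable n par a j ≤ n + n := by
  induction a with
  | zero => exact .inl rfl
  | succ a ih =>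
    rw [stageTable]
    split_ifs with h
    · omega
    · rcases ih (by omega) with h' | h'
      · exact .inl h'
      · omega

/-- Isolate the summand of the position `p`. -/
theorem sum_range_eq_erase_add {α : Type*} [AddCommMonoid α] {v p : ℕ} (hp : p < v) {f g : ℕ → α}
    (h : ∀ j < v, j ≠ p → f j = g j) :
    ∑ j ∈ Finset.range v, f j = ∑ j ∈ (Finset.range v).erase p, g j + f p := by
  rw [← Finset.sum_erase_add _ _ (Finset.mem_range.2 hp)]
  congr 1
  refine Finset.sum_congr rfl fun j hj => ?_
  rw [Finset.mem_erase, Finset.mem_range] at hj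
  exact h j hj.2 hj.1

variable (E : Elimination n T P par slot)

include E

/-- `stageCount n par a j + 1` is the size of the group of `j`, and the groups of the remaining
positions 0, …, v partition 0, …, n. -/
theorem sum_stageCount (a v : ℕ) (h : a + v = n) :
    ∑ j ∈ Finset.range (v + 1), (stageCount n par a j + 1) = n + 1 := by
  induction a generalizing v with
  | zero => simp_all [stageCount]
  | succ a ih =>
    rw [← ih (v + 1) (by omega), Finset.sum_range_succ _ (v + 1)]
    have hp := E.par_lt (v + 1) (by omega) (by omega)
    rw [sum_range_eq_erase_add hp (g := fun j => stageCount n par a j + 1) (fun j _ hj => by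
        rw [stageCount_succ (show a + (v + 1) = n by omega), if_neg hj, Nat.add_zero]),
      stageCount_succ (show a + (v + 1) = n by omega), if_pos rfl,
      ← Finset.sum_erase_add _ _ (Finset.mem_range.2 hp)]
    omega

theorem stageCount_le {a v j : ℕ} (h : a + v = n) (hj : j ≤ v) : stageCount n par a j ≤ n := by
  have h₁ := sum_stageCount E a v h
  have h₂ := Finset.single_le_sum (f := fun j => stageCount n par a j + 1)
    (fun _ _ => Nat.zero_le _) (Finset.mem_range.2 (show j < v + 1 by omega))
  omega

/-- The left side is the largest index in the row created by merging `v`, so rows of length n + 1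
suffice. -/
theorem stageCount_add_le {a v : ℕ} (h : a + v = n) (hv : 1 ≤ v) :
    stageCount n par a (par v) + stageCount n par a v + 1 ≤ n := by
  have hp := E.par_lt v hv (by omega)
  have h₁ := stageCount_le E (a := a + 1) (v := v - 1) (j := par v) (by omega) (by omega)
  rwa [stageCount_succ h, if_pos rfl, ← Nat.add_assoc] at h₁

theorem stageCount_last : stageCount n par n 0 = n := by
  have h₁ := sum_stageCount E n 0 (by omega)
  simpa using h₁

/-- The sum of the squared group sizes is a potential: uniting groups of sizes x and y raises it by
(x + y)² − x² − y² = 2xy, twice the term added on the left. -/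
theorem sum_stageCount_sq (a v : ℕ) (h : a + v = n) :
    2 * ∑ i ∈ Finset.range a, (stageCount n par i (par (n - i)) + 1) *
        (stageCount n par i (n - i) + 1) ≤
      ∑ j ∈ Finset.range (v + 1), (stageCount n par a j + 1) ^ 2 := by
  induction a generalizing v with
  | zero => simp
  | succ a ih =>
    have h₁ := ih (v + 1) (by omega)
    have hp := E.par_lt (v + 1) (by omega) (by omega)
    rw [Finset.sum_range_succ _ (v + 1), ← Finset.sum_erase_add _ _ (Finset.mem_range.2 hp)] at h₁
    rw [Finset.sum_range_succ, show n - a = v + 1 by omega,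
      sum_range_eq_erase_add hp (g := fun j => (stageCount n par a j + 1) ^ 2) (fun j _ hj => by
        rw [stageCount_succ (show a + (v + 1) = n by omega), if_neg hj, Nat.add_zero]),
      stageCount_succ (show a + (v + 1) = n by omega), if_pos rfl]
    nlinarith

theorem sum_stageCount_mul_le :
    ∑ i ∈ Finset.range n, (stageCount n par i (par (n - i)) + 1) *
        (stageCount n par i (n - i) + 1) ≤ (n + 1) ^ 2 := by
  have h₁ := sum_stageCount_sq E n 0 (by omega)
  have h₂ := stageCount_last E
  simp only [zero_add, Finset.sum_range_one, h₂] at h₁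
  omega

variable {ω : ℕ → ℕ → ℝ} {y : ℕ → ℕ}

omit E in
/-- The local weight can be computed from a mask that agrees with the colouring on `P j` and `j`. -/
theorem localWeight_eq (hω : ∀ j, 1 ≤ j → j ≤ n → ∀ u, 1 ≤ u → u < j → u ∉ P j → ω u j = 0)
    {m j : ℕ} (hj : 1 ≤ j) (hjn : j ≤ n)
    (hm : ∀ u, u = j ∨ u ∈ P j → bit m (slot u) = y u) :
    localWeight ω (fun u => bit m (slot u)) j = localWeight ω y j := by
  refine Finset.sum_congr rfl fun u hu => ?_
  rw [Finset.mem_Ico] at hu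
  by_cases huP : u ∈ P j
  · simp only [hm u (.inr huP), hm j (.inl rfl)]
  · simp only [hω j hj hjn u hu.1 hu.2 huP, ite_self]

/-- By `filled`, the parent's mask already records the colours of all of `P v`. Their slots differ
from `slot v`, so overwriting that one digit completes the mask for `v` and destroys nothing that is
needed. -/
theorem agree_setBit {M : ℕ → ℕ} {v : ℕ} (hv : 1 ≤ v) (hvn : v ≤ n) (hy : y v < 2)
    (hM : ∀ j, 1 ≤ j → j < v → ∀ u, u = j ∨ u ∈ P j → bit (M j) (slot u) = y u) (u : ℕ)
    (hu : u = v ∨ u ∈ P v) : bit (setBit (M (par v)) (slot v) (y v)) (slot u) = y u := by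
  rw [bit_setBit _ _ _ hy]
  rcases hu with rfl | hu
  · rw [if_pos rfl]
  · rw [if_neg (E.slot_ne v hv hvn u hu)]
    have hp := E.par_lt v hv hvn
    have hu1 := E.mem v hv hvn u hu
    rcases E.filled v hv hvn u hu with h | ⟨h₁, h⟩
    · exact hM (par v) (by omega) hp u (.inl h)
    · exact hM (par v) h₁ hp u (.inr h)

variable {V : ℕ → ℕ → ℕ → ℝ} {B C : ℕ → ℕ → ℕ → ℕ}

/-- No colouring is better than the value computed for the number of its ones. -/
theorem sum_localWeight_le
    (hω : ∀ j, 1 ≤ j → j ≤ n → ∀ u, 1 ≤ u → u < j → u ∉ P j → ω u j = 0)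
    (hV : ∀ j ≤ n, ∀ m < 2 ^ T, V j m 0 = localWeight ω (fun u => bit m (slot u)) j)
    (hmerge : ∀ v, 1 ≤ v → v ≤ n → IsMerged n T par slot V B C v) (hy : ∀ j, y j < 2) :
    ∑ j ∈ Finset.Ico 1 (n + 1), localWeight ω y j ≤
      V (stageTable n par n 0) 0 (∑ j ∈ Finset.Ico 1 (n + 1), y j) := by
  -- `c j` is the number of ones merged into `j`, with `j` itself not counted. The bound is claimed
  -- for all masks that agree with `y`, so that the next step is free to choose the mask of the
  -- position being merged.
  have key : ∀ a v, a + v = n → ∃ c : ℕ → ℕ,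
      (∑ j ∈ Finset.range (v + 1), c j + ∑ j ∈ Finset.Ico 1 (v + 1), y j =
        ∑ j ∈ Finset.Ico 1 (n + 1), y j) ∧ (∀ j ≤ v, c j ≤ stageCount n par a j) ∧
      ∀ M : ℕ → ℕ, (∀ j ≤ v, M j < 2 ^ T) →
        (∀ j, 1 ≤ j → j ≤ v → ∀ u, u = j ∨ u ∈ P j → bit (M j) (slot u) = y u) →
        ∑ j ∈ Finset.Ico 1 (n + 1), localWeight ω y j ≤
          ∑ j ∈ Finset.range (v + 1), V (stageTable n par a j) (M j) (c j) := by
    intro a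
    induction a with
    | zero =>
      intro v hv
      obtain rfl : v = n := by omega
      refine ⟨fun _ => 0, by simp, fun _ _ => Nat.zero_le _, fun M hM hagree => ?_⟩
      rw [Finset.range_eq_Ico, Finset.sum_eq_sum_Ico_succ_bot (Nat.succ_pos v)]
      simp only [stageTable]
      rw [hV 0 (by omega) _ (hM 0 (by omega))]
      have h₀ : localWeight ω (fun u => bit (M 0) (slot u)) 0 = 0 := by simp [localWeight]
      rw [h₀, zero_add]
      refine (Finset.sum_congr rfl fun j hj => ?_).le
      rw [Finset.mem_Ico] at hj
      rw [hV j (by omega) _ (hM j (by omega)),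
        localWeight_eq hω hj.1 (by omega) (hagree j hj.1 (by omega))]
    | succ a ih =>
      intro v hv
      obtain ⟨c, hc, hcle, hub⟩ := ih (v + 1) (by omega)
      have hp := E.par_lt (v + 1) (by omega) (by omega)
      have hst := stageTable_succ (par := par) (show a + (v + 1) = n by omega)
      have hsc := stageCount_succ (par := par) (show a + (v + 1) = n by omega)
      refine ⟨fun j => if j = par (v + 1) then y (v + 1) + c j + c (v + 1) else c j, ?_, ?_, ?_⟩
      · rw [sum_range_eq_erase_add hp (g := c) (fun j _ hj => by simp [hj])]
        rw [Finset.sum_range_succ _ (v + 1), Finset.sum_Ico_succ_top (by omega : 1 ≤ v + 1),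
          ← Finset.sum_erase_add _ _ (Finset.mem_range.2 hp)] at hc
        simp only [if_true]
        omega
      · intro j hj
        rw [hsc]
        have h₁ := hcle j (by omega)
        have h₂ := hcle (v + 1) le_rfl
        have h₃ := hy (v + 1)
        dsimp only
        split_ifs <;> omega
      · intro M hM hagree
        -- The mask of the merged position is the one the merge itself uses: the parent's mask with
        -- the digit of `slot (v + 1)` set to its colour.
        have hM' := hub (fun j => if j = v + 1 then
          setBit (M (par (v + 1))) (slot (v + 1)) (y (v + 1)) else M j) ?_ ?_
        · refine hM'.trans ?_
          rw [Finset.sum_range_succ _ (v + 1),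
            sum_range_eq_erase_add hp
              (g := fun j => V (stageTable n par a j) (M j) (c j)) (fun j hj _ => by
              simp [hj.ne]),
            sum_range_eq_erase_add hp
              (g := fun j => V (stageTable n par a j) (M j) (c j)) (fun j _ hj => by
              simp only [hst, if_neg hj])]
          have h₁ := ((hmerge (v + 1) (by omega) (by omega) (M (par (v + 1)))
            (hM _ (by omega))).upper (y (v + 1)) (c (par (v + 1))) (c (v + 1)) ⟨hy _, by
              rw [show n - (v + 1) = a by omega]; exact hcle _ (by omega), by
              rw [show n - (v + 1) = a by omega]; exact hcle _ (by omega)⟩).1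
          rw [show n - (v + 1) = a by omega] at h₁
          simp only [hp.ne, if_false, if_true, hst]
          linarith
        · intro j hj
          split_ifs with h
          · exact setBit_lt (hM _ (by omega)) (E.slot_lt _ (by omega) (by omega)) (hy _)
          · exact hM j (by omega)
        · intro j hj₁ hj u hu
          split_ifs with h
          · subst h
            exact agree_setBit E (by omega) (by omega) (hy _)
              (fun j h₁ h₂ => hagree j h₁ (by omega)) u hu
          · exact hagree j hj₁ (by omega) u hu
  obtain ⟨c, hc, hcle, hub⟩ := key n 0 (by omega)
  -- Only the virtual root is left; it has no colour to agree with, so the mask 0 serves.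
  have h₁ := hub (fun _ => 0) (fun _ _ => by positivity) (fun j h₁ h₂ => by omega)
  simp only [zero_add, Finset.sum_range_one, Finset.Ico_self, Finset.sum_empty, add_zero] at h₁ hc
  rwa [hc] at h₁

omit E in
/-- The state of the reconstruction of an optimal colouring after the position `v`: masks `M`,
numbers `r` of ones yet to be distributed, and colours `y`. -/
structure IsTrace (n T : ℕ) (P : ℕ → Finset ℕ) (par slot : ℕ → ℕ) (V : ℕ → ℕ → ℕ → ℝ) (k : ℕ)
    (M r y : ℕ → ℕ) (v : ℕ) : Prop where
  mask_lt : ∀ j ≤ v, M j < 2 ^ T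
  color_lt : ∀ j, 1 ≤ j → j ≤ v → y j < 2
  agree : ∀ j, 1 ≤ j → j ≤ v → ∀ u, u = j ∨ u ∈ P j → bit (M j) (slot u) = y u
  le : ∀ j ≤ v, r j ≤ stageCount n par (n - v) j
  sum_eq : ∑ j ∈ Finset.range (v + 1), r j + ∑ j ∈ Finset.Ico 1 (v + 1), y j = k
  value_eq : ∑ j ∈ Finset.range (v + 1), V (stageTable n par (n - v) j) (M j) (r j) =
    V (stageTable n par n 0) 0 k

theorem isTrace_zero {k : ℕ} (hk : k ≤ n) {M r : ℕ → ℕ} (hM : M 0 = 0) (hr : r 0 = k) :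
    IsTrace n T P par slot V k M r y 0 where
  mask_lt j hj := by
    obtain rfl : j = 0 := by omega
    rw [hM]; positivity
  color_lt j _ _ := by omega
  agree j _ _ := by omega
  le j hj := by
    obtain rfl : j = 0 := by omega
    rw [Nat.sub_zero, stageCount_last E, hr]; exact hk
  sum_eq := by simp [hr]
  value_eq := by simp [hM, hr]

/-- One step of the reconstruction. -/
theorem IsTrace.succ {k v : ℕ} {M r M' r' y' : ℕ → ℕ} (h : IsTrace n T P par slot V k M r y v)
    (hv : v < n) (hmerge : IsMerged n T par slot V B C (v + 1))
    (hM' : ∀ j, M' j = if j = v + 1 then setBit (M (par (v + 1))) (slot (v + 1))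
      (B (n + (v + 1)) (M (par (v + 1))) (r (par (v + 1))) - 1) else M j)
    (hr' : ∀ j, r' j = if j = v + 1 then C (n + (v + 1)) (M (par (v + 1))) (r (par (v + 1)))
      else if j = par (v + 1) then r j - (B (n + (v + 1)) (M (par (v + 1))) (r (par (v + 1))) - 1) -
        C (n + (v + 1)) (M (par (v + 1))) (r (par (v + 1))) else r j)
    (hy' : ∀ j, 1 ≤ j → j ≤ v + 1 → y' j = if j = v + 1 then
      B (n + (v + 1)) (M (par (v + 1))) (r (par (v + 1))) - 1 else y j) :
    IsTrace n T P par slot V k M' r' y' (v + 1) := by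
  obtain ⟨a, ha⟩ : ∃ a, a + (v + 1) = n := ⟨n - (v + 1), by omega⟩
  have hst := stageTable_succ (par := par) ha
  have hsc := stageCount_succ (par := par) ha
  have hnv : n - v = a + 1 := by omega
  have hnv' : n - (v + 1) = a := by omega
  have hp := E.par_lt (v + 1) (by omega) (by omega)
  obtain ⟨h1, h2, h3, h4, h5, h6⟩ := h
  have hrow := hmerge _ (h1 (par (v + 1)) (by omega))
  rw [hnv'] at hrow
  have hle := h4 (par (v + 1)) (by omega)
  rw [hnv, hsc, if_pos rfl] at hle
  set K := r (par (v + 1))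
  set p := stageCount n par a (par (v + 1))
  set q := stageCount n par a (v + 1)
  -- Each `K ≤ p + q + 1` splits as `b + k₁ + k₂` within the ranges: fill `k₁` up to `p`, then `k₂`
  -- up to `q`, then `b`. Hence this entry was recorded.
  have hB : B (n + (v + 1)) (M (par (v + 1))) K ≠ 0 := by
    rcases Nat.lt_or_ge p K with h | h
    · rcases Nat.lt_or_ge (p + q) K with h' | h'
      · have := (hrow.upper 1 p q ⟨by omega, le_rfl, le_rfl⟩).2
        rwa [show 1 + p + q = K by omega] at this
      · have := (hrow.upper 0 p (K - p) ⟨by omega, le_rfl, by omega⟩).2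
        rwa [show 0 + p + (K - p) = K by omega] at this
    · have := (hrow.upper 0 K 0 ⟨by omega, h, Nat.zero_le _⟩).2
      rwa [show 0 + K + 0 = K by omega] at this
  obtain ⟨b, k₁, k₂, hb, hk₁, hk₂, hK, eB, eC, eV⟩ := hrow.attained K (by omega) hB
  rw [eB, Nat.add_sub_cancel] at hM' hr' hy'
  rw [eC] at hr'
  have hyv : y' (v + 1) = b := by rw [hy' _ (by omega) le_rfl, if_pos rfl]
  have hyj : ∀ j, 1 ≤ j → j ≤ v → y' j = y j := fun j h₁ h₂ => by
    rw [hy' j h₁ (by omega), if_neg (by omega)]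
  have hrp : r' (par (v + 1)) = k₁ := by
    rw [hr', if_neg (by omega), if_pos rfl]
    omega
  have hrv : r' (v + 1) = k₂ := by rw [hr', if_pos rfl]
  have hrj : ∀ j < v + 1, j ≠ par (v + 1) → r' j = r j := fun j h₁ h₂ => by
    rw [hr', if_neg (by omega), if_neg h₂]
  have hMj : ∀ j < v + 1, M' j = M j := fun j h₁ => by rw [hM', if_neg (by omega)]
  have hMv : M' (v + 1) = setBit (M (par (v + 1))) (slot (v + 1)) b := by rw [hM', if_pos rfl]
  have hagree : ∀ j, 1 ≤ j → j < v + 1 → ∀ u, u = j ∨ u ∈ P j → bit (M' j) (slot u) = y' u := by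
    intro j h₁ h₂ u hu
    have hu' : 1 ≤ u ∧ u ≤ j := by
      rcases hu with rfl | hu
      · exact ⟨h₁, le_rfl⟩
      · exact ⟨(E.mem j h₁ (by omega) u hu).1, (E.mem j h₁ (by omega) u hu).2.le⟩
    rw [hMj j h₂, h3 j h₁ (by omega) u hu, hyj u hu'.1 (by omega)]
  constructor
  · intro j hj
    rcases Nat.lt_or_ge j (v + 1) with h | h
    · rw [hMj j h]; exact h1 j (by omega)
    · obtain rfl : j = v + 1 := by omega
      rw [hMv]
      exact setBit_lt (h1 _ (by omega)) (E.slot_lt _ (by omega) (by omega)) hb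
  · intro j h₁ hj
    rcases Nat.lt_or_ge j (v + 1) with h | h
    · rw [hyj j h₁ (by omega)]; exact h2 j h₁ (by omega)
    · obtain rfl : j = v + 1 := by omega
      rwa [hyv]
  · intro j h₁ hj u hu
    rcases Nat.lt_or_ge j (v + 1) with h | h
    · exact hagree j h₁ h u hu
    · obtain rfl : j = v + 1 := by omega
      rw [hMv, ← hMj _ hp, ← hyv]
      exact agree_setBit E (by omega) (by omega) (by rwa [hyv]) hagree u hu
  · intro j hj
    rw [hnv']
    by_cases hjp : j = par (v + 1)
    · rw [hjp, hrp]; exact hk₁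
    rcases Nat.lt_or_ge j (v + 1) with h | h
    · have := h4 j (by omega)
      rw [hnv, hsc, if_neg hjp, Nat.add_zero] at this
      rwa [hrj j h hjp]
    · obtain rfl : j = v + 1 := by omega
      rwa [hrv]
  · rw [Finset.sum_range_succ, hrv, sum_range_eq_erase_add hp hrj, hrp,
      Finset.sum_Ico_succ_top (by omega), hyv,
      Finset.sum_congr (s₁ := Finset.Ico 1 (v + 1)) (g := fun j => y j) rfl (fun j hj => by
        rw [Finset.mem_Ico] at hj
        exact hyj j hj.1 (by omega))]
    rw [← Finset.sum_erase_add _ _ (Finset.mem_range.2 hp)] at h5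
    omega
  · rw [← h6, hnv, hnv', Finset.sum_range_succ _ (v + 1), hrv, hMv,
      sum_range_eq_erase_add hp (g := fun j => V (stageTable n par a j) (M j) (r j))
        (fun j h₁ h₂ => by rw [hrj j h₁ h₂, hMj j h₁]),
      sum_range_eq_erase_add hp (g := fun j => V (stageTable n par a j) (M j) (r j))
        (fun j h₁ h₂ => by rw [hst, if_neg h₂]), hrp, hMj _ hp, hst, if_pos rfl]
    change _ = _ + V (n + (v + 1)) (M (par (v + 1))) K
    rw [eV, add_assoc]

omit E in
/-- A complete reconstruction attains the value that was computed. -/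
theorem IsTrace.sum_localWeight_eq {k : ℕ} {M r : ℕ → ℕ}
    (h : IsTrace n T P par slot V k M r y n)
    (hω : ∀ j, 1 ≤ j → j ≤ n → ∀ u, 1 ≤ u → u < j → u ∉ P j → ω u j = 0)
    (hV : ∀ j ≤ n, ∀ m < 2 ^ T, V j m 0 = localWeight ω (fun u => bit m (slot u)) j) :
    ∑ j ∈ Finset.Ico 1 (n + 1), localWeight ω y j = V (stageTable n par n 0) 0 k ∧
      ∑ j ∈ Finset.Ico 1 (n + 1), y j = k := by
  -- With all merges undone every group is a single position, and no ones remain to be distributed.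
  have hr : ∀ j ∈ Finset.range (n + 1), r j = 0 := fun j hj => by
    have := h.le j (by rw [Finset.mem_range] at hj; omega)
    rw [Nat.sub_self, stageCount] at this
    omega
  constructor
  · rw [← h.value_eq, Nat.sub_self,
      Finset.sum_congr (s₁ := Finset.range (n + 1)) (g := fun j => V (stageTable n par 0 j) (M j) 0)
        rfl (fun j hj => by rw [hr j hj]),
      Finset.range_eq_Ico, Finset.sum_eq_sum_Ico_succ_bot (Nat.succ_pos n)]
    simp only [stageTable]
    rw [hV 0 (by omega) _ (h.mask_lt 0 (by omega))]
    have h₀ : localWeight ω (fun u => bit (M 0) (slot u)) 0 = 0 := by simp [localWeight]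
    rw [h₀, zero_add]
    refine Finset.sum_congr rfl fun j hj => ?_
    rw [Finset.mem_Ico] at hj
    rw [hV j (by omega) _ (h.mask_lt j (by omega)),
      localWeight_eq hω hj.1 (by omega) (h.agree j hj.1 (by omega))]
  · rw [← h.sum_eq, Finset.sum_congr rfl hr]
    simp

end Stages

/-! ### The elimination order obtained from a tree decomposition -/

section Discovery

variable {n N : ℕ} {G : SimpleGraph (Fin n)} (D : TreeDecomposition G N)

/-- The positions `pos` number the vertices from `1` to `n` in such a way that the ranks of their
topmost nodes `top` increase. -/
structure IsDiscovery (rank : Fin N → ℕ) (pos : Fin n → ℕ) (top : Fin n → Fin N) : Prop where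
  pos_pos : ∀ u, 1 ≤ pos u
  pos_le : ∀ u, pos u ≤ n
  pos_inj : Function.Injective pos
  top_mem : ∀ u, u ∈ D.bag (top u)
  top_le : ∀ u i, u ∈ D.bag i → rank (top u) ≤ rank i
  mono : ∀ u v, pos u ≤ pos v → rank (top u) ≤ rank (top v)

/-- The positions of the vertices that precede the vertex in position `c` and belong to the bag of
its topmost node. -/
def earlier (pos : Fin n → ℕ) (top : Fin n → Fin N) (c : ℕ) : Finset ℕ :=
  (Finset.univ.filter fun u => pos u < c ∧ ∃ v, pos v = c ∧ u ∈ D.bag (top v)).image pos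

variable {D} {rank : Fin N → ℕ} {pos : Fin n → ℕ} {top : Fin n → Fin N}

theorem mem_earlier {c x : ℕ} : x ∈ earlier D pos top c ↔
    ∃ u, (pos u < c ∧ ∃ v, pos v = c ∧ u ∈ D.bag (top v)) ∧ pos u = x := by
  simp [earlier]

namespace IsDiscovery

variable (H : IsDiscovery D rank pos top)

include H

theorem image_pos : Finset.univ.image pos = Finset.Ico 1 (n + 1) := by
  refine Finset.eq_of_subset_of_card_le (fun x hx => ?_) ?_
  · obtain ⟨u, -, rfl⟩ := Finset.mem_image.1 hx
    have h₁ := H.pos_pos u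
    have h₂ := H.pos_le u
    rw [Finset.mem_Ico]
    omega
  · rw [Finset.card_image_of_injective _ H.pos_inj]
    simp

theorem exists_pos_eq {c : ℕ} (hc : 1 ≤ c) (hcn : c ≤ n) : ∃ v, pos v = c := by
  have : c ∈ Finset.univ.image pos := by
    rw [H.image_pos, Finset.mem_Ico]
    omega
  simpa using this

theorem mem_earlier_pos {u v : Fin n} :
    pos u ∈ earlier D pos top (pos v) ↔ pos u < pos v ∧ u ∈ D.bag (top v) := by
  rw [mem_earlier]
  constructor
  · rintro ⟨u', ⟨h, v', hv, hu⟩, hu'⟩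
    rw [H.pos_inj hu', H.pos_inj hv] at *
    exact ⟨h, hu⟩
  · exact fun h => ⟨u, ⟨h.1, v, rfl, h.2⟩, rfl⟩

variable (hrank : ∀ i, i ≠ D.tree.root → rank (D.tree.parent i) < rank i)
  (hinj : Function.Injective rank)

include hrank hinj

/-- For `filled`, let q be the last and u another earlier vertex in the bag of the topmost node of
v. They share this bag, so `mem_bag_top` puts u into the bag of the topmost node of q. If there are
no earlier vertices, the empty supremum makes 0, the virtual root, the parent. -/
theorem elimination {T : ℕ} {par slot : ℕ → ℕ}
    (hpar : ∀ c, 1 ≤ c → c ≤ n → par c = (earlier D pos top c).sup id)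
    (hslot : ∀ c, 1 ≤ c → c ≤ n → ∀ u ∈ earlier D pos top c, slot u ≠ slot c)
    (hlt : ∀ c, 1 ≤ c → c ≤ n → slot c < T) :
    Elimination n T (earlier D pos top) par slot where
  par_lt c h₁ h₂ := by
    rw [hpar c h₁ h₂, Finset.sup_lt_iff (show ⊥ < c from h₁)]
    intro x hx
    obtain ⟨u, hu, rfl⟩ := mem_earlier.1 hx
    exact hu.1
  mem c h₁ h₂ x hx := by
    obtain ⟨u, hu, rfl⟩ := mem_earlier.1 hx
    exact ⟨H.pos_pos u, hu.1⟩
  filled c h₁ h₂ x hx := by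
    have hne : (earlier D pos top c).Nonempty := ⟨x, hx⟩
    obtain ⟨p, hp, hp'⟩ := Finset.exists_mem_eq_sup _ hne id
    rw [← hpar c h₁ h₂] at hp'
    have hle : x ≤ p := by
      rw [id] at hp'
      rw [← hp', hpar c h₁ h₂]
      exact Finset.le_sup (f := id) hx
    rw [hp', id]
    obtain ⟨v, rfl⟩ := H.exists_pos_eq h₁ h₂
    obtain ⟨u, -, rfl⟩ := mem_earlier.1 hx
    obtain ⟨q, -, rfl⟩ := mem_earlier.1 hp
    rw [H.mem_earlier_pos] at hx hp ⊢
    rcases hle.eq_or_lt with h | h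
    · exact .inl h
    · exact .inr ⟨H.pos_pos q, h, D.mem_bag_top hrank H.top_mem H.top_le hinj
        (H.mono u q hle) hx.2 hp.2⟩
  slot_ne := hslot
  slot_lt := hlt

theorem mem_earlier_of_adj {u v : Fin n} (h : G.Adj u v) (huv : pos u < pos v) :
    pos u ∈ earlier D pos top (pos v) := by
  obtain ⟨i, hu, hv⟩ := D.edge_cover u v h
  exact H.mem_earlier_pos.2 ⟨huv, D.mem_bag_top hrank H.top_mem H.top_le hinj
    (H.mono u v huv.le) hu hv⟩

end IsDiscovery

end Discovery

/-! ### Cuts and colourings -/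

section Cuts

variable {n N : ℕ} {G : SimpleGraph (Fin n)} (w : G.edgeSet → ℝ)

theorem pairWeight_comm (u v : Fin n) : pairWeight w u v = pairWeight w v u := by
  unfold pairWeight
  by_cases h : G.Adj u v
  · rw [dif_pos h, dif_pos h.symm]
    congr 2
    exact Sym2.eq_swap
  · rw [dif_neg h, dif_neg fun h' => h h'.symm]

theorem cutWeight_comm (A B : Finset (Fin n)) : cutWeight w A B = cutWeight w B A := by
  rw [cutWeight, cutWeight, Finset.sum_comm]
  exact Finset.sum_congr rfl fun u _ => Finset.sum_congr rfl fun v _ => pairWeight_comm w v u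

theorem weightArray_apply (u v : Fin n) : weightArray w (u * n + v) = pairWeight w u v := by
  have hlt : (u : ℕ) * n + v < n * n := by
    have h₁ := u.2
    have h₂ := v.2
    calc (u : ℕ) * n + v < u * n + n := by omega
      _ = (u + 1) * n := by ring
      _ ≤ n * n := Nat.mul_le_mul_right _ h₁
  have hn : 0 < n := u.pos
  rw [weightArray, dif_pos hlt]
  congr 1
  · ext
    simp [Fin.divNat, Nat.add_comm (u * n : ℕ), Nat.add_mul_div_right _ _ hn,
      Nat.div_eq_of_lt v.2]
  · ext
    simp [Fin.modNat, Nat.add_comm (u * n : ℕ), Nat.mod_eq_of_lt v.2]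

variable {D : TreeDecomposition G N} {rank : Fin N → ℕ} {pos : Fin n → ℕ} {top : Fin n → Fin N}
  (H : IsDiscovery D rank pos top)

include H

/-- Every cut edge is counted once, at its end with the larger position. -/
theorem IsDiscovery.sum_localWeight {ω : ℕ → ℕ → ℝ} {ε : ℝ}
    (hω : ∀ u v, ω (pos u) (pos v) = ε * pairWeight w u v) {y : ℕ → ℕ}
    (hy : ∀ u, y (pos u) < 2) :
    ∑ j ∈ Finset.Ico 1 (n + 1), localWeight ω y j =
      ε * cutWeight w (Finset.univ.filter fun u => y (pos u) = 1)
        (Finset.univ.filter fun u => y (pos u) = 1)ᶜ := by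
  set F : Fin n → Fin n → ℝ := fun u v =>
    if y (pos u) = 1 then if y (pos v) = 1 then 0 else pairWeight w u v else 0 with hF
  have hcut : cutWeight w (Finset.univ.filter fun u => y (pos u) = 1)
      (Finset.univ.filter fun u => y (pos u) = 1)ᶜ = ∑ v, ∑ u, F u v := by
    rw [Finset.sum_comm, cutWeight, Finset.sum_filter]
    refine Finset.sum_congr rfl fun u _ => ?_
    rw [Finset.compl_filter, Finset.sum_filter]
    by_cases h : y (pos u) = 1
    · simp [hF, h]
    · simp [hF, h]
  -- `F` counts a cut pair in the direction from colour 1 to the other colour. Collecting both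
  -- directions at the later position makes the summand symmetric, as in `localWeight`.
  have hsplit : ∑ v, ∑ u, F u v =
      ∑ v, ∑ u, if pos u < pos v then F u v + F v u else 0 := by
    have h₁ : ∀ u v, F u v =
        (if pos u < pos v then F u v else 0) + if pos v < pos u then F u v else 0 := by
      intro u v
      rcases lt_trichotomy (pos u) (pos v) with h | h | h
      · simp [h, h.le]
      · rw [H.pos_inj h]
        simp only [hF]
        split_ifs <;> simp_all
      · simp [h, h.le]
    calc ∑ v, ∑ u, F u v
        = ∑ v, ∑ u, (if pos u < pos v then F u v else 0) +
          ∑ v, ∑ u, (if pos v < pos u then F u v else 0) := by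
          rw [← Finset.sum_add_distrib]
          refine Finset.sum_congr rfl fun v _ => ?_
          rw [← Finset.sum_add_distrib]
          exact Finset.sum_congr rfl fun u _ => h₁ u v
      _ = ∑ v, ∑ u, (if pos u < pos v then F u v else 0) +
          ∑ v, ∑ u, (if pos u < pos v then F v u else 0) := by
          congr 1
          exact Finset.sum_comm
      _ = _ := by
          rw [← Finset.sum_add_distrib]
          refine Finset.sum_congr rfl fun v _ => ?_
          rw [← Finset.sum_add_distrib]
          refine Finset.sum_congr rfl fun u _ => ?_
          split_ifs <;> simp
  rw [hcut, hsplit, ← H.image_pos, Finset.sum_image H.pos_inj.injOn, Finset.mul_sum]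
  refine Finset.sum_congr rfl fun v _ => ?_
  have hIco : Finset.Ico 1 (pos v) = (Finset.univ.filter fun u => pos u < pos v).image pos := by
    ext x
    simp only [Finset.mem_Ico, Finset.mem_image, Finset.mem_filter, Finset.mem_univ, true_and]
    constructor
    · rintro ⟨h₁, h₂⟩
      obtain ⟨u, rfl⟩ := H.exists_pos_eq h₁ (h₂.le.trans (H.pos_le v))
      exact ⟨u, h₂, rfl⟩
    · rintro ⟨u, hu, rfl⟩
      exact ⟨H.pos_pos u, hu⟩
  rw [localWeight, hIco, Finset.sum_image H.pos_inj.injOn, Finset.sum_filter, Finset.mul_sum]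
  refine Finset.sum_congr rfl fun u _ => ?_
  have h₁ := hy u
  have h₂ := hy v
  split_ifs with h h'
  · simp only [hF, h']
    split_ifs <;> simp
  · rw [hω, hF]
    rcases (show y (pos u) = 0 ∨ y (pos u) = 1 by omega) with e₁ | e₁ <;>
    rcases (show y (pos v) = 0 ∨ y (pos v) = 1 by omega) with e₂ | e₂ <;>
    simp_all [pairWeight_comm w v u]
  · simp

/-- An optimal colouring with half of the positions coloured `1` is an optimal bisection. -/
theorem IsDiscovery.isBisection {ω : ℕ → ℕ → ℝ} {ε : ℝ}
    (hω : ∀ u v, ω (pos u) (pos v) = ε * pairWeight w u v) {y : ℕ → ℕ}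
    (hy : ∀ u, y (pos u) < 2) (hsum : ∑ j ∈ Finset.Ico 1 (n + 1), y j = (n + 1) / 2)
    (hopt : ∀ y' : ℕ → ℕ, (∀ j, y' j < 2) → ∑ j ∈ Finset.Ico 1 (n + 1), y' j = (n + 1) / 2 →
      ∑ j ∈ Finset.Ico 1 (n + 1), localWeight ω y' j ≤
        ∑ j ∈ Finset.Ico 1 (n + 1), localWeight ω y j)
    {A : Finset (Fin n)} (hA : A = Finset.univ.filter fun u => y (pos u) = 1) :
    IsBisection A Aᶜ ∧
      ∀ A' B', IsBisection A' B' → ε * cutWeight w A' B' ≤ ε * cutWeight w A Aᶜ := by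
  have hcard : A.card = (n + 1) / 2 := by
    rw [← hsum, ← H.image_pos, Finset.sum_image H.pos_inj.injOn, hA, Finset.card_filter]
    refine Finset.sum_congr rfl fun u _ => ?_
    have := hy u
    split_ifs <;> omega
  have hcompl : ∀ A : Finset (Fin n), A.card + Aᶜ.card = n := fun A => by
    rw [Finset.card_add_card_compl, Fintype.card_fin]
  have h₁ : ∀ A' : Finset (Fin n), A'.card = (n + 1) / 2 →
      ε * cutWeight w A' A'ᶜ ≤ ε * cutWeight w A Aᶜ := by
    intro A' hA'
    classical
    set y' : ℕ → ℕ := fun j => if ∃ v ∈ A', pos v = j then 1 else 0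
    have hy' : ∀ u, y' (pos u) = if u ∈ A' then 1 else 0 := by
      intro u
      have : (∃ v ∈ A', pos v = pos u) ↔ u ∈ A' :=
        ⟨fun ⟨v, hv, h⟩ => H.pos_inj h ▸ hv, fun h => ⟨u, h, rfl⟩⟩
      simp only [y', this]
    have hlt : ∀ j, y' j < 2 := fun j => by
      simp only [y']
      split_ifs <;> omega
    have hs' : ∑ j ∈ Finset.Ico 1 (n + 1), y' j = (n + 1) / 2 := by
      rw [← H.image_pos, Finset.sum_image H.pos_inj.injOn, ← hA']
      simp [hy']
    have := hopt y' hlt hs'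
    rw [H.sum_localWeight w hω hy, H.sum_localWeight w hω (fun u => hlt _), ← hA] at this
    simpa [hy'] using this
  refine ⟨⟨disjoint_compl_right, Finset.union_compl A, ?_⟩, fun A' B' hB => ?_⟩
  · have := hcompl A
    omega
  · obtain ⟨hd, hu, h₂, h₃⟩ := hB
    have hB' : B' = A'ᶜ := by
      refine (IsCompl.of_eq ?_ ?_).compl_eq.symm
      · exact hd.eq_bot
      · exact hu
    subst hB'
    have := hcompl A'
    -- One side of any bisection has ⌈n/2⌉ vertices, and the cut weight is symmetric in the two
    -- sides.
    rcases (show A'.card = (n + 1) / 2 ∨ A'ᶜ.card = (n + 1) / 2 by omega) with h | h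
    · exact h₁ A' h
    · rw [cutWeight_comm]
      simpa using h₁ A'ᶜ h

end Cuts

open RealRAM

/-! ### A topological order of the nodes -/

namespace RootedTree

variable {N : ℕ} (T : RootedTree N)

/-- Append `x` and its next `L - 1` ancestors, the topmost first. -/
def appendChain (l : List (Fin N)) : ℕ → Fin N → List (Fin N)
  | 0, _ => l
  | L + 1, x => appendChain l L (T.parent x) ++ [x]

/-- The number of steps from `x` up to the first node in `l`. -/
noncomputable def climb (l : List (Fin N)) (x : Fin N) : ℕ := sInf {k | T.parent^[k] x ∈ l}

/-- The list of nodes that is obtained by appending the missing ancestors of `0, 1, …, j - 1`. -/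
noncomputable def orderList : ℕ → List (Fin N)
  | 0 => [T.root]
  | j + 1 => if h : j < N then
      T.appendChain (orderList j) (T.climb (orderList j) ⟨j, h⟩) ⟨j, h⟩ else orderList j

/-- The list contains the root and has no repetitions, and parents come before children. -/
structure IsOrdered (l : List (Fin N)) : Prop where
  root_mem : T.root ∈ l
  nodup : l.Nodup
  parent : ∀ (k : ℕ) (x : Fin N), l[k]? = some x → x ≠ T.root →
    ∃ k' < k, l[k']? = some (T.parent x)

variable {T} {l : List (Fin N)} {L : ℕ} {x : Fin N}

theorem IsOrdered.append (h : T.IsOrdered l) (hx : x ∉ l) (hp : T.parent x ∈ l) :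
    T.IsOrdered (l ++ [x]) where
  root_mem := List.mem_append_left _ h.root_mem
  nodup := h.nodup.append (List.nodup_singleton x) (by simpa using hx)
  parent k z hz hr := by
    rcases Nat.lt_or_ge k l.length with hk | hk
    · rw [List.getElem?_append_left hk] at hz
      obtain ⟨k', h₁, h₂⟩ := h.parent k z hz hr
      exact ⟨k', h₁, by rw [List.getElem?_append_left (by omega), h₂]⟩
    · rw [List.getElem?_append_right hk] at hz
      have hzx : z = x := by
        have := List.mem_of_getElem? hz
        simpa using this
      obtain ⟨k', h₁⟩ := List.mem_iff_getElem?.1 hp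
      have hk' : k' < l.length := (List.getElem?_eq_some_iff.1 h₁).1
      exact ⟨k', by omega, by rw [List.getElem?_append_left hk', h₁, hzx]⟩

theorem length_appendChain : (T.appendChain l L x).length = l.length + L := by
  induction L generalizing x with
  | zero => rfl
  | succ L ih => simp [appendChain, ih, Nat.add_assoc]

theorem mem_appendChain {z : Fin N} :
    z ∈ T.appendChain l L x ↔ z ∈ l ∨ ∃ k < L, T.parent^[k] x = z := by
  induction L generalizing x with
  | zero => simp [appendChain]
  | succ L ih =>
    rw [appendChain, List.mem_append, ih, or_assoc, List.mem_singleton]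
    refine or_congr_right ⟨?_, ?_⟩
    · rintro (⟨k, hk, rfl⟩ | rfl)
      · exact ⟨k + 1, by omega, rfl⟩
      · exact ⟨0, by omega, rfl⟩
    · rintro ⟨k, hk, rfl⟩
      cases k with
      | zero => exact .inr rfl
      | succ k => exact .inl ⟨k, by omega, rfl⟩

theorem getElem?_appendChain (k : ℕ) : (T.appendChain l L x)[k]? =
    if k < l.length then l[k]? else
      if k < l.length + L then some (T.parent^[l.length + L - 1 - k] x) else none := by
  induction L generalizing x with
  | zero =>
    rw [appendChain]
    split_ifs with h h'
    · rfl
    · omega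
    · exact List.getElem?_eq_none (by omega)
  | succ L ih =>
    rw [appendChain, List.getElem?_append, length_appendChain, ih]
    by_cases h : k < l.length
    · simp [h, Nat.lt_add_right]
    by_cases h' : k < l.length + L
    · rw [if_pos h', if_neg h, if_pos h', if_neg h, if_pos (by omega),
        show l.length + (L + 1) - 1 - k = l.length + L - 1 - k + 1 by omega,
        Function.iterate_succ_apply]
    · rw [if_neg h', if_neg h, List.getElem?_singleton]
      by_cases h₂ : k = l.length + L
      · subst h₂
        simp
      · rw [if_neg (by omega), if_neg (by omega)]

/-- The nodes of the chain are distinct because only the root can recur among its own ancestors, and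
the root already belongs to `l`. -/
theorem IsOrdered.appendChain (h : T.IsOrdered l) (hL : ∀ k < L, T.parent^[k] x ∉ l)
    (hL' : T.parent^[L] x ∈ l) : T.IsOrdered (T.appendChain l L x) := by
  induction L generalizing x with
  | zero => exact h
  | succ L ih =>
    refine (ih (x := T.parent x) (fun k hk => hL (k + 1) (by omega)) hL').append ?_ ?_
    · rw [mem_appendChain]
      rintro (hx | ⟨k, hk, hx⟩)
      · exact hL 0 (by omega) hx
      · refine hL 0 (by omega) ?_
        rw [T.eq_root_of_iterate_eq (k := k + 1) (by omega) hx]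
        exact h.root_mem
    · rw [mem_appendChain]
      rcases Nat.eq_zero_or_pos L with rfl | hp
      · exact .inl hL'
      · exact .inr ⟨0, hp, rfl⟩

theorem IsOrdered.climb_spec (h : T.IsOrdered l) (x : Fin N) :
    T.parent^[T.climb l x] x ∈ l ∧ ∀ k < T.climb l x, T.parent^[k] x ∉ l := by
  have hne : {k | T.parent^[k] x ∈ l}.Nonempty := by
    obtain ⟨k, hk⟩ := T.reaches_root x
    refine ⟨k, ?_⟩
    change T.parent^[k] x ∈ l
    rw [hk]
    exact h.root_mem
  exact ⟨Nat.sInf_mem hne, fun k hk => Nat.notMem_of_lt_sInf hk⟩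

variable (T)

theorem isOrdered_orderList (j : ℕ) : T.IsOrdered (T.orderList j) := by
  induction j with
  | zero =>
    refine ⟨by simp [orderList], List.nodup_singleton _, fun k x hx hr => absurd ?_ hr⟩
    simpa [orderList] using List.mem_of_getElem? hx
  | succ j ih =>
    rw [orderList]
    split_ifs with h
    · exact ih.appendChain (ih.climb_spec _).2 (ih.climb_spec _).1
    · exact ih

theorem orderList_succ (x : Fin N) : T.orderList (x + 1) =
    T.appendChain (T.orderList x) (T.climb (T.orderList x) x) x := by
  rw [orderList, dif_pos x.2]

theorem mem_orderList (x : Fin N) {j : ℕ} (h : (x : ℕ) < j) : x ∈ T.orderList j := by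
  induction j with
  | zero => omega
  | succ j ih =>
    by_cases hj : j < N
    · rw [orderList, dif_pos hj, mem_appendChain]
      rcases Nat.lt_or_ge x j with h' | h'
      · exact .inl (ih h')
      · have hx : x = ⟨j, hj⟩ := Fin.ext (by simp; omega)
        rcases Nat.eq_zero_or_pos (T.climb (T.orderList j) ⟨j, hj⟩) with h₀ | h₀
        · have := ((T.isOrdered_orderList j).climb_spec ⟨j, hj⟩).1
          rw [h₀] at this
          exact .inl (hx ▸ this)
        · exact .inr ⟨0, h₀, hx.symm⟩
    · have := x.2
      rw [orderList, dif_neg hj]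
      exact ih (by omega)

theorem length_orderList_le (j : ℕ) : (T.orderList j).length ≤ N := by
  simpa using (T.isOrdered_orderList j).nodup.length_le_card

theorem length_orderList : (T.orderList N).length = N := by
  have := List.Nodup.length_le_card (T.isOrdered_orderList N).nodup
  refine le_antisymm (T.length_orderList_le N) ?_
  have h₂ : (Finset.univ : Finset (Fin N)) ⊆ (T.orderList N).toFinset := fun x _ =>
    List.mem_toFinset.2 (T.mem_orderList x x.2)
  have h₃ := (Finset.card_le_card h₂).trans (List.toFinset_card_le _)
  simpa using h₃

theorem length_orderList_succ (j : ℕ) :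
    (T.orderList j).length ≤ (T.orderList (j + 1)).length := by
  rw [orderList]
  split_ifs with h
  · rw [length_appendChain]; omega
  · rfl

end RootedTree

/-! ### The program that finds the order -/

/-- Find the root. -/
def findRoot : Prog :=
  forUp 10 1 (branch (.eq (.get 0 (.var 10)) (.var 10)) (asg 11 (.var 10)) skip)

/-- Count the nodes on the path from the node in variable `10` that are not yet marked. -/
def climbProg : Prog :=
  .seq (asg 13 (.var 10)) (.seq (asg 14 (.lit 0))
    (repeatWhile (.eq (.get 4 (.var 13)) (.lit 0))
      (.seq (asg 14 (.add (.var 14) (.lit 1))) (asg 13 (.get 0 (.var 13))))))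

/-- Write these nodes into the array `5`, and mark them. -/
def writeChain : Prog :=
  .seq (asg 13 (.var 10)) (.seq (asg 15 (.add (.var 12) (.var 14)))
    (forUp 16 14 (.seq (asg 15 (.sub (.var 15) (.lit 1))) (.seq (put 5 (.var 15) (.var 13))
      (.seq (put 4 (.var 13) (.lit 1)) (asg 13 (.get 0 (.var 13))))))))

/-- Write all nodes into the array `5`, parents before children. -/
def orderProg : Prog :=
  .seq findRoot (.seq (put 5 (.lit 0) (.var 11)) (.seq (put 4 (.var 11) (.lit 1))
    (.seq (asg 12 (.lit 1)) (forUp 10 1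
      (.seq climbProg (.seq writeChain (asg 12 (.add (.var 12) (.var 14)))))))))

section Order

variable {N : ℕ} {T : RootedTree N} {s : State}

theorem findRoot_spec (hN : s.natVar 1 = N) (hp : ∀ i : Fin N, s.natArr 0 i = T.parent i) :
    Tri findRoot s (N * 20 + 5) (fun s' => s'.natVar 11 = T.root) := by
  refine (Tri.forUp_const N (fun j s' => (T.root : ℕ) < j → s'.natVar 11 = T.root) 13 hN
    (fun h => by omega) (fun j hj s' hs' hI hF => ?_) (by omega)).mono le_rfl
    (fun s' h _ => h T.root.2)
  have ha := hF.natArr 0 rfl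
  refine Tri.branch (B' := 2) (fun hb => Tri.asg ?_ (by simp [NatExpr.cost])) (fun hb => Tri.skip (by omega) ?_)
    (by simp [BoolExpr.cost, NatExpr.cost])
  · intro _
    simp only [BoolExpr.Holds, NatExpr.eval, hs', ha] at hb
    rw [hp ⟨j, hj⟩] at hb
    have := T.eq_root_of_parent_eq (Fin.ext hb)
    simp [← this, hs']
  · intro h
    simp only [BoolExpr.Holds, NatExpr.eval, hs', ha] at hb
    rw [hp ⟨j, hj⟩] at hb
    have hne : (T.root : ℕ) ≠ j := by
      rintro h'
      apply hb
      have : (⟨j, hj⟩ : Fin N) = T.root := Fin.ext h'.symm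
      rw [this, T.parent_root, ← h']
    simpa using hI (by omega)

/-- The arrays `4` and `5` and the variable `12` represent the list `l`. -/
structure RepOrder (l : List (Fin N)) (s : State) : Prop where
  mark : ∀ i : Fin N, s.natArr 4 i = if i ∈ l then 1 else 0
  order : ∀ k (hk : k < l.length), s.natArr 5 k = l[k]
  count : s.natVar 12 = l.length

theorem climbProg_spec (hp : ∀ i : Fin N, s.natArr 0 i = T.parent i) {l : List (Fin N)}
    (hl : T.IsOrdered l) (hs : RepOrder l s) (x : Fin N) (hx : s.natVar 10 = x) :
    Tri climbProg s (T.climb l x * 11 + 8) (fun s' => s'.natVar 14 = T.climb l x) := by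
  obtain ⟨h₁, h₂⟩ := hl.climb_spec x
  refine Tri.mono (.seq_asg (.seq_asg (Tri.repeatWhile (T.climb l x) (fun k s' =>
    s'.natVar 14 = k ∧ s'.natVar 13 = T.parent^[k] x) (fun _ => 7) ?_ ?_ ?_) le_rfl) le_rfl) ?_
    (fun s' h _ => h.1)
  · simp [hx]
  · rintro k hk s' ⟨e₁, e₂⟩ hF
    have ha := hF.natArr 4 rfl
    have hb := hF.natArr 0 rfl
    simp only [State.setN_natArr] at ha hb
    refine ⟨?_, .seq_asg (.asg ⟨?_, ?_⟩ le_rfl) ?_⟩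
    · simp [ha, e₂, hs.mark, h₂ k hk]
    · simp [e₁]
    · simp [hb, e₂, hp, Function.iterate_succ_apply']
    · simp [NatExpr.cost]
  · rintro s' ⟨e₁, e₂⟩ hF
    have ha := hF.natArr 4 rfl
    simp only [State.setN_natArr] at ha
    simp [ha, e₂, hs.mark, h₁]
  · simp [BoolExpr.cost, NatExpr.cost]
    omega

theorem writeChain_spec (hp : ∀ i : Fin N, s.natArr 0 i = T.parent i) {l : List (Fin N)}
    (hs : RepOrder l s) (x : Fin N) (hx : s.natVar 10 = x) {L : ℕ} (hL : s.natVar 14 = L) :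
    Tri writeChain s (L * 20 + 11) (fun s' =>
      (∀ i : Fin N, s'.natArr 4 i = if i ∈ T.appendChain l L x then 1 else 0) ∧
      ∀ k (hk : k < (T.appendChain l L x).length), s'.natArr 5 k = (T.appendChain l L x)[k]) := by
  -- The climb meets descendants before ancestors, so the new block is filled from its end
  -- downwards: after `k` rounds its last `k` cells are written.
  refine Tri.mono (.seq_asg (.seq_asg (Tri.forUp_const L (fun k s' =>
    s'.natVar 13 = T.parent^[k] x ∧ s'.natVar 15 = l.length + L - k ∧
    (∀ i : Fin N, s'.natArr 4 i = if i ∈ T.appendChain l k x then 1 else 0) ∧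
    ∀ m, s'.natArr 5 m = if m < l.length + L ∧ l.length + L - k ≤ m then
      (T.parent^[l.length + L - 1 - m] x : ℕ) else s.natArr 5 m) 13 ?_ ?_ ?_ le_rfl) le_rfl)
    le_rfl) ?_ ?_
  · simp [hL]
  · simp only [State.setN_natVar, State.setN_natArr]
    refine ⟨by simp [hx], by simp [hs.count, hL], fun i => ?_, fun m => ?_⟩
    · rw [hs.mark, RootedTree.appendChain]
    · rw [if_neg (by omega)]
  · rintro k hk s' - ⟨e₁, e₂, e₃, e₄⟩ hF
    have hb := hF.natArr 0 rfl
    simp only [State.setN_natArr] at hb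
    refine .seq_asg (.seq_put (.seq_put (.asg ⟨?_, ?_, ?_, ?_⟩ le_rfl) le_rfl) le_rfl) ?_
    · simp [hb, e₁, hp, Function.iterate_succ_apply']
    · simp [e₂]
      omega
    · intro i
      simp only [NatExpr.eval, State.setN_natArr, State.setN_natVar, State.setA_natArr,
        State.setA_natVar, e₁]
      simp only [Nat.reduceEqDiff, if_true, if_false, Function.update_apply, e₃,
        RootedTree.mem_appendChain]
      by_cases hi : i = T.parent^[k] x
      · rw [if_pos (by rw [hi]), if_pos (.inr ⟨k, by omega, hi.symm⟩)]
      · rw [if_neg (by rwa [Fin.val_inj])]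
        refine if_congr ?_ rfl rfl
        refine (or_congr_right ⟨fun ⟨k', h₁, h₂⟩ => ⟨k', by omega, h₂⟩,
          fun ⟨k', h₁, h₂⟩ => ⟨k', ?_, h₂⟩⟩)
        have : k' ≠ k := by
          rintro rfl
          exact hi h₂.symm
        omega
    · intro m
      simp only [NatExpr.eval, State.setN_natArr, State.setN_natVar, State.setA_natArr,
        State.setA_natVar, e₁, e₂]
      simp only [Nat.reduceEqDiff, if_true, if_false, Function.update_apply, e₄]
      by_cases hmk : m = l.length + L - k - 1
      · rw [if_pos hmk, if_pos (by omega), show l.length + L - 1 - m = k by omega]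
      · rw [if_neg hmk]
        exact if_congr (by omega) rfl rfl
    · simp [NatExpr.cost]
  · simp [NatExpr.cost]
    omega
  · rintro s' ⟨-, -, e₃, e₄⟩ -
    refine ⟨e₃, fun k hk => ?_⟩
    rw [e₄]
    rw [RootedTree.length_appendChain] at hk
    have h₁ := RootedTree.getElem?_appendChain (T := T) (l := l) (L := L) (x := x) k
    rw [List.getElem?_eq_getElem (by rwa [RootedTree.length_appendChain])] at h₁
    by_cases hkl : k < l.length
    · rw [if_pos hkl, List.getElem?_eq_getElem hkl, Option.some_inj] at h₁
      rw [if_neg (by omega), h₁, hs.order k hkl]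
    · rw [if_neg hkl, if_pos hk, Option.some_inj] at h₁
      rw [if_pos (by omega), h₁]

theorem orderProg_spec (hN : s.natVar 1 = N) (hp : ∀ i : Fin N, s.natArr 0 i = T.parent i)
    (hm : s.natArr 4 = fun _ => 0) :
    Tri orderProg s (N * 100 + 100) (fun s' => ∃ l : List (Fin N), l.length = N ∧ l.Nodup ∧
      (∀ i, i ≠ T.root → l.idxOf (T.parent i) < l.idxOf i) ∧
      ∀ k (hk : k < l.length), s'.natArr 5 k = l[k]) := by
  refine Tri.seq (findRoot_spec hN hp) (B₂ := N * 80 + 95) (fun s₁ hr hF₁ => ?_) (by omega)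
  have hN₁ := (hF₁.natVar 1 (by omega) rfl).trans hN
  have hp₁ := hF₁.natArr 0 rfl
  have hm₁ := (hF₁.natArr 4 rfl).trans hm
  -- An iteration costs a constant plus a multiple of the number of nodes it appends. These numbers
  -- telescope to at most `N`, which makes the whole search linear.
  refine Tri.mono (.seq_put (.seq_put (.seq_asg (Tri.forUp N
    (fun j s' => RepOrder (T.orderList j) s')
    (fun j => ((T.orderList (j + 1)).length - (T.orderList j).length) * 31 + 25)
    ?_ ?_ ?_ le_rfl) le_rfl) le_rfl) le_rfl) ?_ ?_
  · simp [hN₁]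
  · refine ⟨fun i => ?_, fun k hk => ?_, ?_⟩
    · simp [hr, hm₁, RootedTree.orderList, Function.update_apply, Fin.val_inj]
    · have : k = 0 := by simpa [RootedTree.orderList] using hk
      subst this
      simp [hr, RootedTree.orderList]
    · simp [RootedTree.orderList]
  · intro j hj s₂ hj₂ hI hF
    have hp₂ : ∀ i : Fin N, s₂.natArr 0 i = T.parent i := by
      have := hF.natArr 0 rfl
      simp only [State.setN_natArr, State.setA_natArr] at this
      intro i
      rw [this]
      simp [hp₁, hp]
    have hl := T.isOrdered_orderList j
    have hlen := T.orderList_succ ⟨j, hj⟩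
    simp only at hlen
    rw [hlen, RootedTree.length_appendChain, Nat.add_sub_cancel_left]
    refine Tri.seq (climbProg_spec hp₂ hl hI ⟨j, hj⟩ hj₂)
      (B₂ := T.climb (T.orderList j) ⟨j, hj⟩ * 20 + 17) (fun s₃ hc₃ hF₃ => ?_) (by omega)
    have hI₃ : RepOrder (T.orderList j) s₃ := by
      refine ⟨?_, ?_, ?_⟩
      · rw [hF₃.natArr 4 rfl]; exact hI.mark
      · rw [hF₃.natArr 5 rfl]; exact hI.order
      · rw [hF₃.natVar 12 (by omega) rfl]; exact hI.count
    refine Tri.seq (writeChain_spec (T := T) (by rw [hF₃.natArr 0 rfl]; exact hp₂) hI₃ ⟨j, hj⟩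
      ((hF₃.natVar 10 (by omega) rfl).trans hj₂) hc₃) (B₂ := 4) (fun s₄ h₄ hF₄ => ?_) (by omega)
    refine Tri.asg ⟨?_, ?_, ?_⟩ le_rfl
    · exact h₄.1
    · exact h₄.2
    · simp [hF₄.natVar 12 (by omega) rfl, hF₄.natVar 14 (by omega) rfl, hc₃, hI₃.count,
        RootedTree.length_appendChain]
  · have hmono : Monotone fun j => (T.orderList j).length :=
      monotone_nat_of_le_succ T.length_orderList_succ
    have h₁ := Finset.sum_range_tsub hmono N
    have h₂ := T.length_orderList_le N
    simp only [Finset.sum_add_distrib, ← Finset.sum_mul, h₁]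
    simp [NatExpr.cost]
    omega
  · intro s' hI _
    refine ⟨_, T.length_orderList, (T.isOrdered_orderList N).nodup, fun i hi => ?_, hI.order⟩
    have hmem := T.mem_orderList i i.2
    obtain ⟨k', h₁, h₂⟩ := (T.isOrdered_orderList N).parent _ i (by
      rw [List.getElem?_eq_getElem (List.idxOf_lt_length_of_mem hmem), List.getElem_idxOf]) hi
    refine lt_of_le_of_lt ?_ h₁
    obtain ⟨hk', h₃⟩ := List.getElem?_eq_some_iff.1 h₂
    rw [← h₃, List.Nodup.idxOf_getElem (T.isOrdered_orderList N).nodup]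

end Order

/-! ### The program that numbers the vertices -/

/-- The body of the inner loop of `discoverProg`: number a vertex, unless it has a number. -/
def discoverStep : Prog :=
  .seq (asg 17 (.get 2 (.add (.var 14) (.var 16)))) (branch (.eq (.get 6 (.var 17)) (.lit 0))
    (.seq (asg 12 (.add (.var 12) (.lit 1))) (.seq (put 6 (.var 17) (.var 12))
      (.seq (put 7 (.var 12) (.var 17)) (put 8 (.var 12) (.var 13))))) skip)

/-- Number the vertices in the order of their first occurrence in the bags. -/
def discoverProg : Prog :=
  .seq (asg 12 (.lit 0)) (forUp 10 1 (.seq (asg 13 (.get 5 (.var 10)))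
    (.seq (asg 14 (.get 1 (.var 13)))
      (.seq (asg 15 (.sub (.get 1 (.add (.var 13) (.lit 1))) (.var 14)))
        (forUp 16 15 discoverStep)))))

section Discover

variable {n N t : ℕ} {G : SimpleGraph (Fin n)} {D : TreeDecomposition G N} {rank : Fin N → ℕ}
  {s : State}

/-- The memory contains the tree and the bags. -/
structure RepInput (D : TreeDecomposition G N) (s : State) : Prop where
  vertices : s.natVar 0 = n
  nodes : s.natVar 1 = N
  parent : ∀ i : Fin N, s.natArr 0 i = D.tree.parent i
  offset : s.natArr 1 = offsetArray D
  bags : s.natArr 2 = bagArray D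

theorem RepInput.of_frame {p : Prog} {s' : State} (h : RepInput D s) (hF : Frame p s s')
    (hp : (p.any (Op.writesN 0) = false ∧ p.any (Op.writesN 1) = false) ∧
      p.any (Op.writesA 0) = false ∧ p.any (Op.writesA 1) = false ∧
      p.any (Op.writesA 2) = false := by decide) : RepInput D s' where
  vertices := (hF.natVar 0 (by omega) hp.1.1).trans h.vertices
  nodes := (hF.natVar 1 (by omega) hp.1.2).trans h.nodes
  parent i := by rw [hF.natArr 0 hp.2.1, h.parent]
  offset := (hF.natArr 1 hp.2.2.1).trans h.offset
  bags := (hF.natArr 2 hp.2.2.2).trans h.bags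

/-- The arrays `6`, `7` and `8` contain the positions of the vertices in `S`, the vertices in these
positions, and their topmost nodes, all of which have rank at most `m`. -/
structure RepDiscovery (D : TreeDecomposition G N) (rank : Fin N → ℕ) (S : Finset (Fin n)) (m : ℕ)
    (top : Fin n → Fin N) (s : State) : Prop where
  notMem : ∀ u ∉ S, s.natArr 6 u = 0
  pos_pos : ∀ u ∈ S, 1 ≤ s.natArr 6 u
  pos_le : ∀ u ∈ S, s.natArr 6 u ≤ s.natVar 12
  vertex : ∀ u ∈ S, s.natArr 7 (s.natArr 6 u) = u
  top_eq : ∀ u ∈ S, s.natArr 8 (s.natArr 6 u) = top u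
  top_mem : ∀ u ∈ S, u ∈ D.bag (top u)
  top_le : ∀ u ∈ S, rank (top u) ≤ m
  top_min : ∀ u ∈ S, ∀ i, u ∈ D.bag i → rank (top u) ≤ rank i
  mono : ∀ u ∈ S, ∀ v ∈ S, s.natArr 6 u ≤ s.natArr 6 v → rank (top u) ≤ rank (top v)
  count : s.natVar 12 = S.card

/-- Nodes are scanned by increasing rank, so the node at which a vertex is first met is its topmost
one; `hmin` expresses this. -/
theorem discoverStep_spec {S : Finset (Fin n)} {m : ℕ} {top : Fin n → Fin N}
    (h : RepDiscovery D rank S m top s) {i : Fin N} (hi : rank i = m) (hs : s.natVar 13 = i)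
    {u : Fin n} (hu : s.natArr 2 (s.natVar 14 + s.natVar 16) = u) (hui : u ∈ D.bag i)
    (hmin : u ∉ S → ∀ i, u ∈ D.bag i → m ≤ rank i) :
    Tri discoverStep s 30 (fun s' => ∃ top', RepDiscovery D rank (insert u S) m top' s') := by
  refine .seq_asg (.branch (B' := 13) (fun hb => Tri.mono (.seq_asg (.seq_put (.seq_put
    (.put (Q := fun s' => ∃ top', RepDiscovery D rank (insert u S) m top' s') ?_ le_rfl)
    le_rfl) le_rfl) le_rfl) (by simp [NatExpr.cost]) (fun _ h _ => h))
    (fun hb => .skip (by omega) ?_) le_rfl) (by simp [NatExpr.cost, BoolExpr.cost])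
  · have huS : u ∉ S := fun hS => by
      have := h.pos_pos u hS
      simp [hu] at hb
      omega
    have e6 : ∀ v : Fin n, v ≠ u → (v : ℕ) ≠ u := fun v hv h => hv (Fin.ext h)
    have hne : ∀ v ∈ S, v ≠ u := fun v hv h => huS (h ▸ hv)
    have hlt : ∀ v ∈ S, s.natArr 6 v ≠ s.natVar 12 + 1 := fun v hv => by
      have := h.pos_le v hv
      omega
    refine ⟨Function.update top u i, ?_⟩
    constructor
    · intro v hv
      rw [Finset.mem_insert, not_or] at hv
      simp [hu, e6 v hv.1, h.notMem v hv.2]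
    · intro v hv
      rcases Finset.mem_insert.1 hv with rfl | hv
      · simp [hu]
      · simp [hu, e6 v (hne v hv)]
        exact h.pos_pos v hv
    · intro v hv
      rcases Finset.mem_insert.1 hv with rfl | hv
      · simp [hu]
      · simp [hu, e6 v (hne v hv)]
        exact (h.pos_le v hv).trans (by omega)
    · intro v hv
      rcases Finset.mem_insert.1 hv with rfl | hv
      · simp [hu]
      · simp [hu, e6 v (hne v hv), hlt v hv, h.vertex v hv]
    · intro v hv
      rcases Finset.mem_insert.1 hv with rfl | hv
      · simp [hu, hs]
      · simp [hu, e6 v (hne v hv), hlt v hv, h.top_eq v hv, hne v hv]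
    · intro v hv
      rcases Finset.mem_insert.1 hv with rfl | hv
      · simpa using hui
      · simpa [hne v hv] using h.top_mem v hv
    · intro v hv
      rcases Finset.mem_insert.1 hv with rfl | hv
      · simp [hi]
      · simpa [hne v hv] using h.top_le v hv
    · intro v hv j hj
      rcases Finset.mem_insert.1 hv with rfl | hv
      · simpa [hi] using hmin huS j hj
      · simpa [hne v hv] using h.top_min v hv j hj
    · intro v hv v' hv' hle
      rcases Finset.mem_insert.1 hv with rfl | hv₁ <;> rcases Finset.mem_insert.1 hv' with rfl | hv'
      · exact le_rfl
      · simp [hu, e6 v' (hne v' hv')] at hle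
        have := h.pos_le v' hv'
        omega
      · simpa [hne v hv₁, hi] using h.top_le v hv₁
      · simp [hu, e6 v (hne v hv₁), e6 v' (hne v' hv')] at hle
        simpa [hne v hv₁, hne v' hv'] using h.mono v hv₁ v' hv' hle
    · simp [h.count, Finset.card_insert_of_notMem huS]
  · have huS : u ∈ S := by
      by_contra hS
      have := h.notMem u hS
      simp [hu, this] at hb
    refine ⟨top, ?_⟩
    rw [Finset.insert_eq_self.2 huS]
    exact ⟨h.notMem, h.pos_pos, h.pos_le, h.vertex, h.top_eq, h.top_mem, h.top_le, h.top_min,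
      h.mono, h.count⟩

theorem discoverProg_spec (hw : D.width = t) (h : RepInput D s) (hpos : s.natArr 6 = fun _ => 0)
    {l : List (Fin N)} (hlen : l.length = N) (hl : l.Nodup)
    (ho : ∀ k (hk : k < l.length), s.natArr 5 k = l[k]) :
    Tri discoverProg s (N * ((t + 1) * 37 + 50) + 10) (fun s' =>
      ∃ (pos : Fin n → ℕ) (top : Fin n → Fin N), IsDiscovery D (fun i => l.idxOf i) pos top ∧
        ∀ u : Fin n, s'.natArr 6 u = pos u ∧ s'.natArr 7 (pos u) = u ∧ s'.natArr 8 (pos u) = top u) := by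
  have hmem : ∀ i, i ∈ l := by
    intro i
    have : l.toFinset = Finset.univ := Finset.eq_univ_of_card _ (by
      rw [List.toFinset_card_of_nodup hl, hlen, Fintype.card_fin])
    rw [← List.mem_toFinset, this]
    exact Finset.mem_univ i
  have hidx : ∀ i, l.idxOf i < N := fun i =>
    (List.idxOf_lt_length_of_mem (hmem i)).trans_eq hlen
  set rank : Fin N → ℕ := fun i => l.idxOf i with hrank
  -- The vertices that have been met after the first `k` nodes of the order.
  let S : ℕ → Finset (Fin n) := fun k => Finset.univ.filter fun u => ∃ i, rank i < k ∧ u ∈ D.bag i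
  refine Tri.mono (.seq_asg (Tri.forUp_const N
    (fun k s' => ∃ top, RepDiscovery D rank (S k) k top s') ((t + 1) * 37 + 35) ?_ ?_ ?_ le_rfl)
    le_rfl) ?_ ?_
  · simp [h.nodes]
  · have hS : S 0 = ∅ := by simp [S]
    refine ⟨fun _ => D.tree.root, ?_⟩
    rw [hS]
    constructor <;> simp [hpos]
  · rintro k hk s₁ hk₁ ⟨top, hI⟩ hF
    have hI₁ : RepInput D s₁ := RepInput.of_frame (s := s.setN 12 0)
      ⟨h.vertices, h.nodes, h.parent, h.offset, h.bags⟩ hF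
    have ho₁ : s₁.natArr 5 k = l[k] := by
      rw [hF.natArr 5 rfl]
      exact ho k (by omega)
    set i := l[k] with hidef
    have hi : rank i = k := hl.idxOf_getElem k _
    have hcard := D.card_bag_le hw i
    have hoff := D.offsetArray_succ i
    refine Tri.mono (.seq_asg (.seq_asg (.seq_asg (Tri.forUp_const (D.bag i).card
      (fun r s' => ∃ top, RepDiscovery D rank (S k ∪ ((D.bagList i).take r).toFinset) k top s')
      30 ?_ ?_ ?_ le_rfl) le_rfl) le_rfl) le_rfl) ?_ ?_
    · simp [hk₁, ho₁, hI₁.offset, hoff]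
    · refine ⟨top, ?_⟩
      simp only [List.take_zero, List.toFinset_nil, Finset.union_empty]
      exact ⟨hI.notMem, hI.pos_pos, hI.pos_le, hI.vertex, hI.top_eq, hI.top_mem, hI.top_le,
        hI.top_min, hI.mono, hI.count⟩
    · rintro r hr s₂ hr₂ ⟨top₂, hI₂⟩ hF₂
      have hrl : r < (D.bagList i).length := by rwa [D.length_bagList]
      have e₁ := hF₂.natVar 13 (by omega) rfl
      have e₂ := hF₂.natVar 14 (by omega) rfl
      have e₃ := hF₂.natArr 2 rfl
      simp [hk₁, ho₁, hI₁.offset, hI₁.bags] at e₁ e₂ e₃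
      have hset : S k ∪ ((D.bagList i).take (r + 1)).toFinset =
          insert (D.bagList i)[r] (S k ∪ ((D.bagList i).take r).toFinset) := by
        rw [List.take_add_one, List.getElem?_eq_getElem hrl]
        ext u
        simp only [Option.toList_some, List.toFinset_append, List.toFinset_cons, List.toFinset_nil,
          Finset.mem_union, Finset.mem_insert, List.mem_toFinset, Finset.notMem_empty]
        tauto
      refine (discoverStep_spec hI₂ hi e₁ (u := (D.bagList i)[r]) ?_ ?_ ?_).mono le_rfl
        (fun s₃ h₃ _ => ?_)
      · rw [e₂, e₃, hr₂, D.bagArray_apply i hr]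
      · exact D.mem_bagList.1 (List.getElem_mem _)
      · intro hu i' hi'
        by_contra hlt
        refine hu (Finset.mem_union_left _ ?_)
        simp only [S, Finset.mem_filter, Finset.mem_univ, true_and]
        exact ⟨i', by omega, hi'⟩
      · rw [hset]
        obtain ⟨top₃, h₃⟩ := h₃
        exact ⟨top₃, h₃.notMem, h₃.pos_pos, h₃.pos_le, h₃.vertex, h₃.top_eq, h₃.top_mem, h₃.top_le,
          h₃.top_min, h₃.mono, h₃.count⟩
    · simp only [NatExpr.cost]
      have := Nat.mul_le_mul_right 37 hcard
      omega
    · rintro s₂ ⟨top₂, h₂⟩ -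
      have hset : S (k + 1) = S k ∪ ((D.bagList i).take (D.bag i).card).toFinset := by
        rw [← D.length_bagList, List.take_length]
        ext u
        simp only [S, Finset.mem_filter, Finset.mem_univ, true_and, Finset.mem_union,
          List.mem_toFinset, D.mem_bagList]
        constructor
        · rintro ⟨i', h₁, h₂⟩
          rcases Nat.lt_or_ge (rank i') k with h | h
          · exact .inl ⟨i', h, h₂⟩
          · have : i' = i := (List.idxOf_inj (hmem i')).1 (by
              change rank i' = rank i
              omega)
            exact .inr (this ▸ h₂)
        · rintro (⟨i', h₁, h₂⟩ | h)
          · exact ⟨i', by omega, h₂⟩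
          · exact ⟨i, by omega, h⟩
      refine ⟨top₂, ?_⟩
      rw [hset]
      exact ⟨h₂.notMem, h₂.pos_pos, h₂.pos_le, h₂.vertex, h₂.top_eq, h₂.top_mem,
        fun u hu => (h₂.top_le u hu).trans (by omega), h₂.top_min, h₂.mono, h₂.count⟩
  · simp only [NatExpr.cost]
    have : N * ((t + 1) * 37 + 35 + 7) ≤ N * ((t + 1) * 37 + 50) :=
      Nat.mul_le_mul_left _ (by omega)
    omega
  · rintro s' ⟨top, h'⟩ -
    have hS : S N = Finset.univ := by
      refine Finset.eq_univ_of_forall fun u => ?_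
      obtain ⟨i, hi⟩ := D.cover u
      simp only [S, Finset.mem_filter, Finset.mem_univ, true_and]
      exact ⟨i, hidx i, hi⟩
    rw [hS] at h'
    have hm := fun u : Fin n => Finset.mem_univ u
    refine ⟨fun u => s'.natArr 6 u, top, ⟨fun u => h'.pos_pos u (hm u), fun u => ?_,
      fun u v huv => ?_, fun u => h'.top_mem u (hm u), fun u => h'.top_min u (hm u),
      fun u v => h'.mono u (hm u) v (hm v)⟩,
      fun u => ⟨rfl, h'.vertex u (hm u), h'.top_eq u (hm u)⟩⟩
    · have := h'.pos_le u (hm u)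
      rw [h'.count] at this
      simpa using this
    · have h₁ := h'.vertex u (hm u)
      have h₂ := h'.vertex v (hm v)
      rw [huv, h₂] at h₁
      exact Fin.ext h₁.symm

end Discover

/-! ### The program that computes parents and slots -/

/-- The body of the inner loop of `neighbourProg`. -/
def neighbourStep : Prog :=
  .seq (asg 17 (.get 6 (.get 2 (.add (.var 14) (.var 16))))) (branch (.lt (.var 17) (.var 11))
    (.seq (put 9 (.get 10 (.var 17)) (.var 11))
      (branch (.lt (.var 18) (.var 17)) (asg 18 (.var 17)) skip)) skip)

/-- Compute the last earlier neighbour of the position in variable `11`, and mark the slots of all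
its earlier neighbours. -/
def neighbourProg : Prog :=
  .seq (asg 13 (.get 8 (.var 11))) (.seq (asg 14 (.get 1 (.var 13)))
    (.seq (asg 15 (.sub (.get 1 (.add (.var 13) (.lit 1))) (.var 14)))
      (.seq (asg 18 (.lit 0)) (forUp 16 15 neighbourStep))))

/-- Find the first slot that is not marked. -/
def slotProg : Prog :=
  .seq (asg 19 (.lit 0)) (repeatWhile (.eq (.get 9 (.var 19)) (.var 11))
    (asg 19 (.add (.var 19) (.lit 1))))

/-- Compute the parents and the slots of all positions, and the number of slots. -/
def elimProg : Prog :=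
  .seq (asg 3 (.lit 0)) (forUp 10 0 (.seq (asg 11 (.add (.var 10) (.lit 1)))
    (.seq neighbourProg (.seq (put 11 (.var 11) (.var 18)) (.seq slotProg
      (.seq (put 10 (.var 11) (.var 19))
        (branch (.lt (.var 3) (.add (.var 19) (.lit 1))) (asg 3 (.add (.var 19) (.lit 1)))
          skip)))))))

section Elim

variable {n N t : ℕ} {G : SimpleGraph (Fin n)} {D : TreeDecomposition G N} {s : State}
  {pos : Fin n → ℕ} {top : Fin n → Fin N}

/-- The arrays `6`, `7` and `8` represent the numbering of the vertices. -/
def RepPos (pos : Fin n → ℕ) (top : Fin n → Fin N) (s : State) : Prop :=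
  ∀ u : Fin n, s.natArr 6 u = pos u ∧ s.natArr 7 (pos u) = u ∧ s.natArr 8 (pos u) = top u

theorem RepPos.of_frame {p : Prog} {s' : State} (h : RepPos pos top s) (hF : Frame p s s')
    (hp : p.any (Op.writesA 6) = false ∧ p.any (Op.writesA 7) = false ∧
      p.any (Op.writesA 8) = false := by decide) : RepPos pos top s' := by
  rw [RepPos, hF.natArr 6 hp.1, hF.natArr 7 hp.2.1, hF.natArr 8 hp.2.2]
  exact h

/-- The positions in `X` have been processed: variable `18` contains the last one, and their slots
are marked in array `9` by `c`. -/
structure RepNeighbours (c : ℕ) (X : Finset ℕ) (s : State) : Prop where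
  last : s.natVar 18 = X.sup id
  marked : ∀ e, s.natArr 9 e = c ↔ ∃ x ∈ X, s.natArr 10 x = e
  le : ∀ e, s.natArr 9 e ≤ c

theorem neighbourStep_spec {c : ℕ} {X : Finset ℕ} (h : RepNeighbours c X s)
    (hc : s.natVar 11 = c) {x : ℕ} (hx : s.natArr 6 (s.natArr 2 (s.natVar 14 + s.natVar 16)) = x) :
    Tri neighbourStep s 30 (RepNeighbours c (if x < c then insert x X else X)) := by
  have hmark : ∀ e, (Function.update (s.natArr 9) (s.natArr 10 x) c e = c ↔
      ∃ z ∈ insert x X, s.natArr 10 z = e) ∧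
      Function.update (s.natArr 9) (s.natArr 10 x) c e ≤ c := by
    intro e
    have h₁ := h.marked e
    have h₂ := h.le e
    rw [Function.update_apply, Finset.exists_mem_insert]
    split_ifs with he
    · simp [he]
    · simp [h₁, h₂, Ne.symm he]
  refine .seq_asg (.branch (B' := 20) (fun hb => .seq_put (B' := 8) (.branch (B' := 4)
    (fun hb' => .asg ?_ (by simp [NatExpr.cost])) (fun hb' => .skip (by omega) ?_)
    (by simp [NatExpr.cost, BoolExpr.cost])) (by simp [NatExpr.cost]))
    (fun hb => .skip (by omega) ?_) le_rfl) (by simp [NatExpr.cost, BoolExpr.cost])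
  · simp [hx, hc] at hb hb'
    rw [if_pos hb]
    refine ⟨?_, fun e => ?_, fun e => ?_⟩
    · rw [h.last] at hb'
      simp [hx, Finset.sup_insert, hb'.le]
    · simpa [hx, hc] using (hmark e).1
    · simpa [hx, hc] using (hmark e).2
  · simp [hx, hc] at hb hb'
    rw [if_pos hb]
    refine ⟨?_, fun e => ?_, fun e => ?_⟩
    · rw [h.last] at hb'
      simp [h.last, Finset.sup_insert, hb']
    · simpa [hx, hc] using (hmark e).1
    · simpa [hx, hc] using (hmark e).2
  · simp [hx, hc] at hb
    rw [if_neg (by omega)]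
    exact ⟨h.last, h.marked, h.le⟩

/-- Slots are marked with the number of the current position. Older marks are smaller, as `hm` says,
so array `9` never has to be cleared between positions. -/
theorem neighbourProg_spec (hw : D.width = t) (h : RepInput D s) (hp : RepPos pos top s)
    (H : Function.Injective pos) {v : Fin n} (hc : s.natVar 11 = pos v)
    (hm : ∀ e, s.natArr 9 e < pos v) :
    Tri neighbourProg s ((t + 1) * 37 + 40)
      (RepNeighbours (pos v) (earlier D pos top (pos v))) := by
  have htop := (hp v).2.2
  have hoff := D.offsetArray_succ (top v)
  have hcard := D.card_bag_le hw (top v)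
  let X : ℕ → Finset ℕ := fun r =>
    (((D.bagList (top v)).take r).toFinset.image pos).filter fun x => x < pos v
  refine Tri.mono (.seq_asg (.seq_asg (.seq_asg (.seq_asg (Tri.forUp_const (D.bag (top v)).card
    (fun r s' => RepNeighbours (pos v) (X r) s') 30 ?_ ?_ ?_ le_rfl) le_rfl) le_rfl) le_rfl)
    le_rfl) ?_ ?_
  · simp [hc, htop, h.offset, hoff]
  · refine ⟨by simp [X], fun e => ?_, fun e => ?_⟩
    · simpa [X] using (hm e).ne
    · simpa using (hm e).le
  · rintro r hr s₂ hr₂ hI hF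
    have hrl : r < (D.bagList (top v)).length := by rwa [D.length_bagList]
    have e₁ := hF.natVar 11 (by omega) rfl
    have e₂ := hF.natVar 14 (by omega) rfl
    have e₃ := hF.natArr 2 rfl
    have e₄ := hF.natArr 6 rfl
    simp [hc, htop, h.offset, h.bags] at e₁ e₂ e₃ e₄
    refine (neighbourStep_spec hI e₁ (x := pos (D.bagList (top v))[r]) ?_).mono le_rfl
      (fun s₃ h₃ _ => ?_)
    · rw [e₂, e₃, e₄, hr₂, D.bagArray_apply _ hr]
      exact (hp _).1
    · have hX : X (r + 1) = if pos (D.bagList (top v))[r] < pos v then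
          insert (pos (D.bagList (top v))[r]) (X r) else X r := by
        simp only [X]
        rw [List.take_add_one, List.getElem?_eq_getElem hrl, List.toFinset_append,
          Finset.image_union, Finset.filter_union, Finset.union_comm]
        simp only [Option.toList_some, List.toFinset_cons, List.toFinset_nil,
          Finset.image_insert, Finset.image_empty, Finset.filter_insert, Finset.filter_empty]
        split_ifs
        · rw [Finset.insert_union, Finset.empty_union]
        · rw [Finset.empty_union]
      rw [hX]
      exact ⟨h₃.last, h₃.marked, h₃.le⟩
  · simp only [NatExpr.cost]
    have := Nat.mul_le_mul_right 37 hcard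
    omega
  · rintro s' hI -
    have hX : X (D.bag (top v)).card = earlier D pos top (pos v) := by
      simp only [X]
      rw [← D.length_bagList, List.take_length]
      ext x
      simp only [Finset.mem_filter, Finset.mem_image, List.mem_toFinset, D.mem_bagList, mem_earlier]
      constructor
      · rintro ⟨⟨u, hu, rfl⟩, hlt⟩
        exact ⟨u, ⟨hlt, v, rfl, hu⟩, rfl⟩
      · rintro ⟨u, ⟨hlt, v', hv', hu⟩, rfl⟩
        rw [H hv'] at hu
        exact ⟨⟨u, hu, rfl⟩, hlt⟩
    rwa [← hX]

/-- There are few earlier neighbours. -/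
theorem card_earlier_le (hw : D.width = t) (htop : ∀ u, u ∈ D.bag (top u))
    (H : Function.Injective pos) (v : Fin n) : (earlier D pos top (pos v)).card ≤ t := by
  have hsub : earlier D pos top (pos v) ⊆ ((D.bag (top v)).erase v).image pos := by
    intro x hx
    obtain ⟨u, ⟨hlt, v', hv', hu⟩, rfl⟩ := mem_earlier.1 hx
    rw [H hv'] at hu
    exact Finset.mem_image_of_mem _ (Finset.mem_erase.2 ⟨by rintro rfl; omega, hu⟩)
  have h₁ := (Finset.card_le_card hsub).trans Finset.card_image_le
  rw [Finset.card_erase_of_mem (htop v)] at h₁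
  have := D.card_bag_le hw (top v)
  omega

/-- Greedy colouring: all slots below the first free one are occupied by members of `X`, so the
first free slot is at most `X.card`. -/
theorem slotProg_spec {c : ℕ} {X : Finset ℕ} (h : RepNeighbours c X s) (hc : s.natVar 11 = c) :
    Tri slotProg s (X.card * 10 + 10) (fun s' => s'.natVar 19 ≤ X.card ∧
      ∀ x ∈ X, s.natArr 10 x ≠ s'.natVar 19) := by
  set Y : Set ℕ := {e | ∀ x ∈ X, s.natArr 10 x ≠ e} with hY
  have hne : Y.Nonempty := by
    obtain ⟨e, he⟩ := Infinite.exists_notMem_finset (X.image (s.natArr 10))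
    exact ⟨e, fun x hx h => he (Finset.mem_image.2 ⟨x, hx, h⟩)⟩
  have h₁ : sInf Y ∈ Y := Nat.sInf_mem hne
  have h₂ : ∀ e < sInf Y, ∃ x ∈ X, s.natArr 10 x = e := by
    intro e he
    have := Nat.notMem_of_lt_sInf he
    simpa [hY] using this
  have hle : sInf Y ≤ X.card := by
    have hsub : Finset.range (sInf Y) ⊆ X.image (s.natArr 10) := fun e he => by
      obtain ⟨x, hx, hxe⟩ := h₂ e (Finset.mem_range.1 he)
      exact Finset.mem_image.2 ⟨x, hx, hxe⟩
    simpa using (Finset.card_le_card hsub).trans Finset.card_image_le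
  refine Tri.mono (.seq_asg (Tri.repeatWhile (sInf Y) (fun j s' => s'.natVar 19 = j) (fun _ => 4)
    ?_ ?_ ?_) le_rfl) ?_ (fun s' h' _ => ?_)
  · simp
  · rintro j hj s' hj' hF
    have e₁ := hF.natArr 9 rfl
    have e₂ := hF.natVar 11 (by omega) rfl
    simp [hc] at e₁ e₂
    refine ⟨?_, .asg ?_ (by simp [NatExpr.cost])⟩
    · simp only [BoolExpr.Holds, NatExpr.eval, e₁, e₂, hj']
      exact (h.marked j).2 (h₂ j hj)
    · simp [hj']
  · rintro s' hj' hF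
    have e₁ := hF.natArr 9 rfl
    have e₂ := hF.natVar 11 (by omega) rfl
    simp [hc] at e₁ e₂
    simp only [BoolExpr.Holds, NatExpr.eval, e₁, e₂, hj', h.marked]
    rintro ⟨x, hx, hxe⟩
    exact h₁ x hx hxe
  · simp [BoolExpr.cost, NatExpr.cost]
    omega
  · rw [h']
    exact ⟨hle, h₁⟩

/-- The parents and the slots of the positions `1, …, j` have been computed. -/
structure RepElim (D : TreeDecomposition G N) (pos : Fin n → ℕ) (top : Fin n → Fin N) (t j : ℕ)
    (s : State) : Prop where
  par : ∀ c, 1 ≤ c → c ≤ j → s.natArr 11 c = (earlier D pos top c).sup id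
  slot_ne : ∀ c, 1 ≤ c → c ≤ j → ∀ x ∈ earlier D pos top c, s.natArr 10 x ≠ s.natArr 10 c
  slot_lt : ∀ c, 1 ≤ c → c ≤ j → s.natArr 10 c < s.natVar 3
  le : s.natVar 3 ≤ t + 1
  mark_le : ∀ e, s.natArr 9 e ≤ j

theorem elimProg_spec (hw : D.width = t) (h : RepInput D s) (hp : RepPos pos top s)
    {rank : Fin N → ℕ} (H : IsDiscovery D rank pos top) (hm : s.natArr 9 = fun _ => 0) :
    Tri elimProg s (n * ((t + 1) * 47 + 100) + 10) (RepElim D pos top t n) := by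
  refine Tri.mono (.seq_asg (Tri.forUp_const n (RepElim D pos top t) ((t + 1) * 47 + 90)
    h.vertices ?_ ?_ le_rfl) le_rfl) ?_ (fun _ h _ => h)
  · refine ⟨by omega, by omega, by omega, by simp, by simp [hm]⟩
  · rintro j hj s₁ hj₁ hI hF
    obtain ⟨v, hv⟩ := H.exists_pos_eq (c := j + 1) (by omega) (by omega)
    have hI₁ : RepInput D s₁ := RepInput.of_frame (s := s.setN 3 0)
      ⟨h.vertices, h.nodes, h.parent, h.offset, h.bags⟩ hF
    have hp₁ : RepPos pos top s₁ := RepPos.of_frame (s := s.setN 3 0) hp hF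
    have hcard := card_earlier_le hw H.top_mem H.pos_inj v
    refine .seq_asg (B' := (t + 1) * 47 + 86) (.seq (neighbourProg_spec (v := v) (top := top) hw ?_ ?_
      H.pos_inj ?_ ?_) (B₂ := (t + 1) * 10 + 46) (fun s₂ h₂ hF₂ => ?_) (by omega))
      (by simp only [NatExpr.cost]; omega)
    · exact ⟨hI₁.vertices, hI₁.nodes, hI₁.parent, hI₁.offset, hI₁.bags⟩
    · exact hp₁
    · simp [hj₁, hv]
    · intro e
      have := hI.mark_le e
      rw [hv]
      simp
      omega
    rw [hv] at h₂ hcard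
    have c₂ := hF₂.natVar 11 (by omega) rfl
    have a₂ := hF₂.natArr 10 rfl
    have b₂ := hF₂.natArr 11 rfl
    have T₂ := hF₂.natVar 3 (by omega) rfl
    simp [hj₁] at c₂ a₂ b₂ T₂
    refine .seq_put (B' := (t + 1) * 10 + 40) (.seq (slotProg_spec (c := j + 1)
      (X := earlier D pos top (j + 1)) ?_ ?_) (B₂ := 30) (fun s₃ h₃ hF₃ => ?_) (by omega))
      (by simp only [NatExpr.cost]; omega)
    · exact ⟨h₂.last, h₂.marked, h₂.le⟩
    · exact c₂
    have c₃ := hF₃.natVar 11 (by omega) rfl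
    have a₃ := hF₃.natArr 10 rfl
    have b₃ := hF₃.natArr 11 rfl
    have m₃ := hF₃.natArr 9 rfl
    have T₃ := hF₃.natVar 3 (by omega) rfl
    simp [c₂, a₂, b₂, T₂, h₂.last] at c₃ a₃ b₃ m₃ T₃
    simp [a₂] at h₃
    -- Assigning the slot of `j + 1` changes no slot of an earlier neighbour considered so far.
    have hlt : ∀ c ≤ j + 1, ∀ x ∈ earlier D pos top c, x ≠ j + 1 := by
      intro c hc x hx
      obtain ⟨u, hu, rfl⟩ := mem_earlier.1 hx
      omega
    have key : ∀ s₄ : State, s₄.natArr 11 = s₃.natArr 11 → s₄.natArr 9 = s₃.natArr 9 →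
        s₄.natArr 10 = Function.update (s₁.natArr 10) (j + 1) (s₃.natVar 19) →
        s₄.natVar 3 = max (s₁.natVar 3) (s₃.natVar 19 + 1) → RepElim D pos top t (j + 1) s₄ := by
      intro s₄ d₁ d₂ d₃ d₄
      constructor
      · intro c h₁ hc
        rw [d₁, b₃, Function.update_apply]
        split_ifs with hcj
        · rw [hcj]
        · exact hI.par c h₁ (by omega)
      · intro c h₁ hc x hx
        rw [d₃, Function.update_of_ne (hlt c hc x hx), Function.update_apply]
        split_ifs with hcj
        · subst hcj
          exact h₃.2 x hx
        · exact hI.slot_ne c h₁ (by omega) x hx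
      · intro c h₁ hc
        rw [d₃, d₄, Function.update_apply]
        split_ifs with hcj
        · omega
        · exact (hI.slot_lt c h₁ (by omega)).trans_le (le_max_left _ _)
      · have := hI.le
        rw [d₄]
        omega
      · intro e
        rw [d₂, m₃]
        exact h₂.le e
    refine .seq_put (B' := 20) (.branch (B' := 10) (fun hb => .asg (key _ ?_ ?_ ?_ ?_)
      (by simp [NatExpr.cost])) (fun hb => .skip (by omega) (key _ ?_ ?_ ?_ ?_))
      (by simp [NatExpr.cost, BoolExpr.cost])) (by simp [NatExpr.cost])
    · simp
    · simp
    · simp [c₃, a₃]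
    · simp [T₃] at hb ⊢
      omega
    · simp
    · simp
    · simp [c₃, a₃]
    · simp [T₃] at hb ⊢
      omega
  · simp only [NatExpr.cost]
    have : n * ((t + 1) * 47 + 90 + 7) ≤ n * ((t + 1) * 47 + 100) :=
      Nat.mul_le_mul_left _ (by omega)
    omega

end Elim

/-! ### The program that computes powers of two, addresses and bits -/

/-- Compute the powers of two. -/
def powProg : Prog :=
  .seq (asg 4 (.lit 1)) (.seq (put 17 (.lit 0) (.lit 1)) (forUp 10 3
    (.seq (asg 4 (.add (.var 4) (.var 4))) (put 17 (.add (.var 10) (.lit 1)) (.var 4)))))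

/-- Write the multiples of variable `13` into the array `a`, as many as variable `11` says. -/
def multiplesProg (a : ℕ) : Prog :=
  .seq (asg 12 (.lit 0)) (forUp 10 11
    (.seq (put a (.var 10) (.var 12)) (asg 12 (.add (.var 12) (.var 13)))))

/-- Write a bit into the array `16`. -/
def bitStep : Prog :=
  branch (.lt (.var 16) (.var 15)) (put 16 (.add (.var 14) (.var 16)) (.lit 0))
    (branch (.lt (.var 16) (.var 18)) (put 16 (.add (.var 14) (.var 16)) (.lit 1))
      (put 16 (.add (.var 14) (.var 16)) (.get 16 (.sub (.add (.var 14) (.var 16)) (.var 18)))))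

/-- Compute the bits of all masks. -/
def bitProg : Prog :=
  forUp 10 3 (.seq (asg 14 (.get 15 (.var 10))) (.seq (asg 15 (.get 17 (.var 10)))
    (.seq (asg 18 (.get 17 (.add (.var 10) (.lit 1)))) (forUp 16 4 bitStep))))

/-- Compute all tables that do not depend on the graph. -/
def tablesProg : Prog :=
  .seq powProg (.seq (asg 13 (.var 0)) (.seq (asg 11 (.var 0)) (.seq (multiplesProg 12)
    (.seq (asg 13 (.add (.var 0) (.lit 1))) (.seq (asg 11 (.var 4)) (.seq (multiplesProg 13)
      (.seq (asg 13 (.var 12)) (.seq (asg 11 (.add (.add (.var 0) (.var 0)) (.lit 1)))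
        (.seq (multiplesProg 14) (.seq (asg 13 (.var 4)) (.seq (asg 11 (.var 3))
          (.seq (multiplesProg 15) bitProg))))))))))))

/-- The address of the entry `k` of the row for the mask `m` in the table `i`. -/
def addr (n T i m k : ℕ) : ℕ := i * (2 ^ T * (n + 1)) + m * (n + 1) + k

/-- The address is a mixed-radix number with digits `i`, `m`, `k` and bases 2^T and n + 1. -/
theorem addr_inj {n T i m k i' m' k' : ℕ} (hm : m < 2 ^ T) (hk : k ≤ n) (hm' : m' < 2 ^ T)
    (hk' : k' ≤ n) (h : addr n T i m k = addr n T i' m' k') : i = i' ∧ m = m' ∧ k = k' := by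
  have key : ∀ {a a' b b' B : ℕ}, b < B → b' < B → a * B + b = a' * B + b' → a = a' ∧ b = b' := by
    intro a a' b b' B hb hb' h
    have h₁ := congrArg (· / B) h
    have h₂ := congrArg (· % B) h
    have hB : 0 < B := by omega
    simp only [Nat.add_comm _ b, Nat.add_comm _ b', Nat.add_mul_div_right _ _ hB,
      Nat.add_mul_mod_self_right, Nat.div_eq_of_lt hb, Nat.div_eq_of_lt hb', Nat.mod_eq_of_lt hb,
      Nat.mod_eq_of_lt hb', Nat.zero_add] at h₁ h₂
    exact ⟨h₁, h₂⟩
  have h₁ : ∀ i m k, addr n T i m k = (i * 2 ^ T + m) * (n + 1) + k := fun i m k => by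
    rw [addr]; ring
  rw [h₁, h₁] at h
  obtain ⟨h₂, h₃⟩ := key (by omega) (by omega) h
  obtain ⟨h₄, h₅⟩ := key hm hm' h₂
  exact ⟨h₄, h₅, h₃⟩

section Tables

variable {n T Q : ℕ} {s : State}

theorem powProg_spec (hT : s.natVar 3 = T) : Tri powProg s (T * 30 + 30) (fun s' =>
    s'.natVar 4 = 2 ^ T ∧ ∀ i ≤ T, s'.natArr 17 i = 2 ^ i) := by
  refine Tri.mono (.seq_asg (.seq_put (Tri.forUp_const T (fun j s' => s'.natVar 4 = 2 ^ j ∧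
    ∀ i ≤ j, s'.natArr 17 i = 2 ^ i) 20 ?_ ?_ ?_ le_rfl) le_rfl) le_rfl) ?_ (fun _ h _ => h)
  · simpa using hT
  · simp
  · rintro j hj s' hj' ⟨h₁, h₂⟩ -
    refine .seq_asg (B' := 10) (.put ⟨?_, fun i hi => ?_⟩ (by simp [NatExpr.cost]))
      (by simp [NatExpr.cost])
    · simp [h₁, pow_succ]
      omega
    · simp only [NatExpr.eval, State.setN_natArr, State.setA_natArr, State.setN_natVar, if_true,
        Function.update_apply]
      simp only [hj', h₁, Nat.reduceEqDiff, if_false]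
      split_ifs with h
      · rw [h, pow_succ]; omega
      · exact h₂ i (by omega)
  · simp only [NatExpr.cost]
    omega

theorem multiplesProg_spec {a len q : ℕ} (h₁ : s.natVar 11 = len) (h₂ : s.natVar 13 = q) :
    Tri (multiplesProg a) s (len * 30 + 10) (fun s' => s'.natVar 12 = len * q ∧
      ∀ x < len, s'.natArr a x = x * q) := by
  refine Tri.mono (.seq_asg (Tri.forUp_const len (fun j s' => s'.natVar 12 = j * q ∧
    ∀ x < j, s'.natArr a x = x * q) 20 ?_ ?_ ?_ le_rfl (by decide) ⟨rfl, rfl⟩) le_rfl) ?_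
    (fun _ h _ => h)
  · simpa using h₁
  · simp
  · rintro j hj s' hj' ⟨h₃, h₄⟩ hF
    have h₅ : s'.natVar 13 = q := by
      rw [hF.natVar 13 (by omega) rfl]
      simpa using h₂
    refine .seq_put (B' := 10) (.asg ⟨?_, fun x hx => ?_⟩ (by simp [NatExpr.cost]))
      (by simp [NatExpr.cost])
    · simp [h₃, h₅]
      ring
    · simp only [NatExpr.eval, State.setN_natArr, State.setA_natArr, if_true,
        Function.update_apply, hj', h₃]
      split_ifs with h
      · rw [h]
      · exact h₄ x (by omega)
  · simp only [NatExpr.cost]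
    omega

theorem bitProg_spec (hT : s.natVar 3 = T) (hQ : s.natVar 4 = 2 ^ T)
    (h17 : ∀ i ≤ T, s.natArr 17 i = 2 ^ i) (h15 : ∀ i < T, s.natArr 15 i = i * 2 ^ T) :
    Tri bitProg s (T * (2 ^ T * 30 + 30) + 10) (fun s' =>
      ∀ i < T, ∀ m < 2 ^ T, s'.natArr 16 (i * 2 ^ T + m) = bit m i) := by
  refine Tri.mono (Tri.forUp_const T (fun j s' =>
    ∀ i < j, ∀ m < 2 ^ T, s'.natArr 16 (i * 2 ^ T + m) = bit m i) (2 ^ T * 30 + 20) hT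
    (fun i hi => by omega) ?_ le_rfl) ?_ (fun _ h _ => h)
  · intro j hj s₁ hj₁ hI hF
    have e₁ := hF.natArr 15 rfl
    have e₂ := hF.natArr 17 rfl
    have e₃ := hF.natVar 4 (by omega) rfl
    refine Tri.mono (.seq_asg (.seq_asg (.seq_asg (Tri.forUp_const (2 ^ T) (fun r s' =>
      ∀ i m, m < 2 ^ T → (i < j ∨ i = j ∧ m < r) → s'.natArr 16 (i * 2 ^ T + m) = bit m i) 23
      ?_ ?_ ?_ le_rfl) le_rfl) le_rfl) le_rfl) ?_ ?_
    · simp [e₃, hQ]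
    · intro i m hm h
      exact hI i (by omega) m hm
    · intro r hr s₂ hr₂ hI₂ hF₂
      have d₁ := hF₂.natVar 14 (by omega) rfl
      have d₂ := hF₂.natVar 15 (by omega) rfl
      have d₃ := hF₂.natVar 18 (by omega) rfl
      simp [hj₁, e₁, e₂, h15 j hj, h17 j hj.le, h17 (j + 1) hj] at d₁ d₂ d₃
      have key : ∀ s₃ : State, s₃.natArr 16 =
          Function.update (s₂.natArr 16) (j * 2 ^ T + r) (bit r j) →
          ∀ i m, m < 2 ^ T → (i < j ∨ i = j ∧ m < r + 1) →
            s₃.natArr 16 (i * 2 ^ T + m) = bit m i := by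
        intro s₃ h₃ i m hm him
        rw [h₃, Function.update_apply]
        split_ifs with h
        · have h₁ : i = j ∧ m = r := by
            have hle : i ≤ j := by omega
            obtain ⟨d, rfl⟩ := Nat.exists_eq_add_of_le hle
            rcases Nat.eq_zero_or_pos d with rfl | hd
            · rw [Nat.add_zero] at h
              exact ⟨rfl, by omega⟩
            · have h₁ : 2 ^ T ≤ d * 2 ^ T := Nat.le_mul_of_pos_left _ hd
              rw [Nat.add_mul] at h
              omega
          rw [h₁.1, h₁.2]
        · refine hI₂ i m hm ?_
          rcases him with h' | ⟨rfl, h'⟩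
          · exact .inl h'
          · refine .inr ⟨rfl, ?_⟩
            by_contra hc
            exact h (by rw [show m = r by omega])
      -- Digit `j` of `r` is 0 below 2^j, 1 from there up to 2^(j + 1), and afterwards equals the
      -- digit of `r - 2 ^ (j + 1)`, which is already in the row.
      refine .branch (B' := 17) (fun hb => .put (key _ ?_) (by simp [NatExpr.cost]))
        (fun hb => .branch (B' := 12) (fun hb' => .put (key _ ?_) (by simp [NatExpr.cost]))
        (fun hb' => .put (key _ ?_) (by simp [NatExpr.cost]))
        (by simp [NatExpr.cost, BoolExpr.cost])) (by simp [NatExpr.cost, BoolExpr.cost])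
      · simp [hr₂, d₂] at hb
        simp [d₁, hr₂, bit_of_lt hb]
      · simp [hr₂, d₂, d₃] at hb hb'
        simp [d₁, hr₂, bit_of_lt_succ hb hb']
      · simp [hr₂, d₂, d₃] at hb hb'
        have := hI₂ j (r - 2 ^ (j + 1)) (by omega) (.inr ⟨rfl, by
          have : 0 < 2 ^ (j + 1) := by positivity
          omega⟩)
        rw [← Nat.add_sub_assoc hb', bit_sub hb'] at this
        simp [d₁, d₃, hr₂, this]
    · simp only [NatExpr.cost]
      omega
    · intro s' h' _ i hi m hm
      exact h' i m hm (by omega)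
  · have : T * (2 ^ T * 30 + 20 + 7) ≤ T * (2 ^ T * 30 + 30) := Nat.mul_le_mul_left _ (by omega)
    omega

/-- The memory contains the tables that `tablesProg` computes. -/
structure RepTables (n T : ℕ) (s : State) : Prop where
  vertices : s.natVar 0 = n
  slots : s.natVar 3 = T
  masks : s.natVar 4 = 2 ^ T
  rowN : ∀ x < n, s.natArr 12 x = x * n
  rowM : ∀ m < 2 ^ T, s.natArr 13 m = m * (n + 1)
  base : ∀ i ≤ n + n, s.natArr 14 i = i * (2 ^ T * (n + 1))
  rowQ : ∀ i < T, s.natArr 15 i = i * 2 ^ T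
  bits : ∀ i < T, ∀ m < 2 ^ T, s.natArr 16 (i * 2 ^ T + m) = bit m i
  pow : ∀ i ≤ T, s.natArr 17 i = 2 ^ i

theorem RepTables.of_frame {p : Prog} {s' : State} (h : RepTables n T s) (hF : Frame p s s')
    (hv : p.any (Op.writesN 0) = false ∧ p.any (Op.writesN 3) = false ∧
      p.any (Op.writesN 4) = false := by decide)
    (ha : (p.any (Op.writesA 12) = false ∧ p.any (Op.writesA 13) = false ∧
      p.any (Op.writesA 14) = false) ∧ p.any (Op.writesA 15) = false ∧
      p.any (Op.writesA 16) = false ∧ p.any (Op.writesA 17) = false := by decide) :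
    RepTables n T s' where
  vertices := (hF.natVar 0 (by omega) hv.1).trans h.vertices
  slots := (hF.natVar 3 (by omega) hv.2.1).trans h.slots
  masks := (hF.natVar 4 (by omega) hv.2.2).trans h.masks
  rowN := by rw [hF.natArr 12 ha.1.1]; exact h.rowN
  rowM := by rw [hF.natArr 13 ha.1.2.1]; exact h.rowM
  base := by rw [hF.natArr 14 ha.1.2.2]; exact h.base
  rowQ := by rw [hF.natArr 15 ha.2.1]; exact h.rowQ
  bits := by rw [hF.natArr 16 ha.2.2.1]; exact h.bits
  pow := by rw [hF.natArr 17 ha.2.2.2]; exact h.pow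

theorem tablesProg_spec (hn : s.natVar 0 = n) (hT : s.natVar 3 = T) :
    Tri tablesProg s (T * (2 ^ T * 30 + 100) + 2 ^ T * 30 + n * 100 + 300) (RepTables n T) := by
  refine .seq (powProg_spec hT) (B₂ := T * (2 ^ T * 30 + 70) + 2 ^ T * 30 + n * 100 + 270)
    (fun s₁ ⟨q₁, p₁⟩ hF₁ => ?_) (by rw [Nat.mul_add, Nat.mul_add]; omega)
  have n₁ := (hF₁.natVar 0 (by omega) rfl).trans hn
  have t₁ := (hF₁.natVar 3 (by omega) rfl).trans hT
  refine .seq_asg (B' := T * (2 ^ T * 30 + 70) + 2 ^ T * 30 + n * 100 + 260) (.seq_asg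
    (B' := T * (2 ^ T * 30 + 70) + 2 ^ T * 30 + n * 100 + 250) (.seq (multiplesProg_spec
    (len := n) (q := n) (by simp [n₁]) (by simp [n₁]))
    (B₂ := T * (2 ^ T * 30 + 70) + 2 ^ T * 30 + n * 70 + 240) (fun s₂ ⟨_, a₂⟩ hF₂ => ?_)
    (by omega)) (by simp only [NatExpr.cost]; omega)) (by simp only [NatExpr.cost]; omega)
  have n₂ := hF₂.natVar 0 (by omega) rfl
  have t₂ := hF₂.natVar 3 (by omega) rfl
  have q₂ := hF₂.natVar 4 (by omega) rfl
  have p₂ := hF₂.natArr 17 rfl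
  simp [n₁, t₁, q₁] at n₂ t₂ q₂ p₂
  refine .seq_asg (B' := T * (2 ^ T * 30 + 70) + 2 ^ T * 30 + n * 70 + 230) (.seq_asg
    (B' := T * (2 ^ T * 30 + 70) + 2 ^ T * 30 + n * 70 + 220) (.seq (multiplesProg_spec
    (len := 2 ^ T) (q := n + 1) (by simp [q₂]) (by simp [n₂]))
    (B₂ := T * (2 ^ T * 30 + 70) + n * 70 + 210) (fun s₃ ⟨v₃, a₃⟩ hF₃ => ?_)
    (by omega)) (by simp only [NatExpr.cost]; omega)) (by simp only [NatExpr.cost]; omega)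
  have n₃ := hF₃.natVar 0 (by omega) rfl
  have t₃ := hF₃.natVar 3 (by omega) rfl
  have q₃ := hF₃.natVar 4 (by omega) rfl
  have p₃ := hF₃.natArr 17 rfl
  have b₃ := hF₃.natArr 12 rfl
  simp [n₂, t₂, q₂, p₂] at n₃ t₃ q₃ p₃ b₃
  -- Variable `12` now holds the size 2^T·(n + 1) of a table, a product obtained by repeated
  -- addition. There are n + 1 initial and n merged tables, hence `n + n + 1` base addresses.
  refine .seq_asg (B' := T * (2 ^ T * 30 + 70) + n * 70 + 200) (.seq_asg
    (B' := T * (2 ^ T * 30 + 70) + n * 70 + 190) (.seq (multiplesProg_spec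
    (len := n + n + 1) (q := 2 ^ T * (n + 1)) (by simp [n₃]) (by simp [v₃]))
    (B₂ := T * (2 ^ T * 30 + 70) + 140) (fun s₄ ⟨v₄, a₄⟩ hF₄ => ?_)
    (by omega)) (by simp only [NatExpr.cost]; omega)) (by simp only [NatExpr.cost]; omega)
  have n₄ := hF₄.natVar 0 (by omega) rfl
  have t₄ := hF₄.natVar 3 (by omega) rfl
  have q₄ := hF₄.natVar 4 (by omega) rfl
  have p₄ := hF₄.natArr 17 rfl
  have b₄ := hF₄.natArr 12 rfl
  have c₄ := hF₄.natArr 13 rfl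
  simp [n₃, t₃, q₃, p₃, b₃] at n₄ t₄ q₄ p₄ b₄ c₄
  refine .seq_asg (B' := T * (2 ^ T * 30 + 70) + 130) (.seq_asg
    (B' := T * (2 ^ T * 30 + 70) + 120) (.seq (multiplesProg_spec
    (len := T) (q := 2 ^ T) (by simp [t₄]) (by simp [q₄]))
    (B₂ := T * (2 ^ T * 30 + 40) + 100) (fun s₅ ⟨v₅, a₅⟩ hF₅ => ?_)
    (by rw [Nat.mul_add, Nat.mul_add]; omega)) (by simp only [NatExpr.cost]; omega))
    (by simp only [NatExpr.cost]; omega)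
  have n₅ := hF₅.natVar 0 (by omega) rfl
  have t₅ := hF₅.natVar 3 (by omega) rfl
  have q₅ := hF₅.natVar 4 (by omega) rfl
  have p₅ := hF₅.natArr 17 rfl
  have b₅ := hF₅.natArr 12 rfl
  have c₅ := hF₅.natArr 13 rfl
  have d₅ := hF₅.natArr 14 rfl
  simp [n₄, t₄, q₄, p₄, b₄, c₄] at n₅ t₅ q₅ p₅ b₅ c₅ d₅
  refine (bitProg_spec t₅ q₅ (by rwa [p₅]) a₅).mono (by rw [Nat.mul_add, Nat.mul_add]; omega)
    (fun s₆ h₆ hF₆ => ?_)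
  refine ⟨(hF₆.natVar 0 (by omega) rfl).trans n₅, (hF₆.natVar 3 (by omega) rfl).trans t₅,
    (hF₆.natVar 4 (by omega) rfl).trans q₅, ?_, ?_, ?_, ?_, h₆, ?_⟩
  · rwa [hF₆.natArr 12 rfl, b₅]
  · rwa [hF₆.natArr 13 rfl, c₅]
  · rw [hF₆.natArr 14 rfl, d₅]
    exact fun i hi => a₄ i (by omega)
  · rwa [hF₆.natArr 15 rfl]
  · rwa [hF₆.natArr 17 rfl, p₅]

end Tables

/-! ### The program that computes the initial tables -/

/-- Add the weight of a pair, or subtract it if `neg` holds, unless its colours agree. -/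
def weightStep (neg : Bool) : Prog :=
  .seq (asg 17 (.add (.var 16) (.lit 1)))
    (branch (.eq (.get 16 (.add (.get 15 (.get 10 (.var 17))) (.var 13)))
      (.get 16 (.add (.get 15 (.get 10 (.var 11))) (.var 13)))) skip
      (if neg then
        rasg 0 (.sub (.var 0) (.get 0 (.add (.get 12 (.get 7 (.var 17))) (.get 7 (.var 11)))))
      else
        rasg 0 (.add (.var 0) (.get 0 (.add (.get 12 (.get 7 (.var 17))) (.get 7 (.var 11)))))))

/-- Compute the local weight of the position in variable `11` for the mask in variable `13`. -/
def weightProg (neg : Bool) : Prog :=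
  .seq (rasg 0 .zero) (.seq (forUp 16 14 (weightStep neg))
    (rput 1 (.add (.get 14 (.var 11)) (.get 13 (.var 13))) (.var 0)))

/-- Compute the tables that belong to the single positions. -/
def initProg (neg : Bool) : Prog :=
  .seq (asg 20 (.add (.var 0) (.lit 1))) (forUp 11 20 (.seq (put 18 (.var 11) (.var 11))
    (.seq (put 19 (.var 11) (.lit 0)) (.seq (asg 14 (.sub (.var 11) (.lit 1)))
      (forUp 13 4 (weightProg neg))))))

/-- The sign of the weights. -/
def weightSign (neg : Bool) : ℝ := if neg then -1 else 1

/-- The weight, up to sign, of the pair of the positions `u` and `v`. -/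
noncomputable def positionWeight {n : ℕ} {G : SimpleGraph (Fin n)} (w : G.edgeSet → ℝ) (neg : Bool)
    (vertex : ℕ → ℕ) (u v : ℕ) : ℝ :=
  weightSign neg * weightArray w (vertex u * n + vertex v)

section Init

variable {n T : ℕ} {G : SimpleGraph (Fin n)} {w : G.edgeSet → ℝ} {neg : Bool} {s : State}
  {vertex slot : ℕ → ℕ}

/-- The memory contains the weights, the vertices in the positions and the slots. -/
structure RepWeights (w : G.edgeSet → ℝ) (T : ℕ) (vertex slot : ℕ → ℕ) (s : State) : Prop where
  weights : s.realArr 0 = weightArray w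
  vertex_eq : s.natArr 7 = vertex
  slot_eq : s.natArr 10 = slot
  vertex_lt : ∀ c, 1 ≤ c → c ≤ n → vertex c < n
  slot_lt : ∀ c, 1 ≤ c → c ≤ n → slot c < T

theorem RepWeights.of_frame {p : Prog} {s' : State} (h : RepWeights w T vertex slot s)
    (hF : Frame p s s') (ha : p.any (Op.writesA 7) = false ∧ p.any (Op.writesA 10) = false)
    (hb : p.any (Op.writesB 0) = false) : RepWeights w T vertex slot s' where
  weights := (hF.realArr 0 hb).trans h.weights
  vertex_eq := (hF.natArr 7 ha.1).trans h.vertex_eq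
  slot_eq := (hF.natArr 10 ha.2).trans h.slot_eq
  vertex_lt := h.vertex_lt
  slot_lt := h.slot_lt

theorem weightStep_spec (ht : RepTables n T s) (hw : RepWeights w T vertex slot s) {m u j : ℕ}
    (hm : m < 2 ^ T) (hj : 1 ≤ j) (hjn : j ≤ n) (hu : u + 1 < j) (h11 : s.natVar 11 = j)
    (h13 : s.natVar 13 = m) (h16 : s.natVar 16 = u) :
    Tri (weightStep neg) s 40 (fun s' => s'.realVar 0 = s.realVar 0 +
      if bit m (slot (u + 1)) = bit m (slot j) then 0
      else positionWeight w neg vertex (u + 1) j) := by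
  have h₁ := hw.slot_lt (u + 1) (by omega) (by omega)
  have h₂ := hw.slot_lt j hj hjn
  have h₃ := hw.vertex_lt (u + 1) (by omega) (by omega)
  have h₄ := hw.vertex_lt j hj hjn
  have key : (slot (u + 1) * 2 ^ T + m = slot j * 2 ^ T + m → slot (u + 1) = slot j) := by
    intro h
    exact Nat.eq_of_mul_eq_mul_right (by positivity) (Nat.add_right_cancel h)
  refine .seq_asg (.branch (B' := 11) (fun hb => .skip (by omega) ?_) (fun hb => ?_) le_rfl)
    (by simp [NatExpr.cost, BoolExpr.cost])
  · simp [h11, h13, h16, hw.slot_eq, ht.rowQ _ h₁, ht.rowQ _ h₂, ht.bits _ h₁ _ hm,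
      ht.bits _ h₂ _ hm] at hb
    simp [hb]
  · simp [h11, h13, h16, hw.slot_eq, ht.rowQ _ h₁, ht.rowQ _ h₂, ht.bits _ h₁ _ hm,
      ht.bits _ h₂ _ hm] at hb
    rw [if_neg hb]
    cases neg
    · refine .rasg ?_ (by simp [RealExpr.cost, NatExpr.cost])
      simp [positionWeight, weightSign, h11, h16, hw.vertex_eq, ht.rowN _ h₃, hw.weights]
    · refine .rasg ?_ (by simp [RealExpr.cost, NatExpr.cost])
      simp [positionWeight, weightSign, h11, h16, hw.vertex_eq, ht.rowN _ h₃, hw.weights,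
        sub_eq_add_neg]

/-- The sum runs over all earlier positions, including nonadjacent ones of weight 0. This costs O(n)
per mask, within the quadratic bound, and needs no adjacency lists. -/
theorem weightProg_spec (ht : RepTables n T s) (hw : RepWeights w T vertex slot s) {m j : ℕ}
    (hm : m < 2 ^ T) (hjn : j ≤ n) (h11 : s.natVar 11 = j) (h13 : s.natVar 13 = m)
    (h14 : s.natVar 14 = j - 1) :
    Tri (weightProg neg) s (n * 50 + 20) (fun s' => s'.realArr 1 =
      Function.update (s.realArr 1) (addr n T j m 0)
        (localWeight (positionWeight w neg vertex) (fun u => bit m (slot u)) j)) := by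
  refine .seq_rasg (.seq (Tri.forUp_const (B' := n * 50 + 5) (j - 1)
    (fun r s' => s'.realVar 0 = ∑ u ∈ Finset.Ico 1 (r + 1),
      if bit m (slot u) = bit m (slot j) then 0 else positionWeight w neg vertex u j)
    40 ?_ ?_ ?_ ?_ ?_ ?_) (B₂ := 10) (fun s₁ h₁ hF₁ => ?_) le_rfl) ?_
  · exact h14
  · simp
  · intro r hr s₁ hr₁ hI hF
    have e₁ := hF.natVar 11 (by omega) (by cases neg <;> rfl)
    have e₂ := hF.natVar 13 (by omega) (by cases neg <;> rfl)
    have t₁ : RepTables n T s₁ := RepTables.of_frame (s := s.setR 0 0)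
      ⟨ht.1, ht.2, ht.3, ht.4, ht.5, ht.6, ht.7, ht.8, ht.9⟩ hF
      (by cases neg <;> decide) (by cases neg <;> decide)
    have w₁ : RepWeights w T vertex slot s₁ := RepWeights.of_frame (s := s.setR 0 0)
      ⟨hw.1, hw.2, hw.3, hw.4, hw.5⟩ hF (by cases neg <;> decide) (by cases neg <;> decide)
    refine (weightStep_spec t₁ w₁ hm (by omega) hjn (by omega) (e₁.trans h11) (e₂.trans h13)
      hr₁).mono le_rfl (fun s₂ h₂ _ => ?_)
    rw [Finset.sum_Ico_succ_top (by omega), ← hI]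
    exact h₂
  · have : (j - 1) * 47 ≤ n * 50 := Nat.mul_le_mul (by omega) (by omega)
    omega
  · decide
  · cases neg <;> decide
  · have e₁ := hF₁.natVar 11 (by omega) (by cases neg <;> rfl)
    have e₂ := hF₁.natVar 13 (by omega) (by cases neg <;> rfl)
    have e₃ := hF₁.natArr 14 (by cases neg <;> rfl)
    have e₄ := hF₁.natArr 13 (by cases neg <;> rfl)
    have e₅ := hF₁.realArr 1 (by cases neg <;> rfl)
    refine .rput ?_ (by simp [NatExpr.cost, RealExpr.cost])
    have h₂ : s₁.realVar 0 =
        localWeight (positionWeight w neg vertex) (fun u => bit m (slot u)) j := by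
      rw [h₁, localWeight]
      -- For the virtual root the truncated `j - 1` is 0, and the sum is empty.
      rcases Nat.eq_zero_or_pos j with rfl | hj
      · rfl
      · rw [Nat.sub_add_cancel hj]
    simp [e₁, e₂, e₃, e₄, e₅, h11, h13, ht.rowM m hm, ht.base j (by omega), h₂, addr]
  · simp only [RealExpr.cost]
    omega

/-- The initial tables of the positions below `j` have been computed. -/
structure RepInit (n T : ℕ) (ω : ℕ → ℕ → ℝ) (slot : ℕ → ℕ) (j : ℕ) (s : State) : Prop where
  table : ∀ i < j, s.natArr 18 i = i
  count : ∀ i < j, s.natArr 19 i = 0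
  value : ∀ i < j, ∀ m < 2 ^ T,
    s.realArr 1 (addr n T i m 0) = localWeight ω (fun u => bit m (slot u)) i

theorem initProg_spec (ht : RepTables n T s) (hw : RepWeights w T vertex slot s) :
    Tri (initProg neg) s ((n + 1) * (2 ^ T * (n * 50 + 30) + 40) + 10)
      (RepInit n T (positionWeight w neg vertex) slot (n + 1)) := by
  refine .seq_asg (Tri.forUp_const (n + 1)
    (RepInit n T (positionWeight w neg vertex) slot) (2 ^ T * (n * 50 + 30) + 30) ?_ ?_ ?_ le_rfl
    ?_ ?_) ?_
  · simp [ht.vertices]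
  · exact ⟨by omega, by omega, by omega⟩
  · intro j hj s₁ hj₁ hI hF
    have t₁ : RepTables n T s₁ := RepTables.of_frame (s := s.setN 20 _)
      ⟨ht.1, ht.2, ht.3, ht.4, ht.5, ht.6, ht.7, ht.8, ht.9⟩ hF
      (by cases neg <;> decide) (by cases neg <;> decide)
    have w₁ : RepWeights w T vertex slot s₁ := RepWeights.of_frame (s := s.setN 20 _)
      ⟨hw.1, hw.2, hw.3, hw.4, hw.5⟩ hF (by cases neg <;> decide) (by cases neg <;> decide)
    refine .seq_put (.seq_put (.seq_asg (.mono (Tri.forUp_const (2 ^ T)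
      (fun r s' => ∀ i m, m < 2 ^ T → (i < j ∨ i = j ∧ m < r) →
        s'.realArr 1 (addr n T i m 0) =
          localWeight (positionWeight w neg vertex) (fun u => bit m (slot u)) i)
      (n * 50 + 20) ?_ ?_ ?_ le_rfl ?_ ?_) le_rfl ?_) le_rfl) le_rfl) ?_
    · simp [t₁.masks]
    · intro i m hm h
      exact hI.value i (by omega) m hm
    · intro r hr s₂ hr₂ hI₂ hF₂
      have e₁ := hF₂.natVar 11 (by omega) (by cases neg <;> rfl)
      have e₂ := hF₂.natVar 14 (by omega) (by cases neg <;> rfl)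
      simp [hj₁] at e₁ e₂
      have t₂ : RepTables n T s₂ := RepTables.of_frame
        (s := ((s₁.setA 18 (s₁.natVar 11) (s₁.natVar 11)).setA 19 (s₁.natVar 11) 0).setN 14
          (s₁.natVar 11 - 1))
        ⟨t₁.1, t₁.2, t₁.3, t₁.4, t₁.5, t₁.6, t₁.7, t₁.8, t₁.9⟩ hF₂
        (by cases neg <;> decide) (by cases neg <;> decide)
      have w₂ : RepWeights w T vertex slot s₂ := RepWeights.of_frame
        (s := ((s₁.setA 18 (s₁.natVar 11) (s₁.natVar 11)).setA 19 (s₁.natVar 11) 0).setN 14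
          (s₁.natVar 11 - 1))
        ⟨w₁.1, w₁.2, w₁.3, w₁.4, w₁.5⟩ hF₂
        (by cases neg <;> decide) (by cases neg <;> decide)
      refine (weightProg_spec t₂ w₂ hr (by omega) e₁ hr₂ e₂).mono le_rfl
        (fun s₃ h₃ _ i m hm him => ?_)
      simp only [State.setN_realArr, h₃, Function.update_apply]
      split_ifs with h
      · obtain ⟨rfl, rfl, -⟩ := addr_inj hm (Nat.zero_le n) hr (Nat.zero_le n) h
        rfl
      · refine hI₂ i m hm ?_
        rcases him with h' | ⟨rfl, h'⟩
        · exact .inl h'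
        · refine .inr ⟨rfl, ?_⟩
          by_contra hc
          exact h (by rw [show m = r by omega])
    · decide
    · cases neg <;> decide
    · intro s' h' hF'
      have e₁ := hF'.natArr 18 (by cases neg <;> rfl)
      have e₂ := hF'.natArr 19 (by cases neg <;> rfl)
      simp [hj₁] at e₁ e₂
      refine ⟨fun i hi => ?_, fun i hi => ?_, fun i hi m hm => h' i m hm (by omega)⟩
      · rw [State.setN_natArr, e₁, Function.update_apply]
        split_ifs with h
        · exact h.symm
        · exact hI.table i (by omega)
      · rw [State.setN_natArr, e₂, Function.update_apply]
        split_ifs with h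
        · rfl
        · exact hI.count i (by omega)
    · simp only [NatExpr.cost]
      have : 2 ^ T * (n * 50 + 20 + 7) ≤ 2 ^ T * (n * 50 + 30) :=
        Nat.mul_le_mul_left _ (by omega)
      omega
  · decide
  · cases neg <;> decide
  · simp only [NatExpr.cost]
    have : (n + 1) * (2 ^ T * (n * 50 + 30) + 30 + 7) ≤
        (n + 1) * (2 ^ T * (n * 50 + 30) + 40) := Nat.mul_le_mul_left _ (by omega)
    omega

end Init

/-! ### The program that merges the tables -/

/-- Change a bit of the mask in variable `13`. -/
def setBitProg : Prog :=
  branch (.eq (.get 16 (.add (.var 26) (.var 13))) (.var 21)) (asg 22 (.var 13))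
    (branch (.eq (.var 21) (.lit 0)) (asg 22 (.sub (.var 13) (.var 25)))
      (asg 22 (.add (.var 13) (.var 25))))

/-- Record a candidate for an entry of the new row. -/
def recordProg : Prog :=
  .seq (rput 1 (.var 30) (.var 0))
    (.seq (put 20 (.var 30) (.add (.var 21) (.lit 1))) (put 21 (.var 30) (.var 24)))

/-- Compare a candidate with the entry of the new row. -/
def candidateProg : Prog :=
  .seq (asg 30 (.add (.var 29) (.add (.add (.var 21) (.var 23)) (.var 24))))
    (.seq (rasg 0 (.add (.get 1 (.add (.var 27) (.var 23))) (.get 1 (.add (.var 28) (.var 24)))))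
      (branch (.eq (.get 20 (.var 30)) (.lit 0)) recordProg
        (branch (.realLt (.get 1 (.var 30)) (.var 0)) recordProg skip)))

/-- Mark the entries of the new row as undefined. -/
def resetProg : Prog := forUp 23 34 (put 20 (.add (.var 29) (.var 23)) (.lit 0))

/-- Compute the candidates for one colour of the position that is merged. -/
def colourProg : Prog :=
  .seq setBitProg (.seq (asg 28 (.add (.var 33) (.get 13 (.var 22))))
    (forUp 23 35 (forUp 24 36 candidateProg)))

/-- Compute the new row for the mask in variable `13`. -/
def rowProg : Prog :=
  .seq (asg 29 (.add (.var 31) (.get 13 (.var 13))))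
    (.seq (asg 27 (.add (.var 32) (.get 13 (.var 13))))
      (.seq resetProg (forUp 21 40 colourProg)))

/-- Fetch what is needed to merge the position in variable `11` with its parent. -/
def fetchProg : Prog :=
  .seq (asg 12 (.get 11 (.var 11))) (.seq (asg 31 (.get 14 (.add (.var 0) (.var 11))))
    (.seq (asg 32 (.get 14 (.get 18 (.var 12)))) (.seq (asg 33 (.get 14 (.get 18 (.var 11))))
      (.seq (asg 35 (.add (.get 19 (.var 12)) (.lit 1)))
        (.seq (asg 36 (.add (.get 19 (.var 11)) (.lit 1))) (.seq (asg 34 (.add (.var 35) (.var 36)))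
          (.seq (asg 25 (.get 17 (.get 10 (.var 11)))) (asg 26 (.get 15 (.get 10 (.var 11)))))))))))

/-- Merge the position in variable `11` with its parent. -/
def mergeStep : Prog :=
  .seq fetchProg (.seq (forUp 13 4 rowProg) (.seq (put 18 (.var 12) (.add (.var 0) (.var 11)))
    (put 19 (.var 12) (.add (.get 19 (.var 12)) (.var 36)))))

/-- Merge all positions with their parents, the last position first. -/
def mergeProg : Prog :=
  .seq (asg 40 (.lit 2)) (forUp 10 0 (.seq (asg 11 (.sub (.var 0) (.var 10))) mergeStep))

/-- Improve an entry of a merged row by a further candidate. -/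
theorem MergedRow.insert {f : ℕ → ℝ} {g : ℕ → ℕ → ℝ} {p q : ℕ} {h h' : ℕ → ℝ} {B B' M M' : ℕ → ℕ}
    {Z : ℕ → ℕ → ℕ → Prop} (H : MergedRow f g p q h B M Z) {b k₁ k₂ : ℕ} (hb : b < 2) (h₁ : k₁ ≤ p)
    (h₂ : k₂ ≤ q) (hlt : B (b + k₁ + k₂) ≠ 0 → h (b + k₁ + k₂) ≤ f k₁ + g b k₂)
    (hh : ∀ k, h' k = if k = b + k₁ + k₂ then f k₁ + g b k₂ else h k)
    (hB : ∀ k, B' k = if k = b + k₁ + k₂ then b + 1 else B k)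
    (hM : ∀ k, M' k = if k = b + k₁ + k₂ then k₂ else M k) :
    MergedRow f g p q h' B' M'
      (fun b' k₁' k₂' => Z b' k₁' k₂' ∨ b' = b ∧ k₁' = k₁ ∧ k₂' = k₂) where
  upper b' k₁' k₂' hz := by
    rw [hh, hB]
    rcases hz with hz | ⟨rfl, rfl, rfl⟩
    · have h₃ := H.upper b' k₁' k₂' hz
      split_ifs with he
      · rw [he] at h₃
        exact ⟨h₃.1.trans (hlt h₃.2), by omega⟩
      · exact h₃
    · simp
  attained k hk hBk := by
    rw [hB] at hBk
    rw [hB, hM, hh]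
    split_ifs with he
    · exact ⟨b, k₁, k₂, hb, h₁, h₂, he, rfl, rfl, rfl⟩
    · rw [if_neg he] at hBk
      exact H.attained k hk hBk

section Merge

variable {n T : ℕ} {s : State}

theorem setBitProg_spec (ht : RepTables n T s) {m i b : ℕ} (hm : m < 2 ^ T) (hi : i < T)
    (h13 : s.natVar 13 = m) (h21 : s.natVar 21 = b) (h25 : s.natVar 25 = 2 ^ i)
    (h26 : s.natVar 26 = i * 2 ^ T) :
    Tri setBitProg s 30 (fun s' => s'.natVar 22 = setBit m i b) := by
  have hbit := ht.bits i hi m hm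
  refine .branch (B' := 15) (fun hb => .asg ?_ (by simp [NatExpr.cost])) (fun hb => .branch
    (B' := 5) (fun hb' => .asg ?_ (by simp [NatExpr.cost])) (fun hb' => .asg ?_
    (by simp [NatExpr.cost])) (by simp [NatExpr.cost, BoolExpr.cost]))
    (by simp [NatExpr.cost, BoolExpr.cost])
  · simp [h13, h21, h26, hbit] at hb
    simp [h13, setBit, hb]
  · simp [h13, h21, h26, hbit] at hb hb'
    subst hb'
    simp [h13, h25, setBit, hb]
  · simp [h13, h21, h26, hbit] at hb hb'
    simp [h13, h25, setBit, hb, hb']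

/-- The row with address `a` is the maximum of the sums of the entries of the rows with addresses
`l` and `r b`, as far as the triples in `Z` are concerned. The rest of the memory is given by
`R₀`, `B₀` and `M₀`. -/
structure RowState (R₀ : ℕ → ℝ) (B₀ M₀ : ℕ → ℕ) (a l : ℕ) (r : ℕ → ℕ) (p q : ℕ)
    (Z : ℕ → ℕ → ℕ → Prop) (s : State) : Prop where
  outside : ∀ x, (∀ k ≤ p + q + 1, x ≠ a + k) →
    s.realArr 1 x = R₀ x ∧ s.natArr 20 x = B₀ x ∧ s.natArr 21 x = M₀ x
  row : MergedRow (fun k => R₀ (l + k)) (fun b k => R₀ (r b + k)) p q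
    (fun k => s.realArr 1 (a + k)) (fun k => s.natArr 20 (a + k)) (fun k => s.natArr 21 (a + k)) Z

variable {R₀ : ℕ → ℝ} {B₀ M₀ : ℕ → ℕ} {a l : ℕ} {r : ℕ → ℕ} {p q : ℕ} {Z Z' : ℕ → ℕ → ℕ → Prop}

theorem RowState.mono {s' : State} (h : RowState R₀ B₀ M₀ a l r p q Z s)
    (hZ : ∀ b k₁ k₂, Z' b k₁ k₂ → Z b k₁ k₂ ∧ b < 2 ∧ k₁ ≤ p ∧ k₂ ≤ q)
    (h₁ : s'.realArr 1 = s.realArr 1) (h₂ : s'.natArr 20 = s.natArr 20)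
    (h₃ : s'.natArr 21 = s.natArr 21) : RowState R₀ B₀ M₀ a l r p q Z' s' where
  outside x hx := by
    rw [h₁, h₂, h₃]
    exact h.outside x hx
  row := h.row.congr hZ (fun _ _ => rfl) (fun _ _ _ _ => rfl) (fun k _ => by rw [h₁, h₂, h₃]; simp)

/-- By `hl` and `hr` the source rows lie outside the target row, so the values read are those of
`R₀` although the target row is already partly written. -/
theorem candidateProg_spec (h : RowState R₀ B₀ M₀ a l r p q Z s) {b k₁ k₂ : ℕ} (hb : b < 2)
    (h₁ : k₁ ≤ p) (h₂ : k₂ ≤ q) (h21 : s.natVar 21 = b) (h23 : s.natVar 23 = k₁)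
    (h24 : s.natVar 24 = k₂) (h27 : s.natVar 27 = l) (h28 : s.natVar 28 = r b)
    (h29 : s.natVar 29 = a) (hl : ∀ k ≤ p, ∀ k' ≤ p + q + 1, l + k ≠ a + k')
    (hr : ∀ k ≤ q, ∀ k' ≤ p + q + 1, r b + k ≠ a + k') :
    Tri candidateProg s 60 (RowState R₀ B₀ M₀ a l r p q
      (fun b' k₁' k₂' => Z b' k₁' k₂' ∨ b' = b ∧ k₁' = k₁ ∧ k₂' = k₂)) := by
  have e₁ := (h.outside (l + k₁) (hl k₁ h₁)).1
  have e₂ := (h.outside (r b + k₂) (hr k₂ h₂)).1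
  set c := R₀ (l + k₁) + R₀ (r b + k₂) with hc
  set y := a + (b + k₁ + k₂) with hy
  have key : (s.natArr 20 y ≠ 0 → s.realArr 1 y ≤ c) → ∀ s' : State,
      s'.realArr 1 = Function.update (s.realArr 1) y c →
      s'.natArr 20 = Function.update (s.natArr 20) y (b + 1) →
      s'.natArr 21 = Function.update (s.natArr 21) y k₂ →
      RowState R₀ B₀ M₀ a l r p q
        (fun b' k₁' k₂' => Z b' k₁' k₂' ∨ b' = b ∧ k₁' = k₁ ∧ k₂' = k₂) s' := by
    intro hle s' d₁ d₂ d₃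
    refine ⟨fun x hx => ?_, h.row.insert hb h₁ h₂ hle (fun k => ?_) (fun k => ?_) (fun k => ?_)⟩
    · have hne : x ≠ y := hx (b + k₁ + k₂) (by omega)
      rw [d₁, d₂, d₃, Function.update_of_ne hne, Function.update_of_ne hne,
        Function.update_of_ne hne]
      exact h.outside x hx
    · simp [d₁, Function.update_apply, hy, hc]
    · simp [d₂, Function.update_apply, hy]
    · simp [d₃, Function.update_apply, hy]
  refine .seq_asg (B' := 50) (.seq_rasg (B' := 40) (.branch (B' := 30) (fun hz =>
    .seq_rput (.seq_put (.put (key ?_ _ ?_ ?_ ?_) le_rfl) le_rfl)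
      (by simp [NatExpr.cost, RealExpr.cost])) (fun hz => .branch (B' := 20) (fun hlt =>
    .seq_rput (.seq_put (.put (key ?_ _ ?_ ?_ ?_) le_rfl) le_rfl)
      (by simp [NatExpr.cost, RealExpr.cost])) (fun hlt => .skip (by omega) ?_)
    (by simp [NatExpr.cost, RealExpr.cost, BoolExpr.cost]))
    (by simp [NatExpr.cost, BoolExpr.cost]))
    (by simp [NatExpr.cost, RealExpr.cost])) (by simp [NatExpr.cost])
  · simp [h21, h23, h24, h29, ← hy] at hz
    simp [hz]
  · simp [h21, h23, h24, h27, h28, h29, e₁, e₂, ← hy, ← hc]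
  · simp [h21, h23, h24, h29, ← hy]
  · simp [h21, h23, h24, h29, ← hy]
  · simp [h21, h23, h24, h27, h28, h29, e₁, e₂, ← hy, ← hc] at hlt
    exact fun _ => hlt.le
  · simp [h21, h23, h24, h27, h28, h29, e₁, e₂, ← hy, ← hc]
  · simp [h21, h23, h24, h29, ← hy]
  · simp [h21, h23, h24, h29, ← hy]
  · simp [h21, h23, h24, h29, ← hy] at hz
    simp [h21, h23, h24, h27, h28, h29, e₁, e₂, ← hy, ← hc] at hlt
    refine ⟨h.outside, fun b' k₁' k₂' hZ => ?_, h.row.attained⟩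
    rcases hZ with hZ | ⟨rfl, rfl, rfl⟩
    · exact h.row.upper b' k₁' k₂' hZ
    · exact ⟨hlt, hz⟩

/-- No real constant can play the part of −∞, so 0 in array `20` marks an undefined entry; this is
why a colour `b` is recorded as `b + 1`. -/
theorem resetProg_spec (h34 : s.natVar 34 = p + q + 2) (h29 : s.natVar 29 = a) :
    Tri resetProg s ((p + q + 2) * 13 + 5)
      (RowState (s.realArr 1) (s.natArr 20) (s.natArr 21) a l r p q (fun _ _ _ => False)) := by
  refine Tri.mono (Tri.forUp_const (p + q + 2) (fun j s' => (∀ k < j, s'.natArr 20 (a + k) = 0) ∧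
    ∀ x, (∀ k ≤ p + q + 1, x ≠ a + k) → s'.natArr 20 x = s.natArr 20 x) 6 h34 ?_ ?_ le_rfl)
    le_rfl ?_
  · simp
  · rintro j hj s₁ hj₁ ⟨h₁, h₂⟩ hF
    have e₁ := (hF.natVar 29 (by omega) rfl).trans h29
    refine .put ⟨fun k hk => ?_, fun x hx => ?_⟩ (by simp [NatExpr.cost])
    · simp only [NatExpr.eval, hj₁, e₁, State.setN_natArr, State.setA_natArr, if_true,
        Function.update_apply]
      split_ifs with h
      · rfl
      · exact h₁ k (by omega)
    · have := hx j (by omega)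
      simp only [NatExpr.eval, hj₁, e₁, State.setN_natArr, State.setA_natArr, if_true,
        Function.update_apply, if_neg this]
      exact h₂ x hx
  · rintro s' ⟨h₁, h₂⟩ hF
    refine ⟨fun x hx => ⟨by rw [hF.realArr 1 rfl], h₂ x hx, by rw [hF.natArr 21 rfl]⟩,
      fun b k₁ k₂ hz => hz.elim, fun k hk hB => absurd (h₁ k (by omega)) hB⟩

/-- The triples that have been considered before `(b, k₁, k₂)`. -/
def before (p q b k₁ k₂ b' k₁' k₂' : ℕ) : Prop :=
  b' < 2 ∧ k₁' ≤ p ∧ k₂' ≤ q ∧ (b' < b ∨ b' = b ∧ (k₁' < k₁ ∨ k₁' = k₁ ∧ k₂' < k₂))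

theorem colourProg_spec (ht : RepTables n T s) {m i b : ℕ} (hm : m < 2 ^ T) (hi : i < T)
    (hb : b < 2) (h : RowState R₀ B₀ M₀ a l r p q (before p q b 0 0) s) (h13 : s.natVar 13 = m)
    (h21 : s.natVar 21 = b) (h25 : s.natVar 25 = 2 ^ i) (h26 : s.natVar 26 = i * 2 ^ T)
    (h27 : s.natVar 27 = l) (h29 : s.natVar 29 = a) (h35 : s.natVar 35 = p + 1)
    (h36 : s.natVar 36 = q + 1) (h33 : s.natVar 33 + setBit m i b * (n + 1) = r b)
    (hl : ∀ k ≤ p, ∀ k' ≤ p + q + 1, l + k ≠ a + k')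
    (hr : ∀ k ≤ q, ∀ k' ≤ p + q + 1, r b + k ≠ a + k') :
    Tri colourProg s ((p + 1) * ((q + 1) * 67 + 12) + 50)
      (RowState R₀ B₀ M₀ a l r p q (before p q (b + 1) 0 0)) := by
  refine .seq (setBitProg_spec ht hm hi h13 h21 h25 h26)
    (B₂ := (p + 1) * ((q + 1) * 67 + 12) + 20) (fun s₁ h₁ hF₁ => ?_) (by omega)
  have a₁ := hF₁.natArr 13 rfl
  have v35 := (hF₁.natVar 35 (by omega) rfl).trans h35
  have v36 := (hF₁.natVar 36 (by omega) rfl).trans h36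
  have v33 := hF₁.natVar 33 (by omega) rfl
  have v21 := (hF₁.natVar 21 (by omega) rfl).trans h21
  have v27 := (hF₁.natVar 27 (by omega) rfl).trans h27
  have v29 := (hF₁.natVar 29 (by omega) rfl).trans h29
  refine .seq_asg (Tri.mono (Tri.forUp_const (p + 1)
    (fun j s' => RowState R₀ B₀ M₀ a l r p q (before p q b j 0) s') ((q + 1) * 67 + 5)
    ?_ ?_ ?_ le_rfl) le_rfl ?_) (B' := (p + 1) * ((q + 1) * 67 + 12) + 5)
    (by simp only [NatExpr.cost]; omega)
  · simpa using v35
  · exact h.mono (fun b' k₁ k₂ hz => ⟨hz, hz.1, hz.2.1, hz.2.2.1⟩) (hF₁.realArr 1 rfl)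
      (hF₁.natArr 20 rfl) (hF₁.natArr 21 rfl)
  · intro k₁ hk₁ s₂ hk₂ hI hF₂
    have w36 := hF₂.natVar 36 (by omega) rfl
    have w28 := hF₂.natVar 28 (by omega) rfl
    have w21 := hF₂.natVar 21 (by omega) rfl
    have w27 := hF₂.natVar 27 (by omega) rfl
    have w29 := hF₂.natVar 29 (by omega) rfl
    simp [v36, v33, v21, v27, v29, h₁, a₁, ht.rowM _ (setBit_lt hm hi hb), h33]
      at w36 w28 w21 w27 w29
    refine Tri.mono (Tri.forUp_const (q + 1)
      (fun j s' => RowState R₀ B₀ M₀ a l r p q (before p q b k₁ j) s') 60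
      w36 ?_ ?_ le_rfl) le_rfl ?_
    · exact hI.mono (fun b' k₁ k₂ hz => ⟨hz, hz.1, hz.2.1, hz.2.2.1⟩) rfl rfl rfl
    · intro k₂ hk₂' s₃ hk₃ hI₃ hF₃
      have x28 := (hF₃.natVar 28 (by omega) rfl).trans w28
      have x21 := (hF₃.natVar 21 (by omega) rfl).trans w21
      have x27 := (hF₃.natVar 27 (by omega) rfl).trans w27
      have x29 := (hF₃.natVar 29 (by omega) rfl).trans w29
      have x23 := (hF₃.natVar 23 (by omega) rfl).trans hk₂
      refine (candidateProg_spec hI₃ hb (by omega) (by omega) x21 x23 hk₃ x27 x28 x29 hl hr).mono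
        le_rfl (fun s₄ h₄ _ => h₄.mono (fun b' k₁' k₂' hz => ⟨?_, hz.1, hz.2.1, hz.2.2.1⟩)
        rfl rfl rfl)
      obtain ⟨z₁, z₂, z₃, z₄⟩ := hz
      simp only [before]
      omega
    · intro s₃ h₃ _
      refine h₃.mono (fun b' k₁' k₂' hz => ⟨?_, hz.1, hz.2.1, hz.2.2.1⟩) rfl rfl rfl
      obtain ⟨z₁, z₂, z₃, z₄⟩ := hz
      simp only [before]
      omega
  · intro s₃ h₃ _
    refine h₃.mono (fun b' k₁' k₂' hz => ⟨?_, hz.1, hz.2.1, hz.2.2.1⟩) rfl rfl rfl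
    obtain ⟨z₁, z₂, z₃, z₄⟩ := hz
    simp only [before]
    omega

theorem rowProg_spec (ht : RepTables n T s) {m i c₁ c₂ c₃ : ℕ} (hm : m < 2 ^ T) (hi : i < T)
    (h13 : s.natVar 13 = m) (h25 : s.natVar 25 = 2 ^ i) (h26 : s.natVar 26 = i * 2 ^ T)
    (h31 : s.natVar 31 = c₁ * (2 ^ T * (n + 1))) (h32 : s.natVar 32 = c₂ * (2 ^ T * (n + 1)))
    (h33 : s.natVar 33 = c₃ * (2 ^ T * (n + 1))) (h34 : s.natVar 34 = p + q + 2)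
    (h35 : s.natVar 35 = p + 1) (h36 : s.natVar 36 = q + 1) (h40 : s.natVar 40 = 2)
    (hpq : p + q + 1 ≤ n) (hc₂ : c₂ ≠ c₁) (hc₃ : c₃ ≠ c₁) :
    Tri rowProg s ((p + 1) * (q + 1) * 300 + 200)
      (RowState (s.realArr 1) (s.natArr 20) (s.natArr 21) (addr n T c₁ m 0) (addr n T c₂ m 0)
        (fun b => addr n T c₃ (setBit m i b) 0) p q
        (fun b k₁ k₂ => b < 2 ∧ k₁ ≤ p ∧ k₂ ≤ q)) := by
  have haddr : ∀ c m k, addr n T c m 0 + k = addr n T c m k := fun _ _ _ => rfl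
  -- The overheads linear in `p` and `q` are absorbed by the number of pairs, so the merge cost is a
  -- multiple of the product of the group sizes.
  have hX : p + q + 2 ≤ 2 * ((p + 1) * (q + 1)) := by nlinarith
  have hX' : p + 1 ≤ (p + 1) * (q + 1) := Nat.le_mul_of_pos_right _ (by omega)
  refine .seq_asg (B' := (p + 1) * (q + 1) * 300 + 190) (.seq_asg
    (B' := (p + 1) * (q + 1) * 300 + 180) (.seq (resetProg_spec (p := p) (q := q)
    (a := addr n T c₁ m 0) (l := addr n T c₂ m 0)
    (r := fun b => addr n T c₃ (setBit m i b) 0) (by simpa using h34) ?_)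
    (B₂ := (p + 1) * (q + 1) * 270 + 170)
    (fun s₁ h₁ hF₁ => ?_) (by omega)) (by simp only [NatExpr.cost]; omega))
    (by simp only [NatExpr.cost]; omega)
  · simp [h13, h31, ht.rowM m hm, addr]
  have v13 := hF₁.natVar 13 (by omega) rfl
  have v25 := hF₁.natVar 25 (by omega) rfl
  have v26 := hF₁.natVar 26 (by omega) rfl
  have v27 := hF₁.natVar 27 (by omega) rfl
  have v29 := hF₁.natVar 29 (by omega) rfl
  have v33 := hF₁.natVar 33 (by omega) rfl
  have v35 := hF₁.natVar 35 (by omega) rfl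
  have v36 := hF₁.natVar 36 (by omega) rfl
  have v40 := hF₁.natVar 40 (by omega) rfl
  simp [h13, h25, h26, h31, h32, h33, h35, h36, h40, ht.rowM m hm]
    at v13 v25 v26 v27 v29 v33 v35 v36 v40
  have t₁ : RepTables n T s₁ := RepTables.of_frame (s := (s.setN 29 _).setN 27 _)
      ⟨ht.1, ht.2, ht.3, ht.4, ht.5, ht.6, ht.7, ht.8, ht.9⟩ hF₁
  refine Tri.mono (Tri.forUp_const 2
    (fun b s' => RowState (s.realArr 1) (s.natArr 20) (s.natArr 21) (addr n T c₁ m 0)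
      (addr n T c₂ m 0) (fun b => addr n T c₃ (setBit m i b) 0) p q (before p q b 0 0) s')
    ((p + 1) * ((q + 1) * 67 + 12) + 50) v40 ?_ ?_ le_rfl) ?_ ?_
  · refine h₁.mono (fun b' k₁ k₂ hz => ?_) rfl rfl rfl
    obtain ⟨z₁, z₂, z₃, z₄⟩ := hz
    omega
  · intro b hb s₂ hb₂ hI hF₂
    refine (colourProg_spec (t₁.of_frame hF₂) hm hi hb hI
      ((hF₂.natVar 13 (by omega) rfl).trans v13) hb₂ ((hF₂.natVar 25 (by omega) rfl).trans v25)
      ((hF₂.natVar 26 (by omega) rfl).trans v26) ?_ ?_ ((hF₂.natVar 35 (by omega) rfl).trans v35)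
      ((hF₂.natVar 36 (by omega) rfl).trans v36) ?_ ?_ ?_).mono le_rfl (fun s₃ h₃ _ => ?_)
    · rw [hF₂.natVar 27 (by omega) rfl, v27]; rfl
    · rw [hF₂.natVar 29 (by omega) rfl, v29]; rfl
    · rw [hF₂.natVar 33 (by omega) rfl, v33]; rfl
    · intro k hk k' hk' h
      rw [haddr, haddr] at h
      exact hc₂ (addr_inj hm (by omega) hm (by omega) h).1
    · intro k hk k' hk' h
      rw [haddr, haddr] at h
      exact hc₃ (addr_inj (setBit_lt hm hi hb) (by omega) hm (by omega) h).1
    · exact h₃.mono (fun b' k₁ k₂ hz => ⟨hz, hz.1, hz.2.1, hz.2.2.1⟩) rfl rfl rfl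
  · have : (p + 1) * ((q + 1) * 67 + 12) = (p + 1) * (q + 1) * 67 + (p + 1) * 12 := by ring
    omega
  · intro s₃ h₃ _
    refine h₃.mono (fun b' k₁ k₂ hz => ⟨⟨hz.1, hz.2.1, hz.2.2, .inl hz.1⟩, hz⟩) rfl rfl rfl

end Merge

/-! ### Whole tables and the sequence of all merges -/

section MergeAll

variable {n T : ℕ} {s : State}

/-- The first `j` rows of the table `c₁` have been computed from the tables `c₂` and `c₃`. The rest
of the memory is given by `R₀`, `B₀` and `M₀`. -/
structure TableState (n T : ℕ) (R₀ : ℕ → ℝ) (B₀ M₀ : ℕ → ℕ) (c₁ c₂ c₃ i p q j : ℕ) (s : State) :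
    Prop where
  outside : ∀ x, (∀ m < j, ∀ k ≤ n, x ≠ addr n T c₁ m k) →
    s.realArr 1 x = R₀ x ∧ s.natArr 20 x = B₀ x ∧ s.natArr 21 x = M₀ x
  row : ∀ m < j, MergedRow (fun k => R₀ (addr n T c₂ m k))
    (fun b k => R₀ (addr n T c₃ (setBit m i b) k)) p q (fun k => s.realArr 1 (addr n T c₁ m k))
    (fun k => s.natArr 20 (addr n T c₁ m k)) (fun k => s.natArr 21 (addr n T c₁ m k))
    (fun b k₁ k₂ => b < 2 ∧ k₁ ≤ p ∧ k₂ ≤ q)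

theorem TableState.succ {R₀ : ℕ → ℝ} {B₀ M₀ : ℕ → ℕ} {c₁ c₂ c₃ i p q j : ℕ} {s' : State}
    (h : TableState n T R₀ B₀ M₀ c₁ c₂ c₃ i p q j s) (hj : j < 2 ^ T) (hi : i < T)
    (hpq : p + q + 1 ≤ n) (hc₂ : c₂ ≠ c₁) (hc₃ : c₃ ≠ c₁)
    (hr : RowState (s.realArr 1) (s.natArr 20) (s.natArr 21) (addr n T c₁ j 0) (addr n T c₂ j 0)
        (fun b => addr n T c₃ (setBit j i b) 0) p q
        (fun b k₁ k₂ => b < 2 ∧ k₁ ≤ p ∧ k₂ ≤ q) s') :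
    TableState n T R₀ B₀ M₀ c₁ c₂ c₃ i p q (j + 1) s' where
  outside x hx := by
    obtain ⟨h₁, h₂, h₃⟩ := hr.outside x (fun k hk => hx j (by omega) k (by omega))
    rw [h₁, h₂, h₃]
    exact h.outside x (fun m hm k hk => hx m (by omega) k hk)
  row m hm := by
    rcases Nat.lt_succ_iff_lt_or_eq.1 hm with hm | rfl
    · refine (h.row m hm).congr (fun b k₁ k₂ hz => ⟨hz, hz⟩) (fun _ _ => rfl)
        (fun _ _ _ _ => rfl) (fun k hk => hr.outside _ (fun k' hk' he => ?_))
      have := (addr_inj (m' := j) (k' := k') (by omega) (by omega) hj (by omega) he).2.1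
      omega
    · refine hr.row.congr (fun b k₁ k₂ hz => ⟨hz, hz⟩) (fun k hk => ?_) (fun b hb k hk => ?_)
        (fun k hk => ⟨rfl, rfl, rfl⟩)
      · refine (h.outside _ (fun m' hm' k' hk' he => hc₂ ?_)).1.symm
        exact (addr_inj (k := k) hj (by omega) (by omega) hk' he).1
      · refine (h.outside _ (fun m' hm' k' hk' he => hc₃ ?_)).1.symm
        exact (addr_inj (k := k) (setBit_lt hj hi hb) (by omega) (by omega) hk' he).1

/-- The last `a` positions have been merged with their parents. -/
structure RepMerge (n T : ℕ) (ω : ℕ → ℕ → ℝ) (par slot : ℕ → ℕ) (a : ℕ) (s : State) : Prop where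
  table : ∀ j ≤ n - a, s.natArr 18 j = stageTable n par a j
  count : ∀ j ≤ n - a, s.natArr 19 j = stageCount n par a j
  value : ∀ j ≤ n, ∀ m < 2 ^ T,
    s.realArr 1 (addr n T j m 0) = localWeight ω (fun u => bit m (slot u)) j
  merged : ∀ v, n - a < v → v ≤ n → IsMerged n T par slot (fun j m k => s.realArr 1 (addr n T j m k))
    (fun j m k => s.natArr 20 (addr n T j m k)) (fun j m k => s.natArr 21 (addr n T j m k)) v

variable {ω : ℕ → ℕ → ℝ} {P : ℕ → Finset ℕ} {par slot : ℕ → ℕ} {a v : ℕ}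

/-- Each merge writes a fresh table, distinct from the sources and results of all earlier merges.
Their relations therefore persist, and every table remains available for the reconstruction. -/
theorem RepMerge.succ {s' : State} (E : Elimination n T P par slot)
    (h : RepMerge n T ω par slot a s) (ha : a + v = n) (hv : 1 ≤ v)
    (hT : ∀ j, s'.natArr 18 j = if j = par v then n + v else s.natArr 18 j)
    (hC : ∀ j, s'.natArr 19 j = if j = par v then s.natArr 19 j + (stageCount n par a v + 1) else
      s.natArr 19 j)
    (hS : TableState n T (s.realArr 1) (s.natArr 20) (s.natArr 21) (n + v)
      (stageTable n par a (par v)) (stageTable n par a v) (slot v) (stageCount n par a (par v))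
      (stageCount n par a v) (2 ^ T) s') : RepMerge n T ω par slot (a + 1) s' := by
  have out : ∀ j ≠ n + v, ∀ m < 2 ^ T, ∀ k ≤ n,
      s'.realArr 1 (addr n T j m k) = s.realArr 1 (addr n T j m k) ∧
      s'.natArr 20 (addr n T j m k) = s.natArr 20 (addr n T j m k) ∧
      s'.natArr 21 (addr n T j m k) = s.natArr 21 (addr n T j m k) := fun j hj m hm k hk =>
    hS.outside _ (fun m' hm' k' hk' he => hj (addr_inj hm hk hm' hk' he).1)
  refine ⟨fun j hj => ?_, fun j hj => ?_, fun j hj m hm => ?_, fun u hu hun => ?_⟩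
  · rw [hT, stageTable_succ ha, h.table j (by omega)]
  · rw [hC, stageCount_succ ha, h.count j (by omega)]
    split_ifs <;> omega
  · rw [(out j (by omega) m hm 0 (by omega)).1, h.value j hj m hm]
  · rcases Nat.lt_or_ge (n - a) u with hlt | hge
    · intro m hm
      have hpu := E.par_lt u (by omega) hun
      have hcu := stageCount_add_le E (a := n - u) (v := u) (by omega) (by omega)
      have o₁ := stageTable_or (n := n) (par := par) (n - u) (par u) (by omega)
      have o₂ := stageTable_or (n := n) (par := par) (n - u) u (by omega)
      refine (h.merged u hlt hun m hm).congr (fun b k₁ k₂ hz => ⟨hz, hz⟩) (fun k hk => ?_)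
        (fun b hb k hk => ?_) (fun k hk => out _ (by omega) m hm k (by omega))
      · exact (out _ (by omega) m hm k (by omega)).1
      · exact (out _ (by omega) _ (setBit_lt hm (E.slot_lt u (by omega) hun) hb) k (by omega)).1
    · obtain rfl : u = v := by omega
      intro m hm
      have hpu := E.par_lt u (by omega) hun
      have hcu := stageCount_add_le E ha hv
      have o₁ := stageTable_or (n := n) (par := par) a (par u) (by omega)
      have o₂ := stageTable_or (n := n) (par := par) a u (by omega)
      rw [show n - u = a by omega]
      refine (hS.row m hm).congr (fun b k₁ k₂ hz => ⟨hz, hz⟩) (fun k hk => ?_)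
        (fun b hb k hk => ?_) (fun k hk => ⟨rfl, rfl, rfl⟩)
      · exact (out _ (by omega) m hm k (by omega)).1
      · exact (out _ (by omega) _ (setBit_lt hm (E.slot_lt u (by omega) hun) hb) k (by omega)).1

theorem mergeStep_spec (ht : RepTables n T s) (E : Elimination n T P par slot)
    (hp : s.natArr 11 = par) (hs : s.natArr 10 = slot) (h40 : s.natVar 40 = 2)
    (h : RepMerge n T ω par slot a s) (ha : a + v = n) (hv : 1 ≤ v) (h11 : s.natVar 11 = v) :
    Tri mergeStep s (2 ^ T * ((stageCount n par a (par v) + 1) * (stageCount n par a v + 1) * 300 +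
      210) + 150) (RepMerge n T ω par slot (a + 1)) := by
  have hpv := E.par_lt v hv (by omega)
  have hsl := E.slot_lt v hv (by omega)
  have hpq := stageCount_add_le E ha hv
  have o₁ := stageTable_or (n := n) (par := par) a (par v) (by omega)
  have o₂ := stageTable_or (n := n) (par := par) a v (by omega)
  have hX : 2 ^ T * ((stageCount n par a (par v) + 1) * (stageCount n par a v + 1) * 300 + 200 + 7) ≤
    2 ^ T * ((stageCount n par a (par v) + 1) * (stageCount n par a v + 1) * 300 + 210) :=
    Nat.mul_le_mul_left _ (by omega)
  refine .seq (B₁ := 80) (R := fun s' => s'.natVar 12 = par v ∧ s'.natVar 11 = v ∧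
    s'.natVar 31 = (n + v) * (2 ^ T * (n + 1)) ∧
    s'.natVar 32 = stageTable n par a (par v) * (2 ^ T * (n + 1)) ∧
    s'.natVar 33 = stageTable n par a v * (2 ^ T * (n + 1)) ∧
    s'.natVar 34 = stageCount n par a (par v) + stageCount n par a v + 2 ∧
    s'.natVar 35 = stageCount n par a (par v) + 1 ∧ s'.natVar 36 = stageCount n par a v + 1 ∧
    s'.natVar 25 = 2 ^ slot v ∧ s'.natVar 26 = slot v * 2 ^ T) ?_ (fun s₁ h₁ hF₁ => ?_)
    (B₂ := 2 ^ T * ((stageCount n par a (par v) + 1) * (stageCount n par a v + 1) * 300 + 210) + 70)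
    (by omega)
  · refine .seq_asg (.seq_asg (.seq_asg (.seq_asg (.seq_asg (.seq_asg (.seq_asg (.seq_asg (.asg ?_
      le_rfl) le_rfl) le_rfl) le_rfl) le_rfl) le_rfl) le_rfl) le_rfl) (by simp [NatExpr.cost])
    simp [ht.vertices, h11, hp, hs, h.table (par v) (by omega), h.table v (by omega),
      h.count (par v) (by omega), h.count v (by omega), ht.base _ (show n + v ≤ n + n by omega),
      ht.base _ (show stageTable n par a (par v) ≤ n + n by omega),
      ht.base _ (show stageTable n par a v ≤ n + n by omega), ht.pow _ hsl.le, ht.rowQ _ hsl]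
    omega
  obtain ⟨v12, v11, v31, v32, v33, v34, v35, v36, v25, v26⟩ := h₁
  have v40 := (hF₁.natVar 40 (by omega) rfl).trans h40
  have t₁ := ht.of_frame hF₁
  refine .seq (Tri.forUp_const (2 ^ T) (TableState n T (s.realArr 1) (s.natArr 20) (s.natArr 21)
    (n + v) (stageTable n par a (par v)) (stageTable n par a v) (slot v)
    (stageCount n par a (par v)) (stageCount n par a v))
    ((stageCount n par a (par v) + 1) * (stageCount n par a v + 1) * 300 + 200) t₁.masks ?_
    (fun m hm s₂ hm₂ hI hF₂ => ?_) le_rfl) (B₂ := 40) (fun s₂ h₂ hF₂ => .seq_put (B' := 20) (.put ?_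
    (by simp [NatExpr.cost])) (by simp [NatExpr.cost])) (by linarith)
  · exact ⟨fun x _ => ⟨congrFun (hF₁.realArr 1 rfl) x, congrFun (hF₁.natArr 20 rfl) x,
      congrFun (hF₁.natArr 21 rfl) x⟩, fun m hm => absurd hm (Nat.not_lt_zero m)⟩
  · exact (rowProg_spec (t₁.of_frame hF₂) hm hsl hm₂ ((hF₂.natVar 25 (by omega) rfl).trans v25)
      ((hF₂.natVar 26 (by omega) rfl).trans v26) ((hF₂.natVar 31 (by omega) rfl).trans v31)
      ((hF₂.natVar 32 (by omega) rfl).trans v32) ((hF₂.natVar 33 (by omega) rfl).trans v33)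
      ((hF₂.natVar 34 (by omega) rfl).trans v34) ((hF₂.natVar 35 (by omega) rfl).trans v35)
      ((hF₂.natVar 36 (by omega) rfl).trans v36) ((hF₂.natVar 40 (by omega) rfl).trans v40) hpq
      (by omega) (by omega)).mono le_rfl
      (fun s₃ h₃ _ => hI.succ hm hsl hpq (by omega) (by omega) ⟨h₃.outside, h₃.row⟩)
  · have w0 := (hF₂.natVar 0 (by omega) rfl).trans t₁.vertices
    have w11 := (hF₂.natVar 11 (by omega) rfl).trans v11
    have w12 := (hF₂.natVar 12 (by omega) rfl).trans v12
    have w36 := (hF₂.natVar 36 (by omega) rfl).trans v36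
    have w18 := (hF₂.natArr 18 rfl).trans (hF₁.natArr 18 rfl)
    have w19 := (hF₂.natArr 19 rfl).trans (hF₁.natArr 19 rfl)
    refine h.succ E ha hv (fun j => ?_) (fun j => ?_) ⟨fun x hx => ?_, h₂.row⟩
    · simp [w0, w11, w12, w18, Function.update_apply]
    · simp only [NatExpr.eval, w12, w36, w19, State.setA_natArr, Function.update_apply,
        State.setA_natVar, if_true]
      norm_num
      split_ifs with hj
      · rw [hj]
      · rfl
    · exact h₂.outside x hx

theorem mergeProg_spec (ht : RepTables n T s) (E : Elimination n T P par slot)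
    (hp : s.natArr 11 = par) (hs : s.natArr 10 = slot) (h : RepMerge n T ω par slot 0 s) :
    Tri mergeProg s (2 ^ T * ((n + 1) ^ 2 * 300 + n * 210) + n * 170 + 20)
      (RepMerge n T ω par slot n) := by
  refine .seq_asg (B' := 2 ^ T * ((n + 1) ^ 2 * 300 + n * 210) + n * 170 + 10) (Tri.forUp n
    (RepMerge n T ω par slot) (fun a => 2 ^ T * ((stageCount n par a (par (n - a)) + 1) *
    (stageCount n par a (n - a) + 1) * 300 + 210) + 160) ?_ ?_ (fun a ha s₁ ha₁ hI hF => ?_) ?_)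
    (by simp only [NatExpr.cost]; omega)
  · simp [ht.vertices]
  · exact ⟨h.1, h.2, h.3, h.4⟩
  · have t₁ : RepTables n T s₁ := RepTables.of_frame (s := s.setN 40 2)
      ⟨ht.1, ht.2, ht.3, ht.4, ht.5, ht.6, ht.7, ht.8, ht.9⟩ hF
    have v40 := hF.natVar 40 (by omega) rfl
    simp at v40
    have t₂ : RepTables n T (s₁.setN 11 (n - a)) :=
      ⟨t₁.1, t₁.2, t₁.3, t₁.4, t₁.5, t₁.6, t₁.7, t₁.8, t₁.9⟩
    have e : NatExpr.eval s₁ ((NatExpr.var 0).sub (NatExpr.var 10)) = n - a := by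
      simp [t₁.vertices, ha₁]
    refine .seq_asg (B' := 2 ^ T * ((stageCount n par a (par (n - a)) + 1) *
      (stageCount n par a (n - a) + 1) * 300 + 210) + 150) ?_ (by simp only [NatExpr.cost]; omega)
    rw [e]
    exact (mergeStep_spec (v := n - a) t₂ E ((hF.natArr 11 rfl).trans hp)
      ((hF.natArr 10 rfl).trans hs) v40 ⟨hI.1, hI.2, hI.3, hI.4⟩ (by omega) (by omega)
      (by simp)).mono le_rfl (fun s₂ h₂ _ => ⟨h₂.1, h₂.2, h₂.3, h₂.4⟩)
  · simp only [Finset.sum_add_distrib, ← Finset.mul_sum, ← Finset.sum_mul, Finset.sum_const,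
      Finset.card_range, smul_eq_mul]
    -- The costs of the single merges differ; only their sum is quadratic, by the potential
    -- argument.
    have := sum_stageCount_mul_le E
    have := Nat.mul_le_mul_left (2 ^ T) (Nat.add_le_add_right (Nat.mul_le_mul_right 300 this)
      (n * 210))
    omega

end MergeAll

/-! ### The program that reconstructs an optimal bisection -/

/-- Store half the number of vertices, rounded up, in variable `41`. -/
def halfProg : Prog :=
  .seq (asg 41 (.lit 0))
    (repeatWhile (.lt (.add (.var 41) (.var 41)) (.var 0)) (asg 41 (.add (.var 41) (.lit 1))))

/-- Fetch what is needed to colour the position in variable `11`. -/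
def fetchColourProg : Prog :=
  .seq (asg 12 (.get 11 (.var 11))) (.seq (asg 13 (.get 22 (.var 12)))
    (.seq (asg 23 (.get 23 (.var 12)))
      (.seq (asg 30 (.add (.get 14 (.add (.var 0) (.var 11))) (.add (.get 13 (.var 13)) (.var 23))))
        (.seq (asg 21 (.sub (.get 20 (.var 30)) (.lit 1))) (.seq (asg 24 (.get 21 (.var 30)))
          (.seq (asg 25 (.get 17 (.get 10 (.var 11)))) (asg 26 (.get 15 (.get 10 (.var 11))))))))))

/-- Colour the position in variable `11`. -/
def traceStep : Prog :=
  .seq fetchColourProg (.seq setBitProg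
    (.seq (put 23 (.var 12) (.sub (.sub (.var 23) (.var 21)) (.var 24)))
      (.seq (put 23 (.var 11) (.var 24)) (.seq (put 22 (.var 11) (.var 22))
        (put 24 (.var 11) (.var 21))))))

/-- Colour all positions. -/
def traceProg : Prog :=
  .seq halfProg (.seq (put 22 (.lit 0) (.lit 0)) (.seq (put 23 (.lit 0) (.var 41))
    (.seq (forUp 10 0 (.seq (asg 11 (.add (.var 10) (.lit 1))) traceStep))
      (forUp 10 0 (put 3 (.var 10) (.get 24 (.get 6 (.var 10))))))))

section Trace

variable {n T : ℕ} {s : State} {P : ℕ → Finset ℕ} {par slot pos : ℕ → ℕ} {V : ℕ → ℕ → ℕ → ℝ}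
  {B C : ℕ → ℕ → ℕ → ℕ} {k v : ℕ}

/-- In place of division, `j` is incremented while 2j < n, which stops at ⌈n/2⌉. -/
theorem halfProg_spec (h : s.natVar 0 = n) :
    Tri halfProg s (n * 20 + 20) (fun s' => s'.natVar 41 = (n + 1) / 2) := by
  refine .seq_asg (Tri.mono (Tri.repeatWhile ((n + 1) / 2) (fun j s' => s'.natVar 41 = j)
    (fun _ => 5) ?_ (fun j hj s₁ hI hF => ⟨?_, .asg ?_ ?_⟩) (fun s₁ hI hF => ?_)) le_rfl
    (fun _ h _ => h)) ?_
  · simp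
  · have := hF.natVar 0 (by omega) rfl
    simp [h] at this
    simp [this, hI]
    omega
  · simp [hI]
  · simp [NatExpr.cost]
  · have := hF.natVar 0 (by omega) rfl
    simp [h] at this
    simp [this, hI]
    omega
  · simp [NatExpr.cost, BoolExpr.cost]
    omega

theorem traceStep_spec (ht : RepTables n T s) (E : Elimination n T P par slot)
    (hp : s.natArr 11 = par) (hs : s.natArr 10 = slot)
    (hB : (fun j m k => s.natArr 20 (addr n T j m k)) = B)
    (hC : (fun j m k => s.natArr 21 (addr n T j m k)) = C)
    (hmerge : IsMerged n T par slot V B C (v + 1))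
    (h : IsTrace n T P par slot V k (s.natArr 22) (s.natArr 23) (s.natArr 24) v) (hv : v < n)
    (h11 : s.natVar 11 = v + 1) :
    Tri traceStep s 120 (fun s' =>
      IsTrace n T P par slot V k (s'.natArr 22) (s'.natArr 23) (s'.natArr 24) (v + 1)) := by
  have hpv := E.par_lt (v + 1) (by omega) (by omega)
  have hsl := E.slot_lt (v + 1) (by omega) (by omega)
  have hm := h.mask_lt (par (v + 1)) (by omega)
  set m := s.natArr 22 (par (v + 1)) with hm'
  set l := s.natArr 23 (par (v + 1)) with hl'
  have e₁ : s.natArr 20 ((n + (v + 1)) * (2 ^ T * (n + 1)) + (m * (n + 1) + l)) =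
      B (n + (v + 1)) m l := by simp only [← hB, addr, Nat.add_assoc]
  have e₂ : s.natArr 21 ((n + (v + 1)) * (2 ^ T * (n + 1)) + (m * (n + 1) + l)) =
      -- This and the preceding equation match the address computed by `fetchColourProg` with
      -- `addr`; the two differ only in bracketing.
      C (n + (v + 1)) m l := by simp only [← hC, addr, Nat.add_assoc]
  refine .seq (B₁ := 60) (B₂ := 60) (R := fun s' => s'.natVar 12 = par (v + 1) ∧
    s'.natVar 11 = v + 1 ∧ s'.natVar 13 = m ∧ s'.natVar 23 = l ∧
    s'.natVar 21 = B (n + (v + 1)) m l - 1 ∧ s'.natVar 24 = C (n + (v + 1)) m l ∧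
    s'.natVar 25 = 2 ^ slot (v + 1) ∧ s'.natVar 26 = slot (v + 1) * 2 ^ T) ?_
    (fun s₁ h₁ hF₁ => ?_) le_rfl
  · refine .seq_asg (.seq_asg (.seq_asg (.seq_asg (.seq_asg (.seq_asg (.seq_asg (.asg ?_
      le_rfl) le_rfl) le_rfl) le_rfl) le_rfl) le_rfl) le_rfl) (by simp [NatExpr.cost])
    simp [ht.vertices, h11, hp, hs, ht.base (n + (v + 1)) (by omega), ← hm', ← hl', ht.rowM _ hm,
      e₁, e₂, ht.pow _ hsl.le, ht.rowQ _ hsl]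
  obtain ⟨v12, v11, v13, v23, v21, v24, v25, v26⟩ := h₁
  refine .seq (setBitProg_spec (ht.of_frame hF₁) hm hsl v13 v21 v25 v26) (B₂ := 30)
    (fun s₂ h₂ hF₂ => ?_) le_rfl
  have w11 := (hF₂.natVar 11 (by omega) rfl).trans v11
  have w12 := (hF₂.natVar 12 (by omega) rfl).trans v12
  have w21 := (hF₂.natVar 21 (by omega) rfl).trans v21
  have w23 := (hF₂.natVar 23 (by omega) rfl).trans v23
  have w24 := (hF₂.natVar 24 (by omega) rfl).trans v24
  have a22 := (hF₂.natArr 22 rfl).trans (hF₁.natArr 22 rfl)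
  have a23 := (hF₂.natArr 23 rfl).trans (hF₁.natArr 23 rfl)
  have a24 := (hF₂.natArr 24 rfl).trans (hF₁.natArr 24 rfl)
  refine .seq_put (.seq_put (.seq_put (.put ?_ le_rfl) le_rfl) le_rfl) (by simp [NatExpr.cost])
  refine h.succ E hv hmerge (fun j => ?_) (fun j => ?_) (fun j _ _ => ?_)
  · simp [w11, h₂, a22, Function.update_apply, ← hm', ← hl']
  · simp [w11, w12, w21, w23, w24, a23, Function.update_apply, ← hm', ← hl']
    split_ifs with h₁ h₂
    · rfl
    · rw [h₂]
    · rfl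
  · simp [w11, w21, a24, Function.update_apply, ← hm', ← hl']

theorem traceProg_spec (ht : RepTables n T s) (E : Elimination n T P par slot)
    (hp : s.natArr 11 = par) (hs : s.natArr 10 = slot)
    (hmerge : ∀ v, 1 ≤ v → v ≤ n → IsMerged n T par slot V
      (fun j m k => s.natArr 20 (addr n T j m k)) (fun j m k => s.natArr 21 (addr n T j m k)) v) :
    Tri traceProg s (n * 200 + 100) (fun s' => ∃ M r y,
      IsTrace n T P par slot V ((n + 1) / 2) M r y n ∧
      ∀ u < n, s'.natArr 3 u = y (s.natArr 6 u)) := by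
  refine .seq (halfProg_spec ht.vertices) (B₂ := n * 180 + 80) (fun s₁ h₁ hF₁ => ?_) (by omega)
  refine .seq_put (B' := n * 180 + 70) (.seq_put (B' := n * 180 + 60) ?_
    (by simp only [NatExpr.cost]; omega)) (by simp only [NatExpr.cost]; omega)
  generalize hs₂ : State.setA _ _ _ _ = s₂
  have t₁ := ht.of_frame hF₁
  have t₂ : RepTables n T s₂ := by
    rw [← hs₂]
    exact ⟨t₁.1, t₁.2, t₁.3, t₁.4, t₁.5, t₁.6, t₁.7, t₁.8, t₁.9⟩
  have a6 : s₂.natArr 6 = s.natArr 6 := by rw [← hs₂]; exact hF₁.natArr 6 rfl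
  have a10 : s₂.natArr 10 = slot := by rw [← hs₂]; exact (hF₁.natArr 10 rfl).trans hs
  have a11 : s₂.natArr 11 = par := by rw [← hs₂]; exact (hF₁.natArr 11 rfl).trans hp
  have a20 : s₂.natArr 20 = s.natArr 20 := by rw [← hs₂]; exact hF₁.natArr 20 rfl
  have a21 : s₂.natArr 21 = s.natArr 21 := by rw [← hs₂]; exact hF₁.natArr 21 rfl
  have a22 : s₂.natArr 22 0 = 0 := by simp [← hs₂]
  have a23 : s₂.natArr 23 0 = (n + 1) / 2 := by simp [← hs₂, h₁]
  refine .seq (Tri.forUp_const n (fun j s' => IsTrace n T P par slot V ((n + 1) / 2)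
    (s'.natArr 22) (s'.natArr 23) (s'.natArr 24) j) 125 t₂.vertices (isTrace_zero E (by omega) a22
    a23) (fun j hj s₃ hj₃ hI hF₃ => ?_) le_rfl) (B₂ := n * 30 + 10) (fun s₃ h₃ hF₃ => ?_) (by omega)
  · have t₃ := t₂.of_frame hF₃
    have e : NatExpr.eval s₃ ((NatExpr.var 10).add (NatExpr.lit 1)) = j + 1 := by simp [hj₃]
    refine .seq_asg (B' := 120) ?_ (by simp [NatExpr.cost])
    rw [e]
    exact traceStep_spec (s := s₃.setN 11 (j + 1))
      ⟨t₃.1, t₃.2, t₃.3, t₃.4, t₃.5, t₃.6, t₃.7, t₃.8, t₃.9⟩ E ((hF₃.natArr 11 rfl).trans a11)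
      ((hF₃.natArr 10 rfl).trans a10) (by simp [hF₃.natArr 20 rfl, a20])
      (by simp [hF₃.natArr 21 rfl, a21]) (hmerge (j + 1) (by omega) (by omega)) hI hj (by simp)
  · refine Tri.mono (Tri.forUp_const n (fun j s' => ∀ u < j, s'.natArr 3 u =
      s₃.natArr 24 (s.natArr 6 u)) 9 (t₂.of_frame hF₃).vertices (by omega)
      (fun j hj s₄ hj₄ hI hF₄ => .put (fun u hu => ?_) (by simp [NatExpr.cost])) le_rfl) (by omega)
      (fun s₄ h₄ _ => ⟨_, _, _, h₃, h₄⟩)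
    have b6 := (hF₄.natArr 6 rfl).trans ((hF₃.natArr 6 rfl).trans a6)
    have b24 := hF₄.natArr 24 rfl
    simp only [NatExpr.eval, hj₄, b6, b24, State.setN_natArr, State.setA_natArr, if_true,
      Function.update_apply]
    split_ifs with hu'
    · rw [hu']
    · exact hI u (by omega)

end Trace

/-! ### The whole program -/

/-- The program for Max Bisection, or for Min Bisection if `neg` holds. -/
def mainProg (neg : Bool) : Prog :=
  .seq orderProg (.seq discoverProg (.seq elimProg (.seq tablesProg (.seq (initProg neg)
    (.seq mergeProg traceProg)))))

section Main

variable {n N t T : ℕ} {G : SimpleGraph (Fin n)} {D : TreeDecomposition G N} {w : G.edgeSet → ℝ}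
  {neg : Bool} {s : State} {rank : Fin N → ℕ} {pos : Fin n → ℕ} {top : Fin n → Fin N}

theorem positionWeight_pos {vertex : ℕ → ℕ} (hv : ∀ u : Fin n, vertex (pos u) = u) (u v : Fin n) :
    positionWeight w neg vertex (pos u) (pos v) = weightSign neg * pairWeight w u v := by
  rw [positionWeight, hv, hv, weightArray_apply]

/-- The part of the program that computes with the weights. -/
theorem weightsProg_spec (H : IsDiscovery D rank pos top)
    (hrank : ∀ i, i ≠ D.tree.root → rank (D.tree.parent i) < rank i)
    (hinj : Function.Injective rank) (hp : RepPos pos top s) (he : RepElim D pos top t n s)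
    (ht : RepTables n T s) (hw : s.realArr 0 = weightArray w) :
    Tri (.seq (initProg neg) (.seq mergeProg traceProg)) s
      (2 ^ T * ((n + 1) ^ 2 * 600) + (n + 1) * 1000)
      (fun s' => IsBisection (outputSet n s') (outputSet n s')ᶜ ∧ ∀ A B, IsBisection A B →
        weightSign neg * cutWeight w A B ≤
          weightSign neg * cutWeight w (outputSet n s') (outputSet n s')ᶜ) := by
  have hT := ht.slots
  have E : Elimination n T (earlier D pos top) (s.natArr 11) (s.natArr 10) :=
    H.elimination hrank hinj he.par (fun c h₁ h₂ => he.slot_ne c h₁ h₂)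
      (fun c h₁ h₂ => hT ▸ he.slot_lt c h₁ h₂)
  have hW : RepWeights w T (s.natArr 7) (s.natArr 10) s := by
    refine ⟨hw, rfl, rfl, fun c h₁ h₂ => ?_, E.slot_lt⟩
    obtain ⟨u, rfl⟩ := H.exists_pos_eq h₁ h₂
    rw [(hp u).2.1]
    exact u.2
  have hω := positionWeight_pos (w := w) (neg := neg) (fun u => (hp u).2.1)
  have hω₀ : ∀ j, 1 ≤ j → j ≤ n → ∀ u, 1 ≤ u → u < j → u ∉ earlier D pos top j →
      positionWeight w neg (s.natArr 7) u j = 0 := by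
    intro j h₁ h₂ u h₃ h₄ hu
    obtain ⟨u, rfl⟩ := H.exists_pos_eq h₃ (h₄.le.trans h₂)
    obtain ⟨v, rfl⟩ := H.exists_pos_eq h₁ h₂
    rw [hω, pairWeight, dif_neg fun h => hu (H.mem_earlier_of_adj hrank hinj h h₄), mul_zero]
  have hB₁ : (n + 1) * (2 ^ T * (n * 50 + 30) + 40) ≤
      2 ^ T * ((n + 1) ^ 2 * 50) + (n + 1) * 40 := by
    have := Nat.mul_le_mul_left (2 ^ T * (n + 1)) (show n * 50 + 30 ≤ (n + 1) * 50 by omega)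
    linarith
  have hB₂ : 2 ^ T * ((n + 1) ^ 2 * 300 + n * 210) ≤ 2 ^ T * ((n + 1) ^ 2 * 510) :=
    Nat.mul_le_mul_left _ (by nlinarith)
  refine .seq (initProg_spec ht hW) (B₂ := 2 ^ T * ((n + 1) ^ 2 * 550) + (n + 1) * 900)
    (fun s₁ h₁ hF₁ => ?_) (by linarith)
  have t₁ : RepTables n T s₁ :=
    ht.of_frame hF₁ (by cases neg <;> decide) (by cases neg <;> decide)
  have b₆ := hF₁.natArr 6 (by cases neg <;> decide)
  have b₁₁ := hF₁.natArr 11 (by cases neg <;> decide)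
  have b₁₀ := hF₁.natArr 10 (by cases neg <;> decide)
  refine .seq (mergeProg_spec t₁ E b₁₁ b₁₀ (ω := positionWeight w neg (s.natArr 7))
    ⟨fun j hj => h₁.table j (by omega), fun j hj => h₁.count j (by omega),
      fun j hj => h₁.value j (by omega), fun v h h' => by omega⟩) (B₂ := (n + 1) * 600)
    (fun s₂ h₂ hF₂ => ?_) (by linarith [Nat.zero_le (2 ^ T * (n + 1) ^ 2)])
  refine (traceProg_spec (t₁.of_frame hF₂) E ((hF₂.natArr 11 rfl).trans b₁₁)
    ((hF₂.natArr 10 rfl).trans b₁₀) (fun v h h' => h₂.merged v (by omega) h')).mono (by omega) ?_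
  rintro s₃ ⟨M, r, y, h₃, h₄⟩ hF₃
  rw [hF₂.natArr 6 rfl, b₆] at h₄
  have hV := h₂.value
  obtain ⟨e₁, e₂⟩ := h₃.sum_localWeight_eq hω₀ hV
  refine H.isBisection w hω (fun u => h₃.color_lt _ (H.pos_pos u) (H.pos_le u)) e₂
    -- Optimality: the root entry for ⌈n/2⌉ ones bounds every competing colouring, and the
    -- reconstructed one attains it.
    (fun y' hy' hs => ?_) ?_
  · rw [e₁, ← hs]
    exact sum_localWeight_le E hω₀ hV (fun v h h' => h₂.merged v (by omega) h') hy'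
  · ext u
    simp [outputSet, h₄ u u.2, (hp u).1]

/-- Bounds for the running times of the parts of the program. -/
theorem le_two_pow_mul {m : ℕ} (hn : 0 < n) (hm : m = max t 1) (hT : T ≤ t + 1) :
    n * (t + 1) ≤ 2 * (2 ^ t * (m * n) ^ 2) ∧ n ≤ 2 ^ t * (m * n) ^ 2 ∧
    T * 2 ^ T ≤ 4 * (2 ^ t * (m * n) ^ 2) ∧ T ≤ 2 * (2 ^ t * (m * n) ^ 2) ∧
    2 ^ T ≤ 2 * (2 ^ t * (m * n) ^ 2) ∧ 2 ^ T * (n + 1) ^ 2 ≤ 8 * (2 ^ t * (m * n) ^ 2) := by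
  have hm₁ : 1 ≤ m := by omega
  have ht : t + 1 ≤ 2 * m := by omega
  have hp : 1 ≤ 2 ^ t := Nat.one_le_two_pow
  have hT₂ : 2 ^ T ≤ 2 * 2 ^ t := by
    rw [← pow_succ']
    exact Nat.pow_le_pow_right (by omega) hT
  have hz : 1 ≤ m * n := Nat.mul_pos hm₁ hn
  have hnz : n ≤ m * n := Nat.le_mul_of_pos_left n hm₁
  have hmz : m ≤ m * n := Nat.le_mul_of_pos_right m hn
  have htz : n * (t + 1) ≤ 2 * (m * n) := by
    have := Nat.mul_le_mul_left n ht
    linarith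
  generalize m * n = z at *
  generalize 2 ^ t = p at *
  have hzz : z ≤ z ^ 2 := Nat.le_self_pow (by omega) z
  have hpz : z ^ 2 ≤ p * z ^ 2 := Nat.le_mul_of_pos_left _ hp
  have hpz' : p * z ≤ p * z ^ 2 := Nat.mul_le_mul_left p hzz
  have hpp : p ≤ p * z := Nat.le_mul_of_pos_right _ hz
  refine ⟨by omega, by omega, ?_, by omega, by omega, ?_⟩
  · calc T * 2 ^ T ≤ (2 * z) * (2 * p) := Nat.mul_le_mul (by omega) hT₂
      _ = 4 * (p * z) := by ring
      _ ≤ _ := by omega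
  · calc 2 ^ T * (n + 1) ^ 2 ≤ (2 * p) * (2 * z) ^ 2 :=
          Nat.mul_le_mul hT₂ (Nat.pow_le_pow_left (by omega) 2)
      _ = 8 * (p * z ^ 2) := by ring

theorem mainProg_spec (hw : D.width = t) :
    Tri (mainProg neg) (inputState w D)
      (50000 * (2 ^ t * (max t 1 * n) ^ 2 + max t 1 * N))
      (fun s' => IsBisection (outputSet n s') (outputSet n s')ᶜ ∧ ∀ A B, IsBisection A B →
        weightSign neg * cutWeight w A B ≤
          weightSign neg * cutWeight w (outputSet n s') (outputSet n s')ᶜ) := by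
  have hn := D.pos_of_width hw
  have hN : 0 < N := D.tree.root.pos
  have h₀ : RepInput D (inputState w D) :=
    ⟨rfl, rfl, fun i => D.parentArray_apply i, rfl, rfl⟩
  set m := max t 1 with hm
  set X := 2 ^ t * (m * n) ^ 2 with hX
  have hY : N * (t + 1) ≤ 2 * (m * N) := by
    have := Nat.mul_le_mul_right N (show t + 1 ≤ 2 * m by omega)
    linarith
  have hY' : N ≤ m * N := Nat.le_mul_of_pos_left _ (by omega)
  obtain ⟨x₁, x₂, -⟩ := le_two_pow_mul (T := 0) hn hm (by omega)
  rw [← hX] at x₁ x₂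
  refine .seq (orderProg_spec (T := D.tree) h₀.nodes h₀.parent rfl)
    (B₂ := 40000 * X + 40000 * (m * N)) (fun s₁ ⟨l, hlen, hl, hrank, ho⟩ hF₁ => ?_) (by linarith)
  have hinj : Function.Injective fun i => l.idxOf i := by
    have hmem : ∀ i, i ∈ l := by
      intro i
      have : l.toFinset = Finset.univ := Finset.eq_univ_of_card _ (by
        rw [List.toFinset_card_of_nodup hl, hlen, Fintype.card_fin])
      exact List.mem_toFinset.1 (this ▸ Finset.mem_univ i)
    exact fun i j h => (List.idxOf_inj (hmem i)).1 h
  have i₁ := h₀.of_frame hF₁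
  refine .seq (discoverProg_spec hw i₁ (hF₁.natArr 6 rfl) hlen hl ho)
    (B₂ := 40000 * X) (fun s₂ ⟨pos, top, H, hp⟩ hF₂ => ?_) (by linarith)
  have i₂ := i₁.of_frame hF₂
  refine .seq (elimProg_spec hw i₂ hp H ((hF₂.natArr 9 rfl).trans (hF₁.natArr 9 rfl)))
    (B₂ := 30000 * X) (fun s₃ h₃ hF₃ => ?_) (by linarith)
  have i₃ := i₂.of_frame hF₃
  obtain ⟨-, -, y₁, y₂, y₃, y₄⟩ := le_two_pow_mul hn hm h₃.le
  rw [← hX] at y₁ y₂ y₃ y₄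
  -- The program is not told `t`. It uses the number of slots found in variable `3`, which the
  -- greedy colouring keeps at most `t + 1`.
  refine .seq (tablesProg_spec i₃.vertices rfl) (B₂ := 20000 * X) (fun s₄ h₄ hF₄ => ?_)
    (by linarith)
  have v₃ := h₄.slots
  refine (weightsProg_spec (neg := neg) H hrank hinj ((RepPos.of_frame hp hF₃).of_frame hF₄)
    (t := t) ⟨?_, ?_, ?_, ?_, ?_⟩ h₄ ?_).mono (by linarith) (fun s₅ h₅ _ => h₅)
  · rw [hF₄.natArr 11 rfl]; exact h₃.par
  · rw [hF₄.natArr 10 rfl]; exact h₃.slot_ne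
  · rw [hF₄.natArr 10 rfl, v₃]; exact h₃.slot_lt
  · rw [v₃]; exact h₃.le
  · rw [hF₄.natArr 9 rfl]; exact h₃.mark_le
  · rw [hF₄.realArr 0 rfl, hF₃.realArr 0 rfl, hF₂.realArr 0 rfl, hF₁.realArr 0 rfl]
    rfl

/-- Scratch registers are variables, so agreement up to them preserves the arrays and with them the
output set. -/
theorem exists_run_mainProg (neg : Bool) (w : G.edgeSet → ℝ) (hw : D.width = t) :
    ∃ (k : ℕ) (s : State), Run (mainProg neg) (inputState w D) k s ∧
      k ≤ 50000 * (2 ^ t * (max t 1 * n) ^ 2 + max t 1 * N) ∧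
      IsBisection (outputSet n s) (outputSet n s)ᶜ ∧ ∀ A B, IsBisection A B →
        weightSign neg * cutWeight w A B ≤
          weightSign neg * cutWeight w (outputSet n s) (outputSet n s)ᶜ := by
  obtain ⟨k, s, s', hr, hk, hs, h⟩ := (mainProg_spec (neg := neg) (w := w) hw).exists_run
  have : outputSet n s = outputSet n s' := by rw [outputSet, outputSet, hs.natArr]
  exact ⟨k, s, hr, hk, this ▸ h⟩

end Main

end Bisection

theorem mainTheorem1 :
    (∃ (P : Bisection.RealRAM.Prog) (C : ℕ),
      ∀ (n N t : ℕ) (G : SimpleGraph (Fin n)) (w : G.edgeSet → ℝ)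
        (D : Bisection.TreeDecomposition G N), D.width = (t : ℤ) →
        ∃ (k : ℕ) (s : Bisection.RealRAM.State),
          Bisection.RealRAM.Run P (Bisection.inputState w D) k s ∧
          k ≤ C * (2 ^ t * (max t 1 * n) ^ 2 + max t 1 * N) ∧
          Bisection.IsMaxBisection w (Bisection.outputSet n s) (Bisection.outputSet n s)ᶜ) ∧
    (∃ (P : Bisection.RealRAM.Prog) (C : ℕ),
      ∀ (n N t : ℕ) (G : SimpleGraph (Fin n)) (w : G.edgeSet → ℝ)
        (D : Bisection.TreeDecomposition G N), D.width = (t : ℤ) →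
        ∃ (k : ℕ) (s : Bisection.RealRAM.State),
          Bisection.RealRAM.Run P (Bisection.inputState w D) k s ∧
          k ≤ C * (2 ^ t * (max t 1 * n) ^ 2 + max t 1 * N) ∧
          Bisection.IsMinBisection w (Bisection.outputSet n s) (Bisection.outputSet n s)ᶜ) ∧
    (∀ K : ℕ, ∃ C : ℕ,
      ∀ (n N t : ℕ) (G : SimpleGraph (Fin n)) (D : Bisection.TreeDecomposition G N),
        D.IsNice → D.width = (t : ℤ) → N ≤ K * n →
        D.joinSum ≤ C * (max t 1 * n) ^ 2) := by
  -- A maximum for the weights multiplied by `weightSign true`, that is by −1, is a minimum for the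
  -- original weights.
  refine ⟨⟨Bisection.mainProg false, 50000, fun n N t G w D hw => ?_⟩,
    ⟨Bisection.mainProg true, 50000, fun n N t G w D hw => ?_⟩,
    fun K => ⟨4 * K ^ 2, fun n N t G D _ hw hN => D.joinSum_le_of_nodes_le hw hN⟩⟩
  · obtain ⟨k, s, hr, hk, hb, h⟩ := Bisection.exists_run_mainProg false w hw
    exact ⟨k, s, hr, hk, hb, fun A B hA => by simpa [Bisection.weightSign] using h A B hA⟩
  · obtain ⟨k, s, hr, hk, hb, h⟩ := Bisection.exists_run_mainProg true w hw
    exact ⟨k, s, hr, hk, hb, fun A B hA => by simpa [Bisection.weightSign] using h A B hA⟩
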